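/- All varieties are algebraic varieties over $\mathbb{C}$. A linear action of a group on $\mathbb{A}^3=\mathbb{C}^3$ is one given by a group homomorphism to $\mathrm{GL}_3(\mathbb{C})$. **(1)** Let $\Gamma$ be a rational smooth affine curve. There exist a closed embedding $\tau\colon\Gamma\to\mathbb{A}^3$ and a linear action of $\mathrm{Aut}(\Gamma)$ on $\mathbb{A}^3$ that preserves $\tau(\Gamma)$ and such that $\tau$ is $\mathrm{Aut}(\Gamma)$-equivariant. The embedding and the action can be taken as follows. **(2)** For $\Gamma=\mathbb{A}^1$, $\mathrm{Aut}(\Gamma)$ consists of the maps $t\mapsto at+b$ with $a\in\mathbb{C}^*$, $b\in\mathbb{C}$. The map $\tau(t)=(t,1,0)$ is a closed embedding, and it is equivariant for the linear action in which $t\mapsto at+b$ acts by $(x,y,z)\mapsto(ax+by,y,z)$. **(3)** For $\Gamma=\mathbb{C}^*$, $\mathrm{Aut}(\Gamma)$ consists of the maps $\varphi_\lambda\colon t\mapsto\lambda t$ and $\psi_\lambda\colon t\mapsto\lambda t^{-1}$ with $\lambda\in\mathbb{C}^*$. The map $\tau(t)=(t,t^{-1},0)$ is a closed embedding, and it is equivariant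 for the linear action in which $\varphi_\lambda$ acts by $(x,y,z)\mapsto(\lambda x,\lambda^{-1}y,z)$ and $\psi_\lambda$ acts by $(x,y,z)\mapsto(\lambda y,\lambda^{-1}x,z)$. **(4)** Let $\Delta\subset\mathbb{P}^1\times\mathbb{P}^1$ be the diagonal. The map $$\iota\colon(\mathbb{P}^1\times\mathbb{P}^1)\setminus\Delta\to\mathbb{A}^3,\quad([y_0:y_1],[z_0:z_1])\mapsto\left(\frac{y_0z_1+y_1z_0}{y_0z_1-y_1z_0},\frac{2y_0z_0}{y_0z_1-y_1z_0},\frac{2y_1z_1}{y_0z_1-y_1z_0}\right)$$ is a closed embedding whose image is the quadric $yz=x^2-1$. It is $\mathrm{PGL}(2,\mathbb{C})$-equivariant for the diagonal action on $(\mathbb{P}^1\times\mathbb{P}^1)\setminus\Delta$ and the linear action on $\mathbb{A}^3$ in which the class of $\begin{pmatrix}a&b\\c&d\end{pmatrix}$ acts by the matrix $$\frac{1}{ad-bc}\begin{pmatrix}ad+bc&ac&bd\\2ab&a^2&b^2\\2cd&c^2&d^2\end{pmatrix}.$$ Let $\Lambda\subset\mathbb{P}^1$ be a finite set of at least $3$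 points, let $\Gamma=\mathbb{P}^1\setminus\Lambda$, and let $H=\{h\in\mathrm{PGL}(2,\mathbb{C})\mid h(\Lambda)=\Lambda\}$. Then every automorphism of $\Gamma$ is the restriction of a unique element of $H$, and this gives an isomorphism $\mathrm{Aut}(\Gamma)\cong H$. There exists an $H$-equivariant morphism $\delta\colon\mathbb{P}^1\to\mathbb{P}^1$ with $\{q\in\mathbb{P}^1\mid\delta(q)=q\}=\Lambda$. For every such $\delta$ the map $\tau\colon\Gamma\to\mathbb{A}^3$, $q\mapsto\iota(q,\delta(q))$, is a closed embedding, the linear action of $\mathrm{Aut}(\Gamma)\cong H\subset\mathrm{PGL}(2,\mathbb{C})$ on $\mathbb{A}^3$ above preserves $\tau(\Gamma)$, and $\tau$ is $\mathrm{Aut}(\Gamma)$-equivariant. -/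

import Mathlib

open scoped LinearAlgebra.Projectivization Matrix MatrixGroups Topology Pointwise

/-- A space with functions over `ℂ` (the classical language of complex varieties): a topological
space with a sheaf of algebras of `ℂ`-valued functions.  The sheaf is recorded by the relation
`RegAt f x`, "`f` is regular at `x`"; this depends only on the germ of `f` at `x`, is an open
condition, and a function on an open set `U` is a section of the sheaf over `U` when it (or rather
any extension of it) is regular at all points of `U`.  As usual, `f` regular at `x` with `f x ≠ 0`
is nonzero near `x` and has a regular inverse. -/
structure FunSpace where
  Pt : Type*
  top : TopologicalSpace Pt
  RegAt : (Pt → ℂ) → Pt → Prop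
  regAt_congr : ∀ {f g : Pt → ℂ} {x : Pt}, (∀ᶠ y in 𝓝 x, f y = g y) → RegAt f x → RegAt g x
  regAt_eventually : ∀ {f : Pt → ℂ} {x : Pt}, RegAt f x → ∀ᶠ y in 𝓝 x, RegAt f y
  regAt_const : ∀ (c : ℂ) (x : Pt), RegAt (fun _ => c) x
  regAt_add : ∀ {f g : Pt → ℂ} {x : Pt}, RegAt f x → RegAt g x → RegAt (fun y => f y + g y) x
  regAt_mul : ∀ {f g : Pt → ℂ} {x : Pt}, RegAt f x → RegAt g x → RegAt (fun y => f y * g y) x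
  regAt_ne_zero : ∀ {f : Pt → ℂ} {x : Pt}, RegAt f x → f x ≠ 0 → ∀ᶠ y in 𝓝 x, f y ≠ 0
  regAt_inv : ∀ {f : Pt → ℂ} {x : Pt}, RegAt f x → f x ≠ 0 → RegAt (fun y => (f y)⁻¹) x

namespace FunSpace

instance instTopologicalSpacePt (X : FunSpace) : TopologicalSpace X.Pt := X.top

/-- Morphisms: continuous maps that pull regular functions back to regular functions. -/
def IsMorphism (X Y : FunSpace) (f : X.Pt → Y.Pt) : Prop :=
  Continuous f ∧ ∀ (x : X.Pt) (g : Y.Pt → ℂ), Y.RegAt g (f x) → X.RegAt (fun x' => g (f x')) x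

/-- Closed embeddings: morphisms that are homeomorphisms onto a closed subset, and such that every
function regular at `x` is, near `x`, the pullback of a function regular at `f x`.  In other words
`f` is an isomorphism from `X` onto a closed subspace of `Y` with its induced structure. -/
structure IsClosedEmbedding (X Y : FunSpace) (f : X.Pt → Y.Pt) : Prop where
  isMorphism : IsMorphism X Y f
  isClosedEmbedding : Topology.IsClosedEmbedding f
  exists_extension : ∀ (x : X.Pt) (g : X.Pt → ℂ), X.RegAt g x →
    ∃ h : Y.Pt → ℂ, Y.RegAt h (f x) ∧ ∀ᶠ x' in 𝓝 x, g x' = h (f x')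

theorem isMorphism_id (X : FunSpace) : IsMorphism X X (fun x => x) :=
  ⟨continuous_id, fun _ _ hg => hg⟩

theorem IsMorphism.comp {X Y Z : FunSpace} {g : Y.Pt → Z.Pt} {f : X.Pt → Y.Pt}
    (hg : IsMorphism Y Z g) (hf : IsMorphism X Y f) : IsMorphism X Z (fun x => g (f x)) :=
  ⟨hg.1.comp hf.1, fun x k hk => hf.2 x (fun y => k (g y)) (hg.2 (f x) k hk)⟩

/-- The group `Aut(X)` of automorphisms of `X` (the product is the composition of maps). -/
def Aut (X : FunSpace) : Subgroup (Equiv.Perm X.Pt) where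
  carrier := {φ | IsMorphism X X φ ∧ IsMorphism X X φ.symm}
  one_mem' := ⟨isMorphism_id X, isMorphism_id X⟩
  mul_mem' := fun ha hb => ⟨ha.1.comp hb.1, hb.2.comp ha.2⟩
  inv_mem' := fun ha => ⟨ha.2, ha.1⟩

/-- The induced structure on a subset `S` of `X`: regular functions are locally restrictions of
regular functions of `X`. -/
def restrict (X : FunSpace) (S : Set X.Pt) : FunSpace where
  Pt := S
  top := inferInstance
  RegAt f x := ∃ g : X.Pt → ℂ, X.RegAt g x ∧ ∀ᶠ y : S in 𝓝 x, f y = g y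
  regAt_congr := by
    rintro f g x h ⟨k, hk, hfk⟩
    refine ⟨k, hk, ?_⟩
    filter_upwards [h, hfk] with y h1 h2
    rw [← h1, h2]
  regAt_eventually := by
    rintro f x ⟨k, hk, hfk⟩
    have h1 : ∀ᶠ y : S in 𝓝 x, X.RegAt k y :=
      continuous_subtype_val.continuousAt.eventually (X.regAt_eventually hk)
    filter_upwards [h1, hfk.eventually_nhds] with y hy1 hy2
    exact ⟨k, hy1, hy2⟩
  regAt_const c x := ⟨fun _ => c, X.regAt_const c x, Filter.Eventually.of_forall fun _ => rfl⟩
  regAt_add := by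
    rintro f g x ⟨k, hk, hfk⟩ ⟨l, hl, hgl⟩
    refine ⟨_, X.regAt_add hk hl, ?_⟩
    filter_upwards [hfk, hgl] with y h1 h2
    rw [h1, h2]
  regAt_mul := by
    rintro f g x ⟨k, hk, hfk⟩ ⟨l, hl, hgl⟩
    refine ⟨_, X.regAt_mul hk hl, ?_⟩
    filter_upwards [hfk, hgl] with y h1 h2
    rw [h1, h2]
  regAt_ne_zero := by
    rintro f x ⟨k, hk, hfk⟩ hx
    have h1 : ∀ᶠ y : S in 𝓝 x, k y ≠ 0 :=
      continuous_subtype_val.continuousAt.eventually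
        (X.regAt_ne_zero hk (by rw [← hfk.self_of_nhds]; exact hx))
    filter_upwards [h1, hfk] with y hy1 hy2
    rw [hy2]
    exact hy1
  regAt_inv := by
    rintro f x ⟨k, hk, hfk⟩ hx
    refine ⟨_, X.regAt_inv hk (by rw [← hfk.self_of_nhds]; exact hx), ?_⟩
    filter_upwards [hfk] with y hy
    rw [hy]

/-- Let `c x` be (possibly homogeneous) coordinates of the points `x` of a set `X`, and let `w` give
degrees to the coordinates.  The Zariski topology on `X` is generated by the nonvanishing loci of
the homogeneous polynomials. -/
abbrev zariskiTopology {X σ M : Type*} [AddCommMonoid M] (c : X → σ → ℂ) (w : σ → M) :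
    TopologicalSpace X :=
  TopologicalSpace.generateFrom
    {U | ∃ (m : M) (D : MvPolynomial σ ℂ), MvPolynomial.IsWeightedHomogeneous w D m ∧
      U = {x | MvPolynomial.eval (c x) D ≠ 0}}

theorem eventually_eval_ne_zero {X σ M : Type*} [AddCommMonoid M] (c : X → σ → ℂ) (w : σ → M)
    {m : M} {D : MvPolynomial σ ℂ} (hD : MvPolynomial.IsWeightedHomogeneous w D m) {x : X}
    (hx : MvPolynomial.eval (c x) D ≠ 0) :
    ∀ᶠ y in @nhds X (zariskiTopology c w) x, MvPolynomial.eval (c y) D ≠ 0 :=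
  let _ : TopologicalSpace X := zariskiTopology c w
  IsOpen.mem_nhds (TopologicalSpace.isOpen_generateFrom_of_mem ⟨m, D, hD, rfl⟩) hx

/-- Let `c x` be (possibly homogeneous) coordinates of the points `x` of a set `X`, and let `w` give
degrees to the coordinates.  With the Zariski topology on `X`, a function is regular at a point if
near it it is a quotient of two homogeneous polynomials of the same degree, with a denominator that
does not vanish at the point. -/
def ofCoords {X σ M : Type*} [AddCommMonoid M] (c : X → σ → ℂ) (w : σ → M) : FunSpace where
  Pt := X
  top := zariskiTopology c w
  RegAt f x := ∃ (m : M) (N D : MvPolynomial σ ℂ),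
    MvPolynomial.IsWeightedHomogeneous w N m ∧ MvPolynomial.IsWeightedHomogeneous w D m ∧
    MvPolynomial.eval (c x) D ≠ 0 ∧
    ∀ᶠ y in @nhds X (zariskiTopology c w) x,
      f y = MvPolynomial.eval (c y) N / MvPolynomial.eval (c y) D
  regAt_congr := by
    rintro f g x h ⟨m, N, D, hN, hD, hx, hf⟩
    refine ⟨m, N, D, hN, hD, hx, ?_⟩
    filter_upwards [h, hf] with y h1 h2
    rw [← h1, h2]
  regAt_eventually := by
    rintro f x ⟨m, N, D, hN, hD, hx, hf⟩
    let _ : TopologicalSpace X := zariskiTopology c w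
    have h1 : ∀ᶠ y in 𝓝 x, MvPolynomial.eval (c y) D ≠ 0 :=
      eventually_eval_ne_zero c w hD hx
    filter_upwards [h1, hf.eventually_nhds] with y hy1 hy2
    exact ⟨m, N, D, hN, hD, hy1, hy2⟩
  regAt_const a x :=
    ⟨0, MvPolynomial.C a, 1, MvPolynomial.isWeightedHomogeneous_C w a,
      MvPolynomial.isWeightedHomogeneous_one ℂ w, by simp, Filter.Eventually.of_forall (by simp)⟩
  regAt_add := by
    rintro f g x ⟨m, N, D, hN, hD, hx, hf⟩ ⟨m', N', D', hN', hD', hx', hg⟩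
    let _ : TopologicalSpace X := zariskiTopology c w
    have h1 : ∀ᶠ y in 𝓝 x, MvPolynomial.eval (c y) D ≠ 0 :=
      eventually_eval_ne_zero c w hD hx
    have h2 : ∀ᶠ y in 𝓝 x, MvPolynomial.eval (c y) D' ≠ 0 :=
      eventually_eval_ne_zero c w hD' hx'
    refine ⟨m + m', N * D' + D * N', D * D', (hN.mul hD').add (hD.mul hN'), hD.mul hD',
      by simpa using ⟨hx, hx'⟩, ?_⟩
    filter_upwards [h1, h2, hf, hg] with y hy1 hy2 hy3 hy4
    rw [hy3, hy4, div_add_div _ _ hy1 hy2]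
    simp
  regAt_mul := by
    rintro f g x ⟨m, N, D, hN, hD, hx, hf⟩ ⟨m', N', D', hN', hD', hx', hg⟩
    refine ⟨m + m', N * N', D * D', hN.mul hN', hD.mul hD', by simpa using ⟨hx, hx'⟩, ?_⟩
    filter_upwards [hf, hg] with y hy3 hy4
    rw [hy3, hy4, div_mul_div_comm]
    simp
  regAt_ne_zero := by
    rintro f x ⟨m, N, D, hN, hD, hx, hf⟩ hfx
    let _ : TopologicalSpace X := zariskiTopology c w
    have h0 : MvPolynomial.eval (c x) N ≠ 0 := by
      intro h
      apply hfx
      rw [hf.self_of_nhds, h, zero_div]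
    have h1 : ∀ᶠ y in 𝓝 x, MvPolynomial.eval (c y) D ≠ 0 :=
      eventually_eval_ne_zero c w hD hx
    have h2 : ∀ᶠ y in 𝓝 x, MvPolynomial.eval (c y) N ≠ 0 :=
      eventually_eval_ne_zero c w hN h0
    filter_upwards [h1, h2, hf] with y hy1 hy2 hy3
    rw [hy3]
    exact div_ne_zero hy2 hy1
  regAt_inv := by
    rintro f x ⟨m, N, D, hN, hD, hx, hf⟩ hfx
    let _ : TopologicalSpace X := zariskiTopology c w
    have h0 : MvPolynomial.eval (c x) N ≠ 0 := by
      intro h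
      apply hfx
      rw [hf.self_of_nhds, h, zero_div]
    refine ⟨m, D, N, hD, hN, h0, ?_⟩
    filter_upwards [hf] with y hy
    rw [hy, inv_div]

/-- The `ℂ`-algebra of functions that are regular everywhere on `X`. -/
def functions (X : FunSpace) : Subalgebra ℂ (X.Pt → ℂ) where
  carrier := {f | ∀ x, X.RegAt f x}
  mul_mem' := fun hf hg x => X.regAt_mul (hf x) (hg x)
  add_mem' := fun hf hg x => X.regAt_add (hf x) (hg x)
  algebraMap_mem' := fun a x => X.regAt_const a x

/-- The ideal of the functions in `X.functions` that vanish at `p`. -/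
def idealAt (X : FunSpace) (p : X.Pt) : Ideal X.functions :=
  RingHom.ker ((Pi.evalRingHom (fun _ : X.Pt => ℂ) p).comp X.functions.val.toRingHom)

end FunSpace

/-- Affine `n`-space over `ℂ`: the set `ℂⁿ`, with the Zariski topology and the functions that are
locally quotients of polynomials (all polynomials are homogeneous for the trivial grading). -/
noncomputable def affineSpace (n : ℕ) : FunSpace :=
  FunSpace.ofCoords (X := Fin n → ℂ) (M := Unit) (fun x => x) (fun _ => 0)

/-- The projective line: the set of lines of `ℂ²`, with the Zariski topology and the functions that
are locally quotients of homogeneous polynomials of the same degree (the value of such a quotient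
does not depend on the representative of the point). -/
noncomputable def projLine : FunSpace :=
  FunSpace.ofCoords (X := ℙ ℂ (Fin 2 → ℂ)) (M := ℕ) (fun q => q.rep) (fun _ => 1)

/-- The product of two projective lines, with the topology and functions given by bihomogeneous
polynomials in the two pairs of homogeneous coordinates. -/
noncomputable def projLineSq : FunSpace :=
  FunSpace.ofCoords (X := ℙ ℂ (Fin 2 → ℂ) × ℙ ℂ (Fin 2 → ℂ)) (M := ℕ × ℕ)
    (fun p => Sum.elim p.1.rep p.2.rep) (Sum.elim (fun _ : Fin 2 => (1, 0)) (fun _ : Fin 2 => (0, 1)))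

/-- `(ℙ¹ × ℙ¹) ∖ Δ`. -/
noncomputable def projLineSqMinusDiag : FunSpace :=
  projLineSq.restrict {p : ℙ ℂ (Fin 2 → ℂ) × ℙ ℂ (Fin 2 → ℂ) | p.1 ≠ p.2}

/-- The curve `ℂ* = 𝔸¹ ∖ {0}`. -/
noncomputable def punctLine : FunSpace :=
  (affineSpace 1).restrict {t : Fin 1 → ℂ | t 0 ≠ 0}

/-- The curve `ℙ¹ ∖ Λ`. -/
noncomputable def projLineMinus (Λ : Set (ℙ ℂ (Fin 2 → ℂ))) : FunSpace :=
  projLine.restrict Λᶜ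

/-- Rational smooth affine curves over `ℂ`. -/
structure IsRationalSmoothAffineCurve (Γ : FunSpace) : Prop where
  /-- `Γ` is isomorphic to a closed subvariety of some affine space -/
  affine : ∃ (n : ℕ) (j : Γ.Pt → Fin n → ℂ), FunSpace.IsClosedEmbedding Γ (affineSpace n) j
  /-- `Γ` is irreducible (in particular non-empty) -/
  irreducible : IrreducibleSpace Γ.Pt
  /-- `Γ` has dimension one -/
  dim_one : topologicalKrullDim Γ.Pt = 1
  /-- the Zariski cotangent space `𝔪 / 𝔪²` at every point has dimension one -/
  smooth : ∀ p : Γ.Pt, Module.finrank ℂ (Γ.idealAt p).Cotangent = 1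
  /-- the field of rational functions of `Γ` is isomorphic to `ℂ(t)` over `ℂ` -/
  rational : Nonempty (FractionRing Γ.functions ≃ₐ[ℂ] RatFunc ℂ)

/-- `τ` is a closed embedding of `Γ` into `𝔸³`, the linear action of `Aut(Γ)` on `𝔸³` given by `ρ`
preserves `τ(Γ)`, and `τ` is `Aut(Γ)`-equivariant. -/
structure IsEquivariantEmbedding (Γ : FunSpace) (ρ : Γ.Aut →* GL (Fin 3) ℂ)
    (τ : Γ.Pt → Fin 3 → ℂ) : Prop where
  isClosedEmbedding : FunSpace.IsClosedEmbedding Γ (affineSpace 3) τ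
  preserves : ∀ φ : Γ.Aut,
    (fun v : Fin 3 → ℂ => (ρ φ : Matrix (Fin 3) (Fin 3) ℂ) *ᵥ v) '' Set.range τ = Set.range τ
  equivariant : ∀ (φ : Γ.Aut) (q : Γ.Pt),
    τ (φ.1 q) = (ρ φ : Matrix (Fin 3) (Fin 3) ℂ) *ᵥ τ q

/-! Let `Λ` be a finite non-empty subset of ℙ¹ and `δ` a self-map of ℙ¹ whose fixed points are
exactly `Λ`. The graph of `δ` meets the diagonal exactly over `Λ`, so it gives a closed copy of ℙ¹ ∖
Λ inside (ℙ¹ × ℙ¹) ∖ Δ (`isClosedEmbedding_graphMap`). The latter surface is the affine quadric yz =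
x² - 1 (`isClosedEmbedding_quadricMap`), on which PGL₂ acts linearly through the symmetric square
twisted by det⁻¹ (`quadricMap_smul`). If `δ` commutes with the stabilizer `H` of `Λ`, its graph is
stable under `H` and the resulting embedding in 𝔸³ is equivariant.

Such a `δ` comes from the binary form F(v) = ∏ det(r, v), with r running over `Λ`: take the vector
(∂F/∂v₁, -∂F/∂v₀), which is `polarVec`. Euler's relation gives det(δ(v), v) = deg(F) F(v)
(`planeDet_polarVec`), so the fixed points are the zeros of F. There are no base points because F is
squarefree, and the construction is natural under GL₂ up to scalars (`polarMap_smul`).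

That Aut(ℙ¹ ∖ Λ) is `H` rests on `exists_eq_smul_of_injective`: a morphism to ℙ¹ is a quotient of
coprime polynomials away from a finite set, and injectivity forces degree at most one
(`natDegree_le_one_of_injOn_quotient`). The automorphisms of 𝔸¹ and ℂ* follow by viewing these
curves as ℙ¹ minus one or two points. Their embeddings lie in a plane, so the linear action is
pinned down by also fixing a vector outside it (`isEquivariantEmbedding_exists_hom`).

A general rational smooth affine curve is reduced to ℙ¹ ∖ Λ by `exists_isIso_projLineMinus`.
Smoothness makes local rings valuation rings, so the generator t of the function field extends to a
morphism to ℙ¹. The coordinates of the curve are rational functions of t, which provide the inverse,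
and `Λ` is the set of their poles. -/

namespace FunSpace

/-! ### Local criteria for morphisms and closed embeddings -/

/-- The map `f` is a morphism at the point `x`. -/
def MorphismAt (X Y : FunSpace) (f : X.Pt → Y.Pt) (x : X.Pt) : Prop :=
  ContinuousAt f x ∧ ∀ g : Y.Pt → ℂ, Y.RegAt g (f x) → X.RegAt (fun x' => g (f x')) x

theorem isMorphism_iff_morphismAt {X Y : FunSpace} {f : X.Pt → Y.Pt} :
    IsMorphism X Y f ↔ ∀ x, MorphismAt X Y f x :=
  ⟨fun h x => ⟨h.1.continuousAt, h.2 x⟩,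
    fun h => ⟨continuous_iff_continuousAt.2 fun x => (h x).1, fun x => (h x).2⟩⟩

theorem IsMorphism.morphismAt {X Y : FunSpace} {f : X.Pt → Y.Pt} (h : IsMorphism X Y f)
    (x : X.Pt) : MorphismAt X Y f x :=
  isMorphism_iff_morphismAt.1 h x

theorem MorphismAt.comp {X Y Z : FunSpace} {g : Y.Pt → Z.Pt} {f : X.Pt → Y.Pt} {x : X.Pt}
    (hg : MorphismAt Y Z g (f x)) (hf : MorphismAt X Y f x) :
    MorphismAt X Z (fun x' => g (f x')) x :=
  ⟨ContinuousAt.comp (f := f) hg.1 hf.1, fun k hk => hf.2 _ (hg.2 k hk)⟩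

theorem MorphismAt.congr {X Y : FunSpace} {f g : X.Pt → Y.Pt} {x : X.Pt}
    (hf : MorphismAt X Y f x) (h : ∀ᶠ y in 𝓝 x, f y = g y) : MorphismAt X Y g x := by
  refine ⟨hf.1.congr h, fun k hk => ?_⟩
  refine X.regAt_congr ?_ (hf.2 k (by rwa [h.self_of_nhds]))
  filter_upwards [h] with y hy
  rw [hy]

theorem regAt_eval {X : FunSpace} {σ : Type*} {a : X.Pt → σ → ℂ} {x : X.Pt}
    (ha : ∀ i, X.RegAt (fun y => a y i) x) (P : MvPolynomial σ ℂ) :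
    X.RegAt (fun y => MvPolynomial.eval (a y) P) x := by
  induction P using MvPolynomial.induction_on with
  | C c => simpa using X.regAt_const c x
  | add p q hp hq => simpa using X.regAt_add hp hq
  | mul_X p i hp => simpa using X.regAt_mul hp (ha i)

theorem regAt_neg {X : FunSpace} {f : X.Pt → ℂ} {x : X.Pt} (hf : X.RegAt f x) :
    X.RegAt (fun y => -f y) x := by
  simpa using X.regAt_mul (X.regAt_const (-1) x) hf

theorem regAt_sub {X : FunSpace} {f g : X.Pt → ℂ} {x : X.Pt} (hf : X.RegAt f x)
    (hg : X.RegAt g x) : X.RegAt (fun y => f y - g y) x := by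
  simpa [sub_eq_add_neg] using X.regAt_add hf (regAt_neg hg)

theorem regAt_div {X : FunSpace} {f g : X.Pt → ℂ} {x : X.Pt} (hf : X.RegAt f x)
    (hg : X.RegAt g x) (hx : g x ≠ 0) : X.RegAt (fun y => f y / g y) x := by
  simpa [div_eq_mul_inv] using X.regAt_mul hf (X.regAt_inv hg hx)

/-- The rescalings of homogeneous coordinates are the characters `ψ` of the grading monoid. This
form treats the trivial grading, the degree and the bidegree at once. -/
theorem eval_mul_of_isWeightedHomogeneous {σ M : Type*} [AddCommMonoid M] {w : σ → M} {m : M}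
    {P : MvPolynomial σ ℂ} (hP : MvPolynomial.IsWeightedHomogeneous w P m) {ψ : M → ℂ}
    (h0 : ψ 0 = 1) (hadd : ∀ a b, ψ (a + b) = ψ a * ψ b) (c : σ → ℂ) :
    MvPolynomial.eval (fun i => ψ (w i) * c i) P = ψ m * MvPolynomial.eval c P := by
  have key : ∀ d : σ →₀ ℕ, (d.prod fun i k => (ψ (w i) * c i) ^ k) =
      ψ (Finsupp.weight w d) * d.prod fun i k => c i ^ k := by
    intro d
    induction d using Finsupp.induction with
    | zero => simp [h0]
    | single_add i k d hi hk ih =>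
      have hpow : ∀ k : ℕ, ψ (k • w i) = ψ (w i) ^ k := by
        intro k
        induction k with
        | zero => simp [h0]
        | succ k ih => rw [succ_nsmul, hadd, ih, pow_succ]
      rw [Finsupp.prod_add_index' (by simp) (fun _ _ _ => pow_add _ _ _),
        Finsupp.prod_add_index' (by simp) (fun _ _ _ => pow_add _ _ _), ih, map_add, hadd,
        Finsupp.weight_single, hpow, Finsupp.prod_single_index (by simp),
        Finsupp.prod_single_index (by simp), mul_pow]
      ring
  rw [MvPolynomial.eval_eq, MvPolynomial.eval_eq, Finset.mul_sum]
  refine Finset.sum_congr rfl fun d hd => ?_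
  have h1 := key d
  rw [hP (MvPolynomial.mem_support_iff.1 hd)] at h1
  simp only [Finsupp.prod] at h1
  rw [h1]
  ring

/-- A map to a space given by coordinates is a morphism where it is given by regular functions that
are coordinates of the image points up to a rescaling compatible with the grading. -/
theorem morphismAt_ofCoords {X : FunSpace} {Y σ M : Type*} [AddCommMonoid M] {c : Y → σ → ℂ}
    {w : σ → M} {f : X.Pt → Y} {x : X.Pt} (a : X.Pt → σ → ℂ)
    (ha : ∀ i, X.RegAt (fun y => a y i) x)
    (h : ∀ᶠ y in 𝓝 x, ∃ ψ : M → ℂ, (∀ m, ψ m ≠ 0) ∧ ψ 0 = 1 ∧ (∀ m n, ψ (m + n) = ψ m * ψ n) ∧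
      a y = fun i => ψ (w i) * c (f y) i) :
    MorphismAt X (ofCoords c w) f x := by
  have hpol : ∀ {m : M} {P : MvPolynomial σ ℂ}, MvPolynomial.IsWeightedHomogeneous w P m →
      MvPolynomial.eval (c (f x)) P ≠ 0 → ∀ᶠ y in 𝓝 x, MvPolynomial.eval (c (f y)) P ≠ 0 := by
    intro m P hP hx
    have hx' : MvPolynomial.eval (a x) P ≠ 0 := by
      obtain ⟨ψ, h1, h2, h3, h4⟩ := h.self_of_nhds
      rw [h4, eval_mul_of_isWeightedHomogeneous hP h2 h3]
      exact mul_ne_zero (h1 m) hx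
    filter_upwards [h, X.regAt_ne_zero (regAt_eval ha P) hx'] with y ⟨ψ, h1, h2, h3, h4⟩ hy
    rw [h4, eval_mul_of_isWeightedHomogeneous hP h2 h3] at hy
    exact right_ne_zero_of_mul hy
  have hcont : Filter.Tendsto f (𝓝 x) (@nhds Y (zariskiTopology c w) (f x)) := by
    refine TopologicalSpace.tendsto_nhds_generateFrom_iff.2 ?_
    rintro _ ⟨m, P, hP, rfl⟩ hx
    exact hpol hP hx
  refine ⟨hcont, ?_⟩
  rintro g ⟨m, N, D, hN, hD, hx, hg⟩
  have hx' : MvPolynomial.eval (a x) D ≠ 0 := by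
    obtain ⟨ψ, h1, h2, h3, h4⟩ := h.self_of_nhds
    rw [h4, eval_mul_of_isWeightedHomogeneous hD h2 h3]
    exact mul_ne_zero (h1 m) hx
  refine X.regAt_congr ?_ (regAt_div (regAt_eval ha N) (regAt_eval ha D) hx')
  filter_upwards [h, hcont.eventually hg] with y ⟨ψ, h1, h2, h3, h4⟩ hy
  rw [hy, h4, eval_mul_of_isWeightedHomogeneous hD h2 h3,
    eval_mul_of_isWeightedHomogeneous hN h2 h3, mul_div_mul_left _ _ (h1 m)]

theorem morphismAt_val (X : FunSpace) (S : Set X.Pt) (x : (X.restrict S).Pt) :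
    MorphismAt (X.restrict S) X (Subtype.val : S → X.Pt) x :=
  ⟨continuous_subtype_val.continuousAt, fun g hg => ⟨g, hg, Filter.Eventually.of_forall
    fun _ => rfl⟩⟩

theorem morphismAt_restrict {X Y : FunSpace} {S : Set Y.Pt} {f : X.Pt → (Y.restrict S).Pt}
    {x : X.Pt} (h : MorphismAt X Y (fun y => (f y : S).1) x) :
    MorphismAt X (Y.restrict S) f x := by
  have hc : ContinuousAt (Y := S) f x :=
    Topology.IsInducing.subtypeVal.continuousAt_iff.2 h.1
  refine ⟨hc, ?_⟩
  rintro g ⟨k, hk, hgk⟩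
  refine X.regAt_congr ?_ (h.2 k hk)
  filter_upwards [hc.eventually hgk] with y hy
  exact hy.symm

/-- A morphism with closed range that has local retractions is a closed embedding.  The retractions
may take values in a space `Z` whose structure induces that of `X`. -/
theorem isClosedEmbedding_of_retraction {X Y Z : FunSpace} {f : X.Pt → Y.Pt}
    (hf : IsMorphism X Y f) (hclosed : IsClosed (Set.range f)) {i : X.Pt → Z.Pt}
    (hi : Topology.IsEmbedding i)
    (hext : ∀ (x : X.Pt) (g : X.Pt → ℂ), X.RegAt g x →
      ∃ h : Z.Pt → ℂ, Z.RegAt h (i x) ∧ ∀ᶠ x' in 𝓝 x, g x' = h (i x'))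
    (hr : ∀ x : X.Pt, ∃ r : Y.Pt → Z.Pt, MorphismAt Y Z r (f x) ∧
      ∀ᶠ y in 𝓝 (f x), ∀ x', f x' = y → r y = i x') :
    IsClosedEmbedding X Y f := by
  have hinj : Function.Injective f := by
    intro x x' hxx
    obtain ⟨r, -, h⟩ := hr x
    have h1 := h.self_of_nhds
    exact hi.injective ((h1 x rfl).symm.trans (h1 x' hxx.symm))
  have hind : Topology.IsInducing f := by
    rw [Topology.isInducing_iff_nhds]
    intro x
    refine le_antisymm (hf.1.continuousAt.tendsto.le_comap) ?_
    obtain ⟨r, h1, h2⟩ := hr x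
    have hrx : r (f x) = i x := h2.self_of_nhds x rfl
    rw [hi.nhds_eq_comap]
    intro U hU
    obtain ⟨V, hV, hVU⟩ := Filter.mem_comap.1 hU
    rw [← hrx] at hV
    -- The preimage of `V` under `r` is cut down to the neighbourhood on which `r` really inverts
    -- `f`.
    refine Filter.mem_comap.2 ⟨_, Filter.inter_mem (h1.1 hV) h2, ?_⟩
    rintro x' ⟨hx1, hx2⟩
    refine hVU ?_
    have := hx2 x' rfl
    simp only [Set.mem_preimage] at hx1 ⊢
    rwa [← this]
  refine ⟨hf, ⟨⟨hind, hinj⟩, hclosed⟩, ?_⟩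
  intro x g hg
  obtain ⟨r, h1, h2⟩ := hr x
  have hrx : r (f x) = i x := h2.self_of_nhds x rfl
  obtain ⟨k, hk, hgk⟩ := hext x g hg
  refine ⟨fun y => k (r y), h1.2 k (by rwa [hrx]), ?_⟩
  filter_upwards [hgk, hf.1.continuousAt.eventually h2] with x' h3 h4
  rw [h3, h4 x' rfl]

theorem isClosedEmbedding_of_retraction_self {X Y : FunSpace} {f : X.Pt → Y.Pt}
    (hf : IsMorphism X Y f) (hclosed : IsClosed (Set.range f))
    (hr : ∀ x : X.Pt, ∃ r : Y.Pt → X.Pt, MorphismAt Y X r (f x) ∧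
      ∀ᶠ y in 𝓝 (f x), ∀ x', f x' = y → r y = x') :
    IsClosedEmbedding X Y f :=
  isClosedEmbedding_of_retraction hf hclosed (i := id) .id
    (fun _ g hg => ⟨g, hg, Filter.Eventually.of_forall fun _ => rfl⟩) hr

/-- The retraction only has to land in the ambient space: explicit formulas may leave `S` away from
the image of `f`. -/
theorem isClosedEmbedding_of_retraction_restrict {X Y : FunSpace} {S : Set X.Pt}
    {f : (X.restrict S).Pt → Y.Pt}
    (hf : IsMorphism (X.restrict S) Y f) (hclosed : IsClosed (Set.range f))
    (hr : ∀ x : (X.restrict S).Pt, ∃ r : Y.Pt → X.Pt, MorphismAt Y X r (f x) ∧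
      ∀ᶠ y in 𝓝 (f x), ∀ x' : S, f x' = y → r y = x'.1) :
    IsClosedEmbedding (X.restrict S) Y f :=
  isClosedEmbedding_of_retraction hf hclosed (i := (Subtype.val : S → X.Pt))
    Topology.IsEmbedding.subtypeVal (fun _ _ hg => hg) hr

theorem IsClosedEmbedding.comp {X Y Z : FunSpace} {g : Y.Pt → Z.Pt} {f : X.Pt → Y.Pt}
    (hg : IsClosedEmbedding Y Z g) (hf : IsClosedEmbedding X Y f) :
    IsClosedEmbedding X Z (fun x => g (f x)) := by
  refine ⟨hg.1.comp hf.1, hg.2.comp hf.2, fun x k hk => ?_⟩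
  obtain ⟨h, hh, hkh⟩ := hf.3 x k hk
  obtain ⟨l, hl, hhl⟩ := hg.3 (f x) h hh
  refine ⟨l, hl, ?_⟩
  filter_upwards [hkh, hf.1.1.continuousAt.eventually hhl] with x' h1 h2
  rw [h1, h2]

/-- A map that becomes a morphism after composition with a closed embedding is a morphism. -/
theorem IsClosedEmbedding.isMorphism_of_comp {X Y Z : FunSpace} {g : Y.Pt → Z.Pt}
    {f : X.Pt → Y.Pt} (hg : IsClosedEmbedding Y Z g) (h : IsMorphism X Z (fun x => g (f x))) :
    IsMorphism X Y f := by
  have hc : Continuous f := hg.2.isInducing.continuous_iff.2 h.1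
  refine ⟨hc, fun x k hk => ?_⟩
  obtain ⟨l, hl, hkl⟩ := hg.3 (f x) k hk
  refine X.regAt_congr ?_ (h.2 x l hl)
  filter_upwards [hc.continuousAt.eventually hkl] with x' h1
  exact h1.symm

/-- An equivalence of the sets of points that is a morphism in both directions. -/
structure IsIso (X Y : FunSpace) (e : X.Pt ≃ Y.Pt) : Prop where
  isMorphism : IsMorphism X Y e
  isMorphism_symm : IsMorphism Y X e.symm

theorem IsIso.isClosedEmbedding {X Y : FunSpace} {e : X.Pt ≃ Y.Pt} (he : IsIso X Y e) :
    IsClosedEmbedding X Y e := by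
  refine isClosedEmbedding_of_retraction_self he.1 ?_ ?_
  · rw [e.surjective.range_eq]
    exact isClosed_univ
  · exact fun x => ⟨e.symm, he.2.morphismAt _, Filter.Eventually.of_forall fun y x' h => by
      rw [← h, e.symm_apply_apply]⟩

/-- Isomorphic spaces have isomorphic automorphism groups. -/
def IsIso.autCongr {X Y : FunSpace} {e : X.Pt ≃ Y.Pt} (he : IsIso X Y e) : X.Aut →* Y.Aut where
  toFun φ := ⟨e.permCongr φ.1, ⟨he.1.comp (φ.2.1.comp he.2), he.1.comp (φ.2.2.comp he.2)⟩⟩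
  map_one' := by ext; simp
  map_mul' φ ψ := by ext; simp

theorem IsIso.autCongr_apply {X Y : FunSpace} {e : X.Pt ≃ Y.Pt} (he : IsIso X Y e) (φ : X.Aut)
    (y : Y.Pt) : (he.autCongr φ).1 y = e (φ.1 (e.symm y)) :=
  rfl

end FunSpace

theorem IsEquivariantEmbedding.comp_isIso {X Y : FunSpace} {e : X.Pt ≃ Y.Pt}
    (he : FunSpace.IsIso X Y e) {ρ : Y.Aut →* GL (Fin 3) ℂ} {τ : Y.Pt → Fin 3 → ℂ}
    (h : IsEquivariantEmbedding Y ρ τ) :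
    IsEquivariantEmbedding X (ρ.comp he.autCongr) (fun x => τ (e x)) := by
  refine ⟨h.1.comp he.isClosedEmbedding, fun φ => ?_, fun φ q => ?_⟩
  · have : Set.range (fun x => τ (e x)) = Set.range τ := e.surjective.range_comp τ
    rw [this]
    exact h.2 _
  · have := h.3 (he.autCongr φ) (e q)
    rw [he.autCongr_apply, e.symm_apply_apply] at this
    exact this

theorem isEquivariantEmbedding_of_equivariant {X : FunSpace} {ρ : X.Aut →* GL (Fin 3) ℂ}
    {τ : X.Pt → Fin 3 → ℂ} (hτ : FunSpace.IsClosedEmbedding X (affineSpace 3) τ)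
    (h : ∀ (φ : X.Aut) (q : X.Pt),
      τ (φ.1 q) = (ρ φ : Matrix (Fin 3) (Fin 3) ℂ) *ᵥ τ q) : IsEquivariantEmbedding X ρ τ := by
  refine ⟨hτ, fun φ => ?_, h⟩
  rw [← Set.range_comp]
  have : ((fun v : Fin 3 → ℂ => (ρ φ : Matrix (Fin 3) (Fin 3) ℂ) *ᵥ v) ∘ τ) =
      fun q => τ (φ.1 q) := funext fun q => (h φ q).symm
  rw [this]
  exact φ.1.surjective.range_comp τ

open FunSpace

/-! ### Affine space and regular homogeneous coordinates -/

theorem affineSpace_regAt_eval {n : ℕ} (P : MvPolynomial (Fin n) ℂ) (x : (affineSpace n).Pt) :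
    (affineSpace n).RegAt (fun y : Fin n → ℂ => MvPolynomial.eval y P) x := by
  refine ⟨(), P, 1, fun _ _ => rfl, fun _ _ => rfl, by simp, Filter.Eventually.of_forall ?_⟩
  intro y
  simp

theorem affineSpace_regAt_coord {n : ℕ} (i : Fin n) (x : (affineSpace n).Pt) :
    (affineSpace n).RegAt (fun y : Fin n → ℂ => y i) x := by
  simpa using affineSpace_regAt_eval (MvPolynomial.X i) x

theorem isClosed_affineSpace_zeros {n : ℕ} (P : MvPolynomial (Fin n) ℂ) :
    IsClosed (X := (affineSpace n).Pt) {x : Fin n → ℂ | MvPolynomial.eval x P = 0} := by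
  refine ⟨?_⟩
  exact TopologicalSpace.isOpen_generateFrom_of_mem ⟨(), P, fun _ _ => rfl, rfl⟩

/-- Nonvanishing loci of polynomials are stable under intersection, by taking products, so the
generating family is already a basis. -/
theorem affineSpace_exists_basicOpen {n : ℕ} {x : (affineSpace n).Pt} {U : Set (affineSpace n).Pt}
    (hU : U ∈ 𝓝 x) : ∃ E : MvPolynomial (Fin n) ℂ, MvPolynomial.eval (x : Fin n → ℂ) E ≠ 0 ∧
      ∀ y : Fin n → ℂ, MvPolynomial.eval y E ≠ 0 → y ∈ U := by
  obtain ⟨V, hVU, hV, hxV⟩ := mem_nhds_iff.1 hU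
  suffices h : ∃ E : MvPolynomial (Fin n) ℂ, MvPolynomial.eval (x : Fin n → ℂ) E ≠ 0 ∧
      ∀ y : Fin n → ℂ, MvPolynomial.eval y E ≠ 0 → y ∈ V by
    obtain ⟨E, h1, h2⟩ := h
    exact ⟨E, h1, fun y hy => hVU (h2 y hy)⟩
  clear hVU hU
  induction hV with
  | basic s hs =>
    obtain ⟨_, D, -, rfl⟩ := hs
    exact ⟨D, hxV, fun y hy => hy⟩
  | univ => exact ⟨1, by simp, fun y _ => trivial⟩
  | inter s t _ _ hs ht =>
    obtain ⟨E, h1, h2⟩ := hs hxV.1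
    obtain ⟨E', h1', h2'⟩ := ht hxV.2
    refine ⟨E * E', by simpa using ⟨h1, h1'⟩, fun y hy => ?_⟩
    rw [map_mul] at hy
    exact ⟨h2 y (left_ne_zero_of_mul hy), h2' y (right_ne_zero_of_mul hy)⟩
  | sUnion S _ ih =>
    obtain ⟨s, hs, hxs⟩ := hxV
    obtain ⟨E, h1, h2⟩ := ih s hs hxs
    exact ⟨E, h1, fun y hy => ⟨s, hs, h2 y hy⟩⟩

theorem morphismAt_affineSpace {X : FunSpace} {n : ℕ} {f : X.Pt → (affineSpace n).Pt} {x : X.Pt}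
    (h : ∀ i, X.RegAt (fun y => (f y : Fin n → ℂ) i) x) : MorphismAt X (affineSpace n) f x :=
  morphismAt_ofCoords (fun y => (f y : Fin n → ℂ)) h <| Filter.Eventually.of_forall fun _ =>
    ⟨fun _ => 1, by simp, rfl, by simp, by ext; simp⟩

/-- `f` has, near `x`, the homogeneous coordinates `v`. -/
def HasCoordsAt {X : FunSpace} (f : X.Pt → ℙ ℂ (Fin 2 → ℂ)) (v : X.Pt → Fin 2 → ℂ) (x : X.Pt) :
    Prop :=
  (∀ i, X.RegAt (fun y => v y i) x) ∧
    ∀ᶠ y in 𝓝 x, ∃ h : v y ≠ 0, f y = Projectivization.mk ℂ (v y) h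

theorem eventually_ne_zero {X : FunSpace} {n : ℕ} {v : X.Pt → Fin n → ℂ} {x : X.Pt}
    (hv : ∀ i, X.RegAt (fun y => v y i) x) (hx : v x ≠ 0) : ∀ᶠ y in 𝓝 x, v y ≠ 0 := by
  obtain ⟨i, hi⟩ := Function.ne_iff.1 hx
  filter_upwards [X.regAt_ne_zero (hv i) hi] with y hy h
  exact hy (by rw [h]; rfl)

theorem HasCoordsAt.morphismAt {X : FunSpace} {f : X.Pt → projLine.Pt} {v : X.Pt → Fin 2 → ℂ}
    {x : X.Pt} (h : HasCoordsAt f v x) : MorphismAt X projLine f x := by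
  refine morphismAt_ofCoords v h.1 ?_
  filter_upwards [h.2] with y ⟨hy, hfy⟩
  obtain ⟨u, hu⟩ := Projectivization.exists_smul_eq_mk_rep ℂ (v y) hy
  rw [← hfy] at hu
  refine ⟨fun m => ((u⁻¹ : ℂˣ) : ℂ) ^ m, fun m => pow_ne_zero _ (Units.ne_zero _), pow_zero _,
    fun _ _ => pow_add _ _ _, ?_⟩
  ext i
  rw [← hu]
  simp [Units.smul_def]

theorem HasCoordsAt.prodMk {X : FunSpace} {f g : X.Pt → projLine.Pt} {v w : X.Pt → Fin 2 → ℂ}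
    {x : X.Pt} (h : HasCoordsAt f v x) (h' : HasCoordsAt g w x) :
    MorphismAt X projLineSq (fun y => (f y, g y)) x := by
  refine morphismAt_ofCoords (fun y => Sum.elim (v y) (w y)) ?_ ?_
  · rintro (i | i)
    · exact h.1 i
    · exact h'.1 i
  filter_upwards [h.2, h'.2] with y ⟨hy, hfy⟩ ⟨hy', hgy⟩
  obtain ⟨u, hu⟩ := Projectivization.exists_smul_eq_mk_rep ℂ (v y) hy
  obtain ⟨u', hu'⟩ := Projectivization.exists_smul_eq_mk_rep ℂ (w y) hy'
  rw [← hfy] at hu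
  rw [← hgy] at hu'
  refine ⟨fun m => ((u⁻¹ : ℂˣ) : ℂ) ^ m.1 * ((u'⁻¹ : ℂˣ) : ℂ) ^ m.2,
    fun m => mul_ne_zero (pow_ne_zero _ (Units.ne_zero _)) (pow_ne_zero _ (Units.ne_zero _)),
    by simp, fun _ _ => by simp only [Prod.fst_add, Prod.snd_add, pow_add]; ring, ?_⟩
  ext i
  rcases i with i | i
  · simp [← hu, Units.smul_def]
  · simp [← hu', Units.smul_def]

theorem HasCoordsAt.congr_smul {X : FunSpace} {f : X.Pt → ℙ ℂ (Fin 2 → ℂ)}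
    {v w : X.Pt → Fin 2 → ℂ} {x : X.Pt} (hw : ∀ i, X.RegAt (fun y => w y i) x)
    (h : ∀ᶠ y in 𝓝 x, ∃ h : v y ≠ 0, f y = Projectivization.mk ℂ (v y) h)
    (hvw : ∀ᶠ y in 𝓝 x, ∃ c : ℂ, c ≠ 0 ∧ w y = c • v y) : HasCoordsAt f w x := by
  refine ⟨hw, ?_⟩
  filter_upwards [h, hvw] with y ⟨h1, h2⟩ ⟨c, hc, h3⟩
  refine ⟨by rw [h3]; exact smul_ne_zero hc h1, ?_⟩
  rw [h2, Projectivization.mk_eq_mk_iff']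
  exact ⟨c⁻¹, by rw [h3, smul_smul, inv_mul_cancel₀ hc, one_smul]⟩

/-- The chosen representative `rep` need not depend regularly on the point. Dividing it by an entry
that does not vanish at `x` gives quotients of two coordinates of equal degree, hence regular
functions. -/
theorem exists_hasCoordsAt_ofCoords {Y σ M : Type*} [AddCommMonoid M] {c : Y → σ → ℂ} {w : σ → M}
    {f : Y → ℙ ℂ (Fin 2 → ℂ)} {k : Fin 2 → σ} (hk : w (k 0) = w (k 1))
    (hc : ∀ y i, c y (k i) = (f y).rep i) (x : Y) :
    ∃ v : Y → Fin 2 → ℂ, HasCoordsAt (X := ofCoords c w) f v x := by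
  obtain ⟨i, hi⟩ := Function.ne_iff.1 (f x).rep_nonzero
  have hw : ∀ j, MvPolynomial.IsWeightedHomogeneous w (MvPolynomial.X (R := ℂ) (k j))
      (w (k 0)) := by
    intro j
    fin_cases j
    · exact MvPolynomial.isWeightedHomogeneous_X ℂ w _
    · have := MvPolynomial.isWeightedHomogeneous_X ℂ w (k 1)
      rw [← hk] at this
      exact this
  have hx : MvPolynomial.eval (c x) (MvPolynomial.X (k i)) ≠ 0 := by
    rw [MvPolynomial.eval_X, hc]
    exact hi
  refine ⟨fun y j => (f y).rep j / (f y).rep i, HasCoordsAt.congr_smul (v := fun y => (f y).rep)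
    (fun j => ?_) (Filter.Eventually.of_forall fun y => ⟨(f y).rep_nonzero, ?_⟩) ?_⟩
  · refine ⟨w (k 0), MvPolynomial.X (k j), MvPolynomial.X (k i), hw j, hw i, hx, ?_⟩
    exact Filter.Eventually.of_forall fun y => by simp [hc]
  · exact (Projectivization.mk_rep _).symm
  · refine (eventually_eval_ne_zero c w (hw i) hx).mono fun y hy => ?_
    rw [MvPolynomial.eval_X, hc] at hy
    refine ⟨((f y).rep i)⁻¹, inv_ne_zero hy, ?_⟩
    ext j
    simp [div_eq_inv_mul]

theorem HasCoordsAt.comp {X Y : FunSpace} {f : Y.Pt → ℙ ℂ (Fin 2 → ℂ)} {g : X.Pt → Y.Pt}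
    {v : Y.Pt → Fin 2 → ℂ} {x : X.Pt} (h : HasCoordsAt f v (g x)) (hg : MorphismAt X Y g x) :
    HasCoordsAt (fun y => f (g y)) (fun y => v (g y)) x :=
  ⟨fun i => hg.2 _ (h.1 i), hg.1.eventually h.2⟩

/-- Regular coordinates for the identity of ℙ¹ near `f x` are pulled back along `f`. -/
theorem FunSpace.MorphismAt.exists_hasCoordsAt {X : FunSpace} {f : X.Pt → projLine.Pt} {x : X.Pt}
    (hf : MorphismAt X projLine f x) : ∃ v, HasCoordsAt f v x := by
  obtain ⟨v, hv⟩ := exists_hasCoordsAt_ofCoords (c := fun q : ℙ ℂ (Fin 2 → ℂ) => q.rep)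
    (w := fun _ => (1 : ℕ)) (f := id) (k := id) rfl (fun _ _ => rfl) (f x)
  exact ⟨_, HasCoordsAt.comp (Y := projLine) hv hf⟩

theorem FunSpace.MorphismAt.prodMk {X : FunSpace} {f g : X.Pt → projLine.Pt} {x : X.Pt}
    (hf : MorphismAt X projLine f x) (hg : MorphismAt X projLine g x) :
    MorphismAt X projLineSq (fun y => (f y, g y)) x := by
  obtain ⟨v, hv⟩ := hf.exists_hasCoordsAt
  obtain ⟨w, hw⟩ := hg.exists_hasCoordsAt
  exact hv.prodMk hw

theorem exists_hasCoordsAt_fst (x : projLineSq.Pt) :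
    ∃ v, HasCoordsAt (X := projLineSq) Prod.fst v x :=
  exists_hasCoordsAt_ofCoords (k := Sum.inl) rfl (fun _ _ => rfl) x

theorem exists_hasCoordsAt_snd (x : projLineSq.Pt) :
    ∃ v, HasCoordsAt (X := projLineSq) Prod.snd v x :=
  exists_hasCoordsAt_ofCoords (k := Sum.inr) rfl (fun _ _ => rfl) x

/-! ### Determinants, equality of points and separatedness -/

/-- The determinant of two vectors in the plane. -/
def planeDet (v w : Fin 2 → ℂ) : ℂ :=
  v 0 * w 1 - v 1 * w 0

theorem planeDet_self (v : Fin 2 → ℂ) : planeDet v v = 0 := by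
  simp [planeDet]; ring

theorem planeDet_comm (v w : Fin 2 → ℂ) : planeDet v w = -planeDet w v := by
  simp [planeDet]; ring

theorem planeDet_smul_left (c : ℂ) (v w : Fin 2 → ℂ) : planeDet (c • v) w = c * planeDet v w := by
  simp [planeDet]; ring

theorem planeDet_smul_right (c : ℂ) (v w : Fin 2 → ℂ) : planeDet v (c • w) = c * planeDet v w := by
  simp [planeDet]; ring

theorem planeDet_add_right (v w w' : Fin 2 → ℂ) :
    planeDet v (w + w') = planeDet v w + planeDet v w' := by
  simp [planeDet]; ring

theorem planeDet_mulVec (g : Matrix (Fin 2) (Fin 2) ℂ) (v w : Fin 2 → ℂ) :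
    planeDet (g *ᵥ v) (g *ᵥ w) = g.det * planeDet v w := by
  simp [planeDet, Matrix.mulVec, dotProduct, Fin.sum_univ_two, Matrix.det_fin_two]; ring

theorem eq_smul_of_planeDet_eq_zero {v w : Fin 2 → ℂ} (hv : v ≠ 0) (h : planeDet v w = 0) :
    ∃ c : ℂ, w = c • v := by
  have h' : v 0 * w 1 = v 1 * w 0 := sub_eq_zero.1 h
  by_cases h0 : v 0 = 0
  · have h1 : v 1 ≠ 0 := fun h1 => hv (by ext i; fin_cases i <;> assumption)
    refine ⟨w 1 / v 1, ?_⟩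
    ext i
    fin_cases i
    · simp [h0] at h' ⊢
      exact h'.resolve_left h1
    · simp [h1]
  · refine ⟨w 0 / v 0, ?_⟩
    ext i
    fin_cases i
    · simp [h0]
    · simp
      field_simp
      linear_combination h'

theorem mk_eq_mk_iff_planeDet {v w : Fin 2 → ℂ} (hv : v ≠ 0) (hw : w ≠ 0) :
    Projectivization.mk ℂ v hv = Projectivization.mk ℂ w hw ↔ planeDet v w = 0 := by
  rw [Projectivization.mk_eq_mk_iff']
  constructor
  · rintro ⟨a, rfl⟩
    rw [planeDet_smul_left, planeDet_self, mul_zero]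
  · intro h
    rw [planeDet_comm, neg_eq_zero] at h
    obtain ⟨c, rfl⟩ := eq_smul_of_planeDet_eq_zero hw h
    exact ⟨c, rfl⟩

theorem eq_iff_planeDet_rep {p q : ℙ ℂ (Fin 2 → ℂ)} : p = q ↔ planeDet p.rep q.rep = 0 := by
  rw [← mk_eq_mk_iff_planeDet p.rep_nonzero q.rep_nonzero, p.mk_rep, q.mk_rep]

/-- The diagonal of the product of two projective lines is closed. -/
theorem isClosed_diagonal_projLineSq :
    IsClosed (X := projLineSq.Pt) {p : ℙ ℂ (Fin 2 → ℂ) × ℙ ℂ (Fin 2 → ℂ) | p.1 = p.2} := by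
  refine ⟨TopologicalSpace.isOpen_generateFrom_of_mem ?_⟩
  let w : Fin 2 ⊕ Fin 2 → ℕ × ℕ := Sum.elim (fun _ => (1, 0)) (fun _ => (0, 1))
  refine ⟨(1, 0) + (0, 1), MvPolynomial.X (Sum.inl 0) * MvPolynomial.X (Sum.inr 1) -
    MvPolynomial.X (Sum.inl 1) * MvPolynomial.X (Sum.inr 0), ?_, ?_⟩
  · exact ((MvPolynomial.isWeightedHomogeneous_X ℂ w (Sum.inl 0)).mul
      (MvPolynomial.isWeightedHomogeneous_X ℂ w (Sum.inr 1))).sub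
      ((MvPolynomial.isWeightedHomogeneous_X ℂ w (Sum.inl 1)).mul
      (MvPolynomial.isWeightedHomogeneous_X ℂ w (Sum.inr 0)))
  · ext p
    change ¬ p.1 = p.2 ↔ MvPolynomial.eval (Sum.elim p.1.rep p.2.rep) _ ≠ 0
    rw [eq_iff_planeDet_rep, planeDet]
    simp

/-- Separatedness of ℙ¹: the set is the preimage of the diagonal under (f, g). With the cofinite
topology it yields the identity principle used throughout. -/
theorem isClosed_setOf_eq_of_isMorphism {X : FunSpace} {f g : X.Pt → projLine.Pt}
    (hf : IsMorphism X projLine f) (hg : IsMorphism X projLine g) :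
    IsClosed {x | f x = g x} := by
  have h : IsMorphism X projLineSq (fun y => (f y, g y)) :=
    isMorphism_iff_morphismAt.2 fun x => (hf.morphismAt x).prodMk (hg.morphismAt x)
  exact isClosed_diagonal_projLineSq.preimage h.1

/-- The point of the projective line with given homogeneous coordinates (an arbitrary point if they
are both zero). -/
noncomputable def toProj (v : Fin 2 → ℂ) : ℙ ℂ (Fin 2 → ℂ) :=
  open Classical in if h : v ≠ 0 then Projectivization.mk ℂ v h else Classical.arbitrary _

theorem toProj_of_ne_zero {v : Fin 2 → ℂ} (h : v ≠ 0) : toProj v = Projectivization.mk ℂ v h :=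
  dif_pos h

theorem toProj_smul {c : ℂ} (hc : c ≠ 0) (v : Fin 2 → ℂ) : toProj (c • v) = toProj v := by
  by_cases h : v = 0
  · simp [h]
  · rw [toProj_of_ne_zero h, toProj_of_ne_zero (smul_ne_zero hc h),
      Projectivization.mk_eq_mk_iff']
    exact ⟨c, rfl⟩

theorem toProj_rep (p : ℙ ℂ (Fin 2 → ℂ)) : toProj p.rep = p := by
  rw [toProj_of_ne_zero p.rep_nonzero, p.mk_rep]

theorem toProj_eq_toProj_iff {v w : Fin 2 → ℂ} (hv : v ≠ 0) (hw : w ≠ 0) :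
    toProj v = toProj w ↔ planeDet v w = 0 := by
  rw [toProj_of_ne_zero hv, toProj_of_ne_zero hw, mk_eq_mk_iff_planeDet]

theorem hasCoordsAt_toProj {X : FunSpace} {v : X.Pt → Fin 2 → ℂ} {x : X.Pt}
    (hv : ∀ i, X.RegAt (fun y => v y i) x) (hx : v x ≠ 0) :
    HasCoordsAt (fun y => toProj (v y)) v x :=
  ⟨hv, (eventually_ne_zero hv hx).mono fun _ hy => ⟨hy, toProj_of_ne_zero hy⟩⟩

/-! ### The quadric as the complement of the diagonal -/

/-- The coordinates on the quadric of a pair of points of the projective line. -/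
noncomputable def quadricCoords (y z : Fin 2 → ℂ) : Fin 3 → ℂ :=
  ![(y 0 * z 1 + y 1 * z 0) / (y 0 * z 1 - y 1 * z 0),
    2 * y 0 * z 0 / (y 0 * z 1 - y 1 * z 0),
    2 * y 1 * z 1 / (y 0 * z 1 - y 1 * z 0)]

theorem quadricCoords_smul {c d : ℂ} (hc : c ≠ 0) (hd : d ≠ 0) (y z : Fin 2 → ℂ) :
    quadricCoords (c • y) (d • z) = quadricCoords y z := by
  have hcd := mul_ne_zero hc hd
  have hdet : c * y 0 * (d * z 1) - c * y 1 * (d * z 0) =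
      c * d * (y 0 * z 1 - y 1 * z 0) := by ring
  have e1 : c * y 0 * (d * z 1) + c * y 1 * (d * z 0) =
      c * d * (y 0 * z 1 + y 1 * z 0) := by ring
  have e2 : 2 * (c * y 0) * (d * z 0) = c * d * (2 * y 0 * z 0) := by ring
  have e3 : 2 * (c * y 1) * (d * z 1) = c * d * (2 * y 1 * z 1) := by ring
  simp only [quadricCoords, Pi.smul_apply, smul_eq_mul, hdet, e1, e2, e3,
    mul_div_mul_left _ _ hcd]

/-- The embedding of the product of two projective lines minus the diagonal. -/
noncomputable def quadricMap
    (p : {p : ℙ ℂ (Fin 2 → ℂ) × ℙ ℂ (Fin 2 → ℂ) | p.1 ≠ p.2}) : Fin 3 → ℂ :=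
  quadricCoords p.1.1.rep p.1.2.rep

theorem quadricMap_mk (y z : Fin 2 → ℂ) (hy : y ≠ 0) (hz : z ≠ 0)
    (h : Projectivization.mk ℂ y hy ≠ Projectivization.mk ℂ z hz) :
    quadricMap ⟨(Projectivization.mk ℂ y hy, Projectivization.mk ℂ z hz), h⟩ =
      quadricCoords y z := by
  obtain ⟨c, hc⟩ := Projectivization.exists_smul_eq_mk_rep ℂ y hy
  obtain ⟨d, hd⟩ := Projectivization.exists_smul_eq_mk_rep ℂ z hz
  simp only [quadricMap]
  rw [← hc, ← hd]
  exact quadricCoords_smul c.ne_zero d.ne_zero y z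

theorem quadricMap_toProj {y z : Fin 2 → ℂ} (h : planeDet y z ≠ 0) :
    ∃ h' : toProj y ≠ toProj z, quadricMap ⟨(toProj y, toProj z), h'⟩ = quadricCoords y z := by
  have hy : y ≠ 0 := by
    rintro rfl
    simp [planeDet] at h
  have hz : z ≠ 0 := by
    rintro rfl
    simp [planeDet] at h
  have h' : toProj y ≠ toProj z := by
    rwa [Ne, toProj_eq_toProj_iff hy hz]
  refine ⟨h', ?_⟩
  simp only [toProj_of_ne_zero hy, toProj_of_ne_zero hz]
  apply quadricMap_mk

theorem isMorphism_quadricMap :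
    IsMorphism projLineSqMinusDiag (affineSpace 3) quadricMap := by
  refine isMorphism_iff_morphismAt.2 fun x => ?_
  obtain ⟨v, hv⟩ := exists_hasCoordsAt_fst x.1
  obtain ⟨w, hw⟩ := exists_hasCoordsAt_snd x.1
  have hval := morphismAt_val projLineSq
    {p : ℙ ℂ (Fin 2 → ℂ) × ℙ ℂ (Fin 2 → ℂ) | p.1 ≠ p.2} x
  have hv' := hv.comp hval
  have hw' := hw.comp hval
  have hne : v x.1 0 * w x.1 1 - v x.1 1 * w x.1 0 ≠ 0 := by
    obtain ⟨h1, h2⟩ := hv.2.self_of_nhds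
    obtain ⟨h3, h4⟩ := hw.2.self_of_nhds
    intro h
    exact x.2 (by rw [h2, h4, mk_eq_mk_iff_planeDet]; exact h)
  refine MorphismAt.congr (f := fun y : {p : ℙ ℂ (Fin 2 → ℂ) × ℙ ℂ (Fin 2 → ℂ) | p.1 ≠ p.2} =>
    quadricCoords (v y.1) (w y.1)) ?_ ?_
  · refine morphismAt_affineSpace fun i => ?_
    have hD := regAt_sub (projLineSqMinusDiag.regAt_mul (hv'.1 0) (hw'.1 1))
      (projLineSqMinusDiag.regAt_mul (hv'.1 1) (hw'.1 0))
    have h2 := projLineSqMinusDiag.regAt_const 2 x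
    fin_cases i
    · exact regAt_div (projLineSqMinusDiag.regAt_add
        (projLineSqMinusDiag.regAt_mul (hv'.1 0) (hw'.1 1))
        (projLineSqMinusDiag.regAt_mul (hv'.1 1) (hw'.1 0))) hD hne
    · exact regAt_div (projLineSqMinusDiag.regAt_mul
        (projLineSqMinusDiag.regAt_mul h2 (hv'.1 0)) (hw'.1 0)) hD hne
    · exact regAt_div (projLineSqMinusDiag.regAt_mul
        (projLineSqMinusDiag.regAt_mul h2 (hv'.1 1)) (hw'.1 1)) hD hne
  · filter_upwards [hv'.2, hw'.2] with y ⟨h1, h2⟩ ⟨h3, h4⟩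
    have hy : y = ⟨(Projectivization.mk ℂ (v y.1) h1, Projectivization.mk ℂ (w y.1) h3),
        by rw [← h2, ← h4]; exact y.2⟩ := Subtype.ext (Prod.ext h2 h4)
    exact ((congrArg quadricMap hy).trans (quadricMap_mk _ _ _ _ _)).symm

/-- The equation is the identity (y₀z₁ + y₁z₀)² - (y₀z₁ - y₁z₀)² = 4 y₀y₁z₀z₁. Conversely, (x + 1)(x
- 1) = yz lets the two points be read off from ratios such as [x + 1 : z] and [x - 1 : z]. -/
theorem range_quadricMap : Set.range quadricMap = {v : Fin 3 → ℂ | v 1 * v 2 = v 0 ^ 2 - 1} := by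
  ext v
  constructor
  · rintro ⟨x, rfl⟩
    have hx : x.1.1.rep 0 * x.1.2.rep 1 - x.1.1.rep 1 * x.1.2.rep 0 ≠ 0 := fun h =>
      x.2 (eq_iff_planeDet_rep.2 h)
    change quadricMap x 1 * quadricMap x 2 = quadricMap x 0 ^ 2 - 1
    simp only [quadricMap, quadricCoords, Matrix.cons_val]
    rw [div_mul_div_comm, div_pow, div_sub_one (pow_ne_zero 2 hx), ← pow_two]
    congr 1
    ring
  · intro hv
    change v 1 * v 2 = v 0 ^ 2 - 1 at hv
    suffices h : ∃ y z, planeDet y z ≠ 0 ∧ quadricCoords y z = v by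
      obtain ⟨y, z, h1, h2⟩ := h
      obtain ⟨h3, h4⟩ := quadricMap_toProj h1
      exact ⟨_, h4.trans h2⟩
    -- For v₂ ≠ 0 the points [v₀ + 1 : v₂] and [v₀ - 1 : v₂] work. For v₂ = 0 the equation forces v₀
    -- = ±1, and one of the two points is [1 : 0].
    by_cases hz : v 2 = 0
    · have h0 : (v 0 - 1) * (v 0 + 1) = 0 := by rw [hz] at hv; linear_combination -hv
      rcases mul_eq_zero.1 h0 with h | h
      · refine ⟨![2, 0], ![v 1, 2], by norm_num [planeDet], ?_⟩
        ext i
        fin_cases i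
        · simp [quadricCoords]; linear_combination -h
        · simp [quadricCoords]
        · simp [quadricCoords, hz]
      · refine ⟨![v 1, -2], ![-2, 0], by norm_num [planeDet], ?_⟩
        ext i
        fin_cases i
        · simp [quadricCoords]; linear_combination -h
        · simp [quadricCoords]; field_simp
        · simp [quadricCoords, hz]
    · have hD : (v 0 + 1) * v 2 - v 2 * (v 0 - 1) = 2 * v 2 := by ring
      refine ⟨![v 0 + 1, v 2], ![v 0 - 1, v 2], ?_, ?_⟩
      · simp [planeDet, hD, hz]
      · ext i
        fin_cases i
        · simp [quadricCoords, hD]; field_simp; ring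
        · simp [quadricCoords, hD]; field_simp; linear_combination -hv
        · simp [quadricCoords, hD]; field_simp

theorem isClosed_range_quadricMap : IsClosed (X := (affineSpace 3).Pt) (Set.range quadricMap) := by
  convert isClosed_affineSpace_zeros (n := 3) (MvPolynomial.X 1 * MvPolynomial.X 2 -
    (MvPolynomial.X 0 ^ 2 - 1)) using 1
  refine range_quadricMap.trans ?_
  ext v
  change v 1 * v 2 = v 0 ^ 2 - 1 ↔ MvPolynomial.eval v _ = 0
  simp [sub_eq_zero]

/-- Only proportionality of `v (ι y)` to the coordinates of `f y` is required. The factor `s` may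
vanish for some `y`, but not near `x`, since `v` stays nonzero there. -/
theorem exists_retraction_coords {Y : Type*} {f : Y → ℙ ℂ (Fin 2 → ℂ)} {ι : Y → Fin 3 → ℂ}
    {v : (Fin 3 → ℂ) → Fin 2 → ℂ} (hv : ∀ i u, (affineSpace 3).RegAt (fun y => v y i) u) {x : Y}
    (hx : v (ι x) ≠ 0) (h : ∀ y, ∃ s : ℂ, v (ι y) = s • (f y).rep) :
    HasCoordsAt (X := affineSpace 3) (fun u => toProj (v u)) v (ι x) ∧
      ∀ᶠ u in @nhds (affineSpace 3).Pt _ (ι x), ∀ y, ι y = u → toProj (v u) = f y := by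
  have h1 := fun i => hv i (ι x)
  refine ⟨hasCoordsAt_toProj h1 hx, ?_⟩
  filter_upwards [eventually_ne_zero h1 hx] with u hu y hy
  obtain ⟨s, hs⟩ := h y
  rw [← hy] at hu ⊢
  rw [hs] at hu ⊢
  rw [toProj_smul (left_ne_zero_of_smul hu), toProj_rep]

/-- The local inverses are [y₀ : y₁] = [x + 1 : z] = [y : x - 1] and [z₀ : z₁] = [x - 1 : z] = [y :
x + 1], each valid where its right-hand side is nonzero. -/
theorem isClosedEmbedding_quadricMap :
    IsClosedEmbedding projLineSqMinusDiag (affineSpace 3) quadricMap := by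
  refine isClosedEmbedding_of_retraction_restrict isMorphism_quadricMap
    isClosed_range_quadricMap fun x => ?_
  have hne : ∀ y : {p : ℙ ℂ (Fin 2 → ℂ) × ℙ ℂ (Fin 2 → ℂ) | p.1 ≠ p.2},
      y.1.1.rep 0 * y.1.2.rep 1 - y.1.1.rep 1 * y.1.2.rep 0 ≠ 0 := fun y h =>
    y.2 (eq_iff_planeDet_rep.2 h)
  have hadd : ∀ (i : Fin 3) (c : ℂ) u, (affineSpace 3).RegAt (fun y : Fin 3 → ℂ => y i + c) u :=
    fun i c u => (affineSpace 3).regAt_add (affineSpace_regAt_coord i u)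
      ((affineSpace 3).regAt_const c u)
  have hsub : ∀ (i : Fin 3) (c : ℂ) u, (affineSpace 3).RegAt (fun y : Fin 3 → ℂ => y i - c) u :=
    fun i c u => regAt_sub (affineSpace_regAt_coord i u) ((affineSpace 3).regAt_const c u)
  have hsmul : ∀ {a : ℂ} {v : Fin 2 → ℂ}, a ≠ 0 → v ≠ 0 → a • v ≠ 0 := smul_ne_zero
  obtain ⟨v, hv, hvr⟩ : ∃ v, HasCoordsAt (X := affineSpace 3) (fun u => toProj (v u)) v
      (quadricMap x) ∧ ∀ᶠ u in @nhds (affineSpace 3).Pt _ (quadricMap x), ∀ y,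
        quadricMap y = u → toProj (v u) = y.1.1 := by
    -- The two formulas for the first point are its coordinates times 2z₀ or 2z₁ over the
    -- determinant, so the choice depends on which coordinate of the second point is nonzero.
    by_cases h1 : x.1.2.rep 1 = 0
    · have key : ∀ y, (![quadricMap y 1, quadricMap y 0 - 1] : Fin 2 → ℂ) =
          (2 * y.1.2.rep 0 / (y.1.1.rep 0 * y.1.2.rep 1 - y.1.1.rep 1 * y.1.2.rep 0)) •
            y.1.1.rep := by
        intro y
        have := hne y
        ext i
        fin_cases i
        · simp [quadricMap, quadricCoords]; ring
        · simp [quadricMap, quadricCoords]; field_simp; ring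
      refine ⟨fun u => ![u 1, u 0 - 1], exists_retraction_coords ?_ ?_ fun y => ⟨_, key y⟩⟩
      · intro i u
        fin_cases i
        exacts [affineSpace_regAt_coord 1 u, hsub 0 1 u]
      · refine fun h => hsmul (div_ne_zero (mul_ne_zero two_ne_zero ?_) (hne x)) x.1.1.rep_nonzero
          ((key x).symm.trans h)
        intro h0
        exact x.1.2.rep_nonzero (by ext i; fin_cases i <;> assumption)
    · have key : ∀ y, (![quadricMap y 0 + 1, quadricMap y 2] : Fin 2 → ℂ) =
          (2 * y.1.2.rep 1 / (y.1.1.rep 0 * y.1.2.rep 1 - y.1.1.rep 1 * y.1.2.rep 0)) •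
            y.1.1.rep := by
        intro y
        have := hne y
        ext i
        fin_cases i
        · simp [quadricMap, quadricCoords]; field_simp; ring
        · simp [quadricMap, quadricCoords]; ring
      refine ⟨fun u => ![u 0 + 1, u 2], exists_retraction_coords ?_ ?_ fun y => ⟨_, key y⟩⟩
      · intro i u
        fin_cases i
        exacts [hadd 0 1 u, affineSpace_regAt_coord 2 u]
      · exact fun h => hsmul (div_ne_zero (mul_ne_zero two_ne_zero h1) (hne x)) x.1.1.rep_nonzero
          ((key x).symm.trans h)
  obtain ⟨w, hw, hwr⟩ : ∃ w, HasCoordsAt (X := affineSpace 3) (fun u => toProj (w u)) w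
      (quadricMap x) ∧ ∀ᶠ u in @nhds (affineSpace 3).Pt _ (quadricMap x), ∀ y,
        quadricMap y = u → toProj (w u) = y.1.2 := by
    -- Symmetrically, the factors for the second point are 2y₀ and 2y₁ over the determinant.
    by_cases h1 : x.1.1.rep 1 = 0
    · have key : ∀ y, (![quadricMap y 1, quadricMap y 0 + 1] : Fin 2 → ℂ) =
          (2 * y.1.1.rep 0 / (y.1.1.rep 0 * y.1.2.rep 1 - y.1.1.rep 1 * y.1.2.rep 0)) •
            y.1.2.rep := by
        intro y
        have := hne y
        ext i
        fin_cases i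
        · simp [quadricMap, quadricCoords]; ring
        · simp [quadricMap, quadricCoords]; field_simp; ring
      refine ⟨fun u => ![u 1, u 0 + 1], exists_retraction_coords ?_ ?_ fun y => ⟨_, key y⟩⟩
      · intro i u
        fin_cases i
        exacts [affineSpace_regAt_coord 1 u, hadd 0 1 u]
      · refine fun h => hsmul (div_ne_zero (mul_ne_zero two_ne_zero ?_) (hne x)) x.1.2.rep_nonzero
          ((key x).symm.trans h)
        intro h0
        exact x.1.1.rep_nonzero (by ext i; fin_cases i <;> assumption)
    · have key : ∀ y, (![quadricMap y 0 - 1, quadricMap y 2] : Fin 2 → ℂ) =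
          (2 * y.1.1.rep 1 / (y.1.1.rep 0 * y.1.2.rep 1 - y.1.1.rep 1 * y.1.2.rep 0)) •
            y.1.2.rep := by
        intro y
        have := hne y
        ext i
        fin_cases i
        · simp [quadricMap, quadricCoords]; field_simp; ring
        · simp [quadricMap, quadricCoords]; ring
      refine ⟨fun u => ![u 0 - 1, u 2], exists_retraction_coords ?_ ?_ fun y => ⟨_, key y⟩⟩
      · intro i u
        fin_cases i
        exacts [hsub 0 1 u, affineSpace_regAt_coord 2 u]
      · exact fun h => hsmul (div_ne_zero (mul_ne_zero two_ne_zero h1) (hne x)) x.1.2.rep_nonzero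
          ((key x).symm.trans h)
  refine ⟨fun u => (toProj (v u), toProj (w u)), hv.prodMk hw, ?_⟩
  filter_upwards [hvr, hwr] with u h1 h2 y hy
  exact Prod.ext (h1 y hy) (h2 y hy)

/-! ### The linear action of PGL₂ on the quadric -/

/-- The numerator of the action of `2 × 2` matrices on quadric coordinates. -/
def quadricMatrix (g : Matrix (Fin 2) (Fin 2) ℂ) : Matrix (Fin 3) (Fin 3) ℂ :=
  !![g 0 0 * g 1 1 + g 0 1 * g 1 0, g 0 0 * g 1 0, g 0 1 * g 1 1;
     2 * g 0 0 * g 0 1, g 0 0 ^ 2, g 0 1 ^ 2;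
     2 * g 1 0 * g 1 1, g 1 0 ^ 2, g 1 1 ^ 2]

/-- This is the action on the symmetric square of ℂ², in the coordinates (y₀z₁ + y₁z₀, 2y₀z₀, 2y₁z₁)
of a symmetrized product, hence multiplicative. -/
theorem quadricMatrix_mul (g h : Matrix (Fin 2) (Fin 2) ℂ) :
    quadricMatrix (g * h) = quadricMatrix g * quadricMatrix h := by
  ext i j
  fin_cases i <;> fin_cases j <;>
    simp [quadricMatrix, Matrix.mul_apply, Fin.sum_univ_two, Fin.sum_univ_three] <;> ring

/-- The action of invertible `2 × 2` matrices on quadric coordinates. -/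
noncomputable def quadricMatrixHom : GL (Fin 2) ℂ →* Matrix (Fin 3) (Fin 3) ℂ where
  toFun g := (g.1.det)⁻¹ • quadricMatrix g.1
  map_one' := by
    ext i j
    fin_cases i <;> fin_cases j <;> simp [quadricMatrix]
  map_mul' g h := by
    rw [Units.val_mul, Matrix.det_mul, quadricMatrix_mul, Matrix.smul_mul, Matrix.mul_smul,
      smul_smul, mul_inv]

/-- The linear action of `PGL₂` on quadric coordinates. -/
noncomputable def quadricAction : PGL(2, ℂ) →* GL (Fin 3) ℂ :=
  Matrix.ProjGenLinGroup.lift quadricMatrixHom.toHomUnits <| by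
    -- A scalar u multiplies both the symmetric square and the determinant by u², so it acts
    -- trivially.
    ext u i j
    have hu : (u : ℂ) ≠ 0 := u.ne_zero
    fin_cases i <;> fin_cases j <;>
      simp [quadricMatrixHom, quadricMatrix, Matrix.det_fin_two,
        Matrix.scalar_apply] <;> field_simp

theorem quadricAction_mk (g : GL (Fin 2) ℂ) :
    (quadricAction (Matrix.ProjGenLinGroup.mk g) : Matrix (Fin 3) (Fin 3) ℂ) =
      (g 0 0 * g 1 1 - g 0 1 * g 1 0)⁻¹ •
          !![g 0 0 * g 1 1 + g 0 1 * g 1 0, g 0 0 * g 1 0, g 0 1 * g 1 1;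
             2 * g 0 0 * g 0 1, g 0 0 ^ 2, g 0 1 ^ 2;
             2 * g 1 0 * g 1 1, g 1 0 ^ 2, g 1 1 ^ 2] := by
  change (g.1.det)⁻¹ • quadricMatrix g.1 = _
  rw [Matrix.det_fin_two]
  rfl

/-- The numerators transform by the symmetric square and the common denominator by det g. -/
theorem quadricCoords_mulVec {g : Matrix (Fin 2) (Fin 2) ℂ} (hg : g.det ≠ 0) {y z : Fin 2 → ℂ}
    (h : planeDet y z ≠ 0) :
    quadricCoords (g *ᵥ y) (g *ᵥ z) = ((g.det)⁻¹ • quadricMatrix g) *ᵥ quadricCoords y z := by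
  have h1 := planeDet_mulVec g y z
  simp only [planeDet] at h h1
  ext i
  simp only [quadricCoords, h1]
  fin_cases i <;>
    simp [Matrix.mulVec, dotProduct, Fin.sum_univ_two, Fin.sum_univ_three, quadricMatrix] <;>
    field_simp <;> ring

theorem quadricMap_smul (h : PGL(2, ℂ)) (p q : ℙ ℂ (Fin 2 → ℂ)) (hpq : p ≠ q)
    (hpq' : h • p ≠ h • q) : quadricMap ⟨(h • p, h • q), hpq'⟩ =
      (quadricAction h : Matrix (Fin 3) (Fin 3) ℂ) *ᵥ quadricMap ⟨(p, q), hpq⟩ := by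
  obtain ⟨g, rfl⟩ := Matrix.ProjGenLinGroup.mk_surjective h
  induction p with | h y hy =>
  induction q with | h z hz =>
  have hg : g.1.det ≠ 0 := by
    rw [← Matrix.GeneralLinearGroup.val_det_apply]
    exact Units.ne_zero _
  rw [quadricMap_mk]
  refine (quadricMap_mk (g.1 *ᵥ y) (g.1 *ᵥ z) _ _ hpq').trans ?_
  exact quadricCoords_mulVec hg fun h0 => hpq ((mk_eq_mk_iff_planeDet hy hz).2 h0)

/-! ### The cofinite topology of the projective line -/

theorem eval_smul_of_isWeightedHomogeneous_one {m : ℕ} {D : MvPolynomial (Fin 2) ℂ}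
    (hD : MvPolynomial.IsWeightedHomogeneous (fun _ => 1) D m) (c : ℂ) (v : Fin 2 → ℂ) :
    MvPolynomial.eval (c • v) D = c ^ m * MvPolynomial.eval v D :=
  eval_mul_of_isWeightedHomogeneous hD (ψ := fun m => c ^ m) (pow_zero c) (pow_add c) v |>.symm ▸
    by simp [Pi.smul_def]

theorem exists_planeDet_ne_zero {v : Fin 2 → ℂ} (hv : v ≠ 0) : ∃ w, planeDet v w ≠ 0 := by
  by_cases h : v 0 = 0
  · refine ⟨![1, 0], fun h1 => hv ?_⟩
    ext i
    fin_cases i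
    · exact h
    · simpa [planeDet] using h1
  · exact ⟨![0, 1], by simpa [planeDet] using h⟩

theorem ne_zero_left_of_planeDet {v w : Fin 2 → ℂ} (h : planeDet v w ≠ 0) : v ≠ 0 := by
  rintro rfl
  simp [planeDet] at h

theorem ne_zero_right_of_planeDet {v w : Fin 2 → ℂ} (h : planeDet v w ≠ 0) : w ≠ 0 := by
  rintro rfl
  simp [planeDet] at h

theorem eq_smul_add_smul {v w : Fin 2 → ℂ} (h : planeDet v w ≠ 0) (u : Fin 2 → ℂ) :
    u = (planeDet u w / planeDet v w) • v + (planeDet v u / planeDet v w) • w := by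
  ext i
  rw [Pi.add_apply, Pi.smul_apply, Pi.smul_apply, smul_eq_mul, smul_eq_mul, div_mul_eq_mul_div,
    div_mul_eq_mul_div, ← add_div, eq_div_iff h]
  fin_cases i <;> simp [planeDet] <;> ring

/-- On the affine line p + t w, which misses only the point [w], the form becomes a polynomial in t
that is nonzero at t = 0. -/
theorem finite_zeros {m : ℕ} {D : MvPolynomial (Fin 2) ℂ}
    (hD : MvPolynomial.IsWeightedHomogeneous (fun _ => 1) D m) {p : ℙ ℂ (Fin 2 → ℂ)}
    (hp : MvPolynomial.eval p.rep D ≠ 0) :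
    {q : ℙ ℂ (Fin 2 → ℂ) | MvPolynomial.eval q.rep D = 0}.Finite := by
  obtain ⟨w, hw⟩ := exists_planeDet_ne_zero p.rep_nonzero
  let P : Polynomial ℂ :=
    MvPolynomial.aeval (fun i => Polynomial.C (p.rep i) + Polynomial.X * Polynomial.C (w i)) D
  have hP : ∀ t, P.eval t = MvPolynomial.eval (p.rep + t • w) D := by
    intro t
    simp only [P]
    rw [← Polynomial.coe_evalRingHom, MvPolynomial.aeval_def, MvPolynomial.hom_eval₂,
      MvPolynomial.eval, MvPolynomial.coe_eval₂Hom]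
    congr 1
    · ext; simp
    · ext i; simp; exact mul_comm _ _
  have hP0 : P ≠ 0 := by
    intro h
    have := hP 0
    rw [h, zero_smul, add_zero, Polynomial.eval_zero] at this
    exact hp this.symm
  refine ((P.rootSet_finite ℂ).image (fun t => toProj (p.rep + t • w)) |>.union
    (Set.finite_singleton (toProj w))).subset ?_
  intro q hq
  change MvPolynomial.eval q.rep D = 0 at hq
  by_cases ha : planeDet q.rep w / planeDet p.rep w = 0
  · right
    have h := eq_smul_add_smul hw q.rep
    rw [ha, zero_smul, zero_add] at h
    have hb : planeDet p.rep q.rep / planeDet p.rep w ≠ 0 := by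
      intro hb
      rw [hb, zero_smul] at h
      exact q.rep_nonzero h
    rw [Set.mem_singleton_iff, ← toProj_rep q, h, toProj_smul hb]
  · left
    have h := eq_smul_add_smul hw q.rep
    set a := planeDet q.rep w / planeDet p.rep w
    set b := planeDet p.rep q.rep / planeDet p.rep w
    have h' : q.rep = a • (p.rep + (b / a) • w) := by
      rw [smul_add, smul_smul, mul_div_cancel₀ _ ha]
      exact h
    refine ⟨b / a, ?_, ?_⟩
    · rw [Polynomial.mem_rootSet]
      refine ⟨hP0, ?_⟩
      rw [Polynomial.coe_aeval_eq_eval, hP]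
      rw [h', eval_smul_of_isWeightedHomogeneous_one hD] at hq
      exact (mul_eq_zero.1 hq).resolve_left (pow_ne_zero _ ha)
    · change toProj _ = q
      rw [← toProj_smul ha, ← h', toProj_rep]

/-- By `finite_zeros`, every non-empty basic open set has finite complement. Thus whatever holds
near one point holds at all but finitely many points. -/
theorem cofinite_le_nhds_projLine (p : projLine.Pt) :
    (Filter.cofinite : Filter projLine.Pt) ≤ 𝓝 p := by
  change Filter.Tendsto id (Filter.cofinite : Filter projLine.Pt) (𝓝 p)
  refine TopologicalSpace.tendsto_nhds_generateFrom_iff.2 ?_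
  rintro _ ⟨m, D, hD, rfl⟩ hp
  refine Filter.mem_cofinite.2 (Set.Finite.subset (finite_zeros hD hp) fun q hq => ?_)
  exact not_not.1 hq

theorem eventually_cofinite_of_nhds {S : Set projLine.Pt} {x : (projLine.restrict S).Pt}
    {P : S → Prop} (h : ∀ᶠ y in 𝓝 x, P y) :
    ∀ᶠ q in (Filter.cofinite : Filter projLine.Pt), ∀ hq : q ∈ S, P ⟨q, hq⟩ := by
  obtain ⟨U, hU, hUP⟩ := (mem_nhds_subtype S (x : S) {y | P y}).1 h
  filter_upwards [cofinite_le_nhds_projLine _ hU] with q hq hqS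
  exact hUP hq

/-- A point outside `C` would have a neighbourhood disjoint from `C`, and that neighbourhood omits
only finitely many points. -/
theorem eq_univ_of_isClosed_of_infinite {S : Set projLine.Pt} {C : Set (projLine.restrict S).Pt}
    (hC : IsClosed C) (hinf : C.Infinite) : C = Set.univ := by
  by_contra h
  obtain ⟨x, hx⟩ := (Set.ne_univ_iff_exists_notMem C).1 h
  have h1 := eventually_cofinite_of_nhds (hC.isOpen_compl.mem_nhds hx)
  refine hinf ?_
  refine Set.Finite.of_finite_image (f := (Subtype.val : S → projLine.Pt)) ?_
    Subtype.val_injective.injOn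
  refine (Filter.mem_cofinite.1 h1).subset ?_
  rintro _ ⟨y, hy, rfl⟩ h2
  exact h2 y.2 hy

theorem toProj_affine_injective {u v : Fin 2 → ℂ} (h : planeDet u v ≠ 0) :
    Function.Injective fun t : ℂ => toProj (t • u + v) := by
  have hdet : ∀ s t : ℂ, planeDet (s • u + v) (t • u + v) = (s - t) * planeDet u v := by
    intro s t
    simp [planeDet]; ring
  have hne : ∀ t : ℂ, t • u + v ≠ 0 := by
    intro t
    refine ne_zero_right_of_planeDet (v := u) ?_
    rwa [planeDet_add_right, planeDet_smul_right, planeDet_self, mul_zero, zero_add]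
  intro s t hst
  have := (toProj_eq_toProj_iff (hne s) (hne t)).1 hst
  rw [hdet] at this
  exact sub_eq_zero.1 ((mul_eq_zero.1 this).resolve_right h)

instance : Infinite (ℙ ℂ (Fin 2 → ℂ)) :=
  Infinite.of_injective _
    (toProj_affine_injective (u := ![1, 0]) (v := ![0, 1]) (by simp [planeDet]))

theorem vec_ne_zero_of_snd {a b : ℂ} (h : b ≠ 0) : (![a, b] : Fin 2 → ℂ) ≠ 0 :=
  fun h' => h (by simpa using congrFun h' 1)

theorem vec_ne_zero_of_fst {a b : ℂ} (h : a ≠ 0) : (![a, b] : Fin 2 → ℂ) ≠ 0 :=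
  fun h' => h (by simpa using congrFun h' 0)

theorem toProj_one_injective : Function.Injective fun t : ℂ => toProj ![t, 1] := by
  have := toProj_affine_injective (u := ![1, 0]) (v := ![0, 1]) (by simp [planeDet])
  simpa using this

/-! ### Automorphisms of the complement of a finite set -/

theorem mulVec_ne_zero (g : GL (Fin 2) ℂ) {v : Fin 2 → ℂ} (hv : v ≠ 0) : g.1 *ᵥ v ≠ 0 :=
  (smul_ne_zero_iff_ne g).2 hv

theorem mk_smul_toProj (g : GL (Fin 2) ℂ) {v : Fin 2 → ℂ} (hv : v ≠ 0) :
    (Matrix.ProjGenLinGroup.mk g : PGL(2, ℂ)) • toProj v = toProj (g.1 *ᵥ v) := by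
  rw [toProj_of_ne_zero hv, toProj_of_ne_zero (mulVec_ne_zero g hv)]
  rfl

theorem isMorphism_smul (h : PGL(2, ℂ)) :
    IsMorphism projLine projLine (fun q : ℙ ℂ (Fin 2 → ℂ) => h • q) := by
  refine isMorphism_iff_morphismAt.2 fun x => ?_
  obtain ⟨g, rfl⟩ := Matrix.ProjGenLinGroup.mk_surjective h
  obtain ⟨v, hv⟩ := ((isMorphism_id projLine).morphismAt x).exists_hasCoordsAt
  refine HasCoordsAt.morphismAt (v := fun y => g.1 *ᵥ v y) ⟨fun i => ?_, ?_⟩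
  · have h1 : ∀ j, projLine.RegAt (fun y => g.1 i j * v y j) x := fun j =>
      projLine.regAt_mul (projLine.regAt_const _ x) (hv.1 j)
    simpa [Matrix.mulVec, dotProduct, Fin.sum_univ_two] using projLine.regAt_add (h1 0) (h1 1)
  · filter_upwards [hv.2] with y ⟨h1, h2⟩
    refine ⟨mulVec_ne_zero g h1, ?_⟩
    exact congrArg (fun q : ℙ ℂ (Fin 2 → ℂ) => (Matrix.ProjGenLinGroup.mk g : PGL(2, ℂ)) • q) h2

/-- The fixed locus is closed and infinite, hence everything. Then (1,0), (0,1) and (1,1) are all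
eigenvectors of a lift, which is therefore scalar. -/
theorem eq_one_of_infinite_fixed {h : PGL(2, ℂ)} {F : Set (ℙ ℂ (Fin 2 → ℂ))} (hF : F.Infinite)
    (hfix : ∀ q ∈ F, h • q = q) : h = 1 := by
  have hall : ∀ q : ℙ ℂ (Fin 2 → ℂ), h • q = q := by
    have hcl := isClosed_setOf_eq_of_isMorphism (isMorphism_smul h) (isMorphism_id projLine)
    have hcl' : IsClosed (X := (projLine.restrict Set.univ).Pt)
        {q : (Set.univ : Set (ℙ ℂ (Fin 2 → ℂ))) | h • q.1 = q.1} :=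
      hcl.preimage continuous_subtype_val
    have := eq_univ_of_isClosed_of_infinite hcl' ?_
    · intro q
      exact Set.eq_univ_iff_forall.1 this ⟨q, trivial⟩
    · exact Set.Infinite.of_image (fun q : (Set.univ : Set (ℙ ℂ (Fin 2 → ℂ))) => q.1)
        (hF.mono fun q hq => ⟨⟨q, trivial⟩, hfix q hq, rfl⟩)
  obtain ⟨g, rfl⟩ := Matrix.ProjGenLinGroup.mk_surjective h
  have key : ∀ v : Fin 2 → ℂ, v ≠ 0 → planeDet (g.1 *ᵥ v) v = 0 := by
    intro v hv
    rw [← toProj_eq_toProj_iff (mulVec_ne_zero g hv) hv, ← mk_smul_toProj g hv, hall]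
  have h1 := key ![1, 0] (vec_ne_zero_of_fst one_ne_zero)
  have h2 := key ![0, 1] (vec_ne_zero_of_snd one_ne_zero)
  have h3 := key ![1, 1] (vec_ne_zero_of_fst one_ne_zero)
  simp [planeDet, Matrix.mulVec, dotProduct, Fin.sum_univ_two] at h1 h2 h3
  have h00 : g.1 0 0 = g.1 1 1 := by
    rw [h1, h2] at h3
    linear_combination h3
  have hdet : g.1.det ≠ 0 := by
    rw [← Matrix.GeneralLinearGroup.val_det_apply]
    exact Units.ne_zero _
  rw [Matrix.det_fin_two, h1, h2, mul_zero, sub_zero] at hdet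
  have hu : g = Matrix.GeneralLinearGroup.scalar (Fin 2)
      (Units.mk0 (g.1 0 0) (left_ne_zero_of_mul hdet)) := by
    ext i j
    fin_cases i <;> fin_cases j <;> simp [Matrix.scalar_apply]
    exacts [h2, h1, h00.symm]
  rw [hu, Matrix.ProjGenLinGroup.mk_scalar]

open Polynomial in
/-- A quotient of coprime polynomials that is injective away from a finite set has degree at most
one. -/
theorem natDegree_le_one_of_injOn_quotient {n d : ℂ[X]} (hc : IsCoprime n d) {S : Set ℂ}
    (hS : S.Finite) (hinj : ∀ s ∉ S, ∀ t ∉ S, n.eval t * d.eval s = n.eval s * d.eval t → t = s) :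
    n.natDegree ≤ 1 ∧ d.natDegree ≤ 1 := by
  -- A linear relation between `n` and `d` would make the quotient constant, contradicting
  -- injectivity at two points outside `S`.
  have hlin : ∀ a b : ℂ, C a * n = C b * d → a = 0 ∧ b = 0 := by
    intro a b hab
    by_contra hne
    have hev : ∀ t, a * n.eval t = b * d.eval t := fun t => by
      simpa using congrArg (eval t) hab
    obtain ⟨s, hs⟩ := hS.infinite_compl.nonempty
    obtain ⟨t, ht⟩ := (hS.union (Set.finite_singleton s)).infinite_compl.nonempty
    have hts : t ≠ s := fun h => ht (Or.inr h)
    refine hts (hinj s hs t (fun h => ht (Or.inl h)) ?_)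
    have h1 := hev t
    have h2 := hev s
    by_cases ha : a = 0
    · have hb : b ≠ 0 := fun hb => hne ⟨ha, hb⟩
      refine mul_left_cancel₀ hb ?_
      linear_combination (n.eval s) * h1 - (n.eval t) * h2
    · refine mul_left_cancel₀ ha ?_
      linear_combination (d.eval s) * h1 - (d.eval t) * h2
  -- For coprime polynomials a vanishing Wronskian forces both to be constant, which the linear
  -- independence excludes.
  have hW : wronskian n d ≠ 0 := by
    intro h
    obtain ⟨h1, h2⟩ := hc.wronskian_eq_zero_iff.1 h
    have e1 := eq_C_of_derivative_eq_zero h1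
    have e2 := eq_C_of_derivative_eq_zero h2
    have := hlin (d.coeff 0) (n.coeff 0) (by
      conv_lhs => rw [e1]
      conv_rhs => rw [e2]
      rw [mul_comm])
    rw [this.1, C_0] at e2
    rw [this.2, C_0] at e1
    rw [e1, e2] at hc
    exact not_isCoprime_zero_zero hc
  have hnd : ∀ r, n.eval r ≠ 0 ∨ d.eval r ≠ 0 := by
    intro r
    by_contra! h
    obtain ⟨a, b, hab⟩ := hc
    have := congrArg (eval r) hab
    simp [h.1, h.2] at this
  -- The roots of `Q s` are the points of the fibre of n/d through `s`.
  let Q : ℂ → ℂ[X] := fun s => C (d.eval s) * n - C (n.eval s) * d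
  have hQ0 : ∀ s, Q s ≠ 0 := by
    intro s h
    have := hlin _ _ (sub_eq_zero.1 h)
    exact (hnd s).elim (fun h => h this.2) (fun h => h this.1)
  -- Excluded are the points of `S`, the points sharing a fibre with some point of `S`, where
  -- injectivity says nothing, and the ramification points.
  have hbad : (S ∪ (⋃ r ∈ S, {s | (Q r).eval s = 0}) ∪
      {s | (wronskian n d).eval s = 0}).Finite := by
    refine (hS.union (hS.biUnion fun r _ => ?_)).union ?_
    · exact (Q r).finite_setOfPred_isRoot (hQ0 r)
    · exact (wronskian n d).finite_setOfPred_isRoot hW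
  have hdeg : ∀ s ∉ S ∪ (⋃ r ∈ S, {s | (Q r).eval s = 0}) ∪ {s | (wronskian n d).eval s = 0},
      (Q s).natDegree ≤ 1 := by
    intro s hs
    simp only [Set.mem_union, not_or] at hs
    obtain ⟨⟨hs1, hs2⟩, hs3⟩ := hs
    have hev : ∀ t, (Q s).eval t = d.eval s * n.eval t - n.eval s * d.eval t := by
      intro t; simp [Q]
    have hroot : ∀ t ∈ (Q s).roots, t = s := by
      intro t ht
      rw [mem_roots (hQ0 s), IsRoot, hev] at ht
      by_cases htS : t ∈ S
      · exfalso
        refine hs2 (Set.mem_biUnion htS ?_)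
        change (Q t).eval s = 0
        simp only [Q, eval_sub, eval_mul, eval_C]
        linear_combination -ht
      · exact hinj s hs1 t htS (by linear_combination ht)
    have hcount : (Q s).roots = Multiset.replicate (Multiset.card (Q s).roots) s :=
      Multiset.eq_replicate.2 ⟨rfl, hroot⟩
    -- The derivative of `Q s` at `s` is minus the Wronskian at `s`, so `s` is a simple root.
    have hmult : (Q s).rootMultiplicity s ≤ 1 := by
      by_contra! h
      have h2 := (one_lt_rootMultiplicity_iff_isRoot (hQ0 s)).1 h
      refine hs3 ?_
      have h3 := h2.2
      simp only [Q, IsRoot, derivative_sub, derivative_C_mul, eval_sub, eval_mul, eval_C] at h3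
      change eval s (n * derivative d - derivative n * d) = 0
      rw [eval_sub, eval_mul, eval_mul]
      linear_combination -h3
    rw [← (IsAlgClosed.splits (Q s)).natDegree_eq_card_roots.symm]
    rw [← count_roots, hcount, Multiset.count_replicate_self] at hmult
    exact hmult
  -- The coefficient of degree k of `Q s` vanishes for infinitely many `s`. This is a linear
  -- relation between `n` and `d`, with the k-th coefficients as its own coefficients.
  have hcoeff : ∀ k, 2 ≤ k → n.coeff k = 0 ∧ d.coeff k = 0 := by
    intro k hk
    have h0 : C (d.coeff k) * n = C (n.coeff k) * d := by
      refine eq_of_infinite_eval_eq _ _ (hbad.infinite_compl.mono fun s hs => ?_)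
      have h1 : (Q s).coeff k = 0 := coeff_eq_zero_of_natDegree_lt ((hdeg s hs).trans_lt hk)
      simp only [Q, coeff_sub, coeff_C_mul] at h1
      change eval s (C (d.coeff k) * n) = eval s (C (n.coeff k) * d)
      simp only [eval_mul, eval_C]
      linear_combination -h1
    exact (hlin _ _ h0).symm
  refine ⟨?_, ?_⟩
  · exact natDegree_le_iff_coeff_eq_zero.2 fun k hk => (hcoeff k hk).1
  · exact natDegree_le_iff_coeff_eq_zero.2 fun k hk => (hcoeff k hk).2

open Polynomial in
theorem exists_coprime_quotient {n d : ℂ[X]} (h : n ≠ 0 ∨ d ≠ 0) :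
    ∃ n' d' : ℂ[X], IsCoprime n' d' ∧ ∀ᶠ t in Filter.cofinite,
      toProj ![n.eval t, d.eval t] = toProj ![n'.eval t, d'.eval t] := by
  obtain ⟨n', d', hn, hd, hc⟩ : ∃ n' d', n = EuclideanDomain.gcd n d * n' ∧
      d = EuclideanDomain.gcd n d * d' ∧ IsCoprime n' d' := by
    obtain ⟨n', hn⟩ := EuclideanDomain.gcd_dvd_left n d
    obtain ⟨d', hd⟩ := EuclideanDomain.gcd_dvd_right n d
    refine ⟨n', d', hn, hd, EuclideanDomain.gcdA n d, EuclideanDomain.gcdB n d, ?_⟩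
    have hg0 : EuclideanDomain.gcd n d ≠ 0 := by
      intro h0
      rw [EuclideanDomain.gcd_eq_zero_iff] at h0
      exact h.elim (fun h => h h0.1) (fun h => h h0.2)
    refine mul_left_cancel₀ hg0 ?_
    have := EuclideanDomain.gcd_eq_gcd_ab n d
    linear_combination -this - (EuclideanDomain.gcdA n d) * hn - (EuclideanDomain.gcdB n d) * hd
  have hg0 : EuclideanDomain.gcd n d ≠ 0 := by
    intro h0
    rw [EuclideanDomain.gcd_eq_zero_iff] at h0
    exact h.elim (fun h => h h0.1) (fun h => h h0.2)
  refine ⟨n', d', hc, ?_⟩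
  have hfin := Polynomial.finite_setOfPred_isRoot hg0
  filter_upwards [hfin.compl_mem_cofinite] with t ht
  rw [← toProj_smul (c := (EuclideanDomain.gcd n d).eval t) ht ![n'.eval t, d'.eval t]]
  have h1 := congrArg (eval t) hn
  have h2 := congrArg (eval t) hd
  rw [eval_mul] at h1 h2
  rw [h1, h2]
  simp

/-- The dehomogenization of a polynomial in two variables. -/
noncomputable def dehomogenize (D : MvPolynomial (Fin 2) ℂ) : Polynomial ℂ :=
  MvPolynomial.aeval ![Polynomial.X, 1] D

theorem eval_dehomogenize (D : MvPolynomial (Fin 2) ℂ) (t : ℂ) :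
    (dehomogenize D).eval t = MvPolynomial.eval ![t, 1] D := by
  simp only [dehomogenize]
  rw [← Polynomial.coe_evalRingHom, MvPolynomial.aeval_def, MvPolynomial.hom_eval₂,
    MvPolynomial.eval, MvPolynomial.coe_eval₂Hom]
  congr 1
  · ext; simp
  · ext i; fin_cases i <;> simp

theorem toProj_eval_eq {m : ℕ} {N D : MvPolynomial (Fin 2) ℂ}
    (hN : MvPolynomial.IsWeightedHomogeneous (fun _ => 1) N m)
    (hD : MvPolynomial.IsWeightedHomogeneous (fun _ => 1) D m) {c : ℂ} (hc : c ≠ 0)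
    (v : Fin 2 → ℂ) :
    toProj ![MvPolynomial.eval (c • v) N, MvPolynomial.eval (c • v) D] =
      toProj ![MvPolynomial.eval v N, MvPolynomial.eval v D] := by
  rw [eval_smul_of_isWeightedHomogeneous_one hN, eval_smul_of_isWeightedHomogeneous_one hD,
    ← toProj_smul (pow_ne_zero m hc) ![MvPolynomial.eval v N, MvPolynomial.eval v D]]
  simp

/-- Morphisms from a cofinite subset of the projective line to the projective line are given,
outside a finite set, by a quotient of coprime polynomials. -/
theorem exists_polynomial_quotient {Λ : Set (ℙ ℂ (Fin 2 → ℂ))} (hΛ : Λ.Finite)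
    {f : (projLineMinus Λ).Pt → projLine.Pt} (hf : IsMorphism (projLineMinus Λ) projLine f) :
    ∃ n d : Polynomial ℂ, IsCoprime n d ∧ ∀ᶠ t in Filter.cofinite,
      ∃ h : toProj ![t, 1] ∈ Λᶜ, f ⟨toProj ![t, 1], h⟩ = toProj ![n.eval t, d.eval t] := by
  obtain ⟨x, hx⟩ := hΛ.infinite_compl.nonempty
  obtain ⟨v, hv1, hv2⟩ := (hf.morphismAt ⟨x, hx⟩).exists_hasCoordsAt
  obtain ⟨k0, ⟨m0, N0, D0, hN0, hD0, hx0, hk0⟩, hvk0⟩ := hv1 0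
  obtain ⟨k1, ⟨m1, N1, D1, hN1, hD1, hx1, hk1⟩, hvk1⟩ := hv1 1
  have e0 := eventually_eval_ne_zero _ _ hD0 hx0
  have e1 := eventually_eval_ne_zero _ _ hD1 hx1
  -- The coordinates (N₀/D₀, N₁/D₁) are cleared to (N₀D₁, N₁D₀), both of degree m₀ + m₁.
  have hN := hN0.mul hD1
  have hD := hN1.mul hD0
  rw [add_comm m1 m0] at hD
  have hcof : ∀ᶠ q in (Filter.cofinite : Filter (ℙ ℂ (Fin 2 → ℂ))), ∃ h : q ∈ Λᶜ,
      (![MvPolynomial.eval q.rep (N0 * D1), MvPolynomial.eval q.rep (N1 * D0)] : Fin 2 → ℂ) ≠ 0 ∧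
      f ⟨q, h⟩ = toProj ![MvPolynomial.eval q.rep (N0 * D1),
        MvPolynomial.eval q.rep (N1 * D0)] := by
    filter_upwards [eventually_cofinite_of_nhds hv2, eventually_cofinite_of_nhds hvk0,
      eventually_cofinite_of_nhds hvk1, cofinite_le_nhds_projLine x hk0,
      cofinite_le_nhds_projLine x hk1, cofinite_le_nhds_projLine x e0,
      cofinite_le_nhds_projLine x e1, hΛ.compl_mem_cofinite] with q h1 h2 h3 h4 h5 h6 h7 hq
    obtain ⟨h8, h9⟩ := h1 hq
    have h6' : MvPolynomial.eval q.rep D0 ≠ 0 := h6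
    have h7' : MvPolynomial.eval q.rep D1 ≠ 0 := h7
    have hw : (![MvPolynomial.eval q.rep (N0 * D1), MvPolynomial.eval q.rep (N1 * D0)] :
        Fin 2 → ℂ) = (MvPolynomial.eval q.rep D0 * MvPolynomial.eval q.rep D1) • v ⟨q, hq⟩ := by
      ext i
      fin_cases i
      · simp only [Fin.zero_eta, Pi.smul_apply, smul_eq_mul]
        rw [h2 hq]
        erw [h4]
        simp
        field_simp
      · simp only [Fin.mk_one, Pi.smul_apply, smul_eq_mul]
        rw [h3 hq]
        erw [h5]
        simp
        field_simp
    have hc : MvPolynomial.eval q.rep D0 * MvPolynomial.eval q.rep D1 ≠ 0 := mul_ne_zero h6 h7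
    refine ⟨hq, ?_, ?_⟩
    · rw [hw]
      exact smul_ne_zero hc h8
    · rw [hw, toProj_smul hc, toProj_of_ne_zero h8]
      exact h9
  have hcof' := toProj_one_injective.tendsto_cofinite.eventually hcof
  have key : ∀ᶠ t in (Filter.cofinite : Filter ℂ), ∃ h : toProj ![t, 1] ∈ Λᶜ,
      (![(dehomogenize (N0 * D1)).eval t, (dehomogenize (N1 * D0)).eval t] : Fin 2 → ℂ) ≠ 0 ∧
      f ⟨toProj ![t, 1], h⟩ =
        toProj ![(dehomogenize (N0 * D1)).eval t, (dehomogenize (N1 * D0)).eval t] := by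
    filter_upwards [hcof'] with t ⟨h1, h2, h3⟩
    have hne : (![t, 1] : Fin 2 → ℂ) ≠ 0 := vec_ne_zero_of_snd one_ne_zero
    obtain ⟨c, hc⟩ := Projectivization.exists_smul_eq_mk_rep ℂ ![t, 1] hne
    rw [← toProj_of_ne_zero hne] at hc
    rw [← hc, Units.smul_def] at h2 h3
    refine ⟨h1, ?_, ?_⟩
    · rw [eval_dehomogenize, eval_dehomogenize]
      intro h
      refine h2 ?_
      rw [eval_smul_of_isWeightedHomogeneous_one hN, eval_smul_of_isWeightedHomogeneous_one hD]
      have a0 := congrFun h 0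
      have a1 := congrFun h 1
      simp only [Matrix.cons_val_zero, Matrix.cons_val_one, Pi.zero_apply] at a0 a1
      rw [a0, a1]
      simp
    · rw [eval_dehomogenize, eval_dehomogenize, h3]
      exact toProj_eval_eq hN hD c.ne_zero _
  have hne : dehomogenize (N0 * D1) ≠ 0 ∨ dehomogenize (N1 * D0) ≠ 0 := by
    obtain ⟨t, h1, h2, h3⟩ := key.exists
    by_contra! h
    rw [h.1, h.2] at h2
    exact h2 (by ext i; fin_cases i <;> simp)
  obtain ⟨n, d, hc, hnd⟩ := exists_coprime_quotient hne
  refine ⟨n, d, hc, ?_⟩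
  filter_upwards [key, hnd] with t ⟨h1, _, h2⟩ h3
  exact ⟨h1, h2.trans h3⟩

theorem morphismAt_smul_val (Λ : Set (ℙ ℂ (Fin 2 → ℂ))) (h : PGL(2, ℂ))
    (x : (projLineMinus Λ).Pt) : MorphismAt (projLineMinus Λ) projLine
      (fun q : (Λᶜ : Set (ℙ ℂ (Fin 2 → ℂ))) => h • q.1) x :=
  MorphismAt.comp (X := projLineMinus Λ) (Y := projLine) (Z := projLine)
    (g := fun q : ℙ ℂ (Fin 2 → ℂ) => h • q) (f := (Subtype.val : (Λᶜ : Set projLine.Pt) → _))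
    ((isMorphism_smul h).morphismAt _) (morphismAt_val projLine Λᶜ x)

/-- Injective morphisms from a cofinite subset of the projective line to the projective line are
projective transformations. -/
theorem exists_eq_smul_of_injective {Λ : Set (ℙ ℂ (Fin 2 → ℂ))} (hΛ : Λ.Finite)
    {f : (projLineMinus Λ).Pt → projLine.Pt} (hf : IsMorphism (projLineMinus Λ) projLine f)
    (hinj : Function.Injective f) :
    ∃ h : PGL(2, ℂ), ∀ q : (Λᶜ : Set (ℙ ℂ (Fin 2 → ℂ))), f q = h • q.1 := by
  obtain ⟨n, d, hc, hnd⟩ := exists_polynomial_quotient hΛ hf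
  have hnz : ∀ t, (![n.eval t, d.eval t] : Fin 2 → ℂ) ≠ 0 := by
    intro t h
    obtain ⟨a, b, hab⟩ := hc
    have h0 := congrFun h 0
    have h1 := congrFun h 1
    simp only [Matrix.cons_val_zero, Matrix.cons_val_one, Pi.zero_apply] at h0 h1
    have := congrArg (Polynomial.eval t) hab
    simp [h0, h1] at this
  have hS := Filter.eventually_cofinite.1 hnd
  set S := {t : ℂ | ¬ ∃ h : toProj ![t, 1] ∈ Λᶜ,
    f ⟨toProj ![t, 1], h⟩ = toProj ![n.eval t, d.eval t]} with hSdef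
  have hinj' : ∀ s ∉ S, ∀ t ∉ S, n.eval t * d.eval s = n.eval s * d.eval t → t = s := by
    intro s hs t ht hst
    obtain ⟨h1, h2⟩ := not_not.1 hs
    obtain ⟨h3, h4⟩ := not_not.1 ht
    have : f ⟨toProj ![t, 1], h3⟩ = f ⟨toProj ![s, 1], h1⟩ := by
      refine h4.trans (((toProj_eq_toProj_iff (hnz t) (hnz s)).2 ?_).trans h2.symm)
      simp only [planeDet, Matrix.cons_val_zero, Matrix.cons_val_one]
      linear_combination hst
    exact toProj_one_injective (congrArg Subtype.val (hinj this))
  obtain ⟨hn, hd⟩ := natDegree_le_one_of_injOn_quotient hc hS hinj'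
  have hne : ∀ t, n.eval t = n.coeff 1 * t + n.coeff 0 := fun t => by
    conv_lhs => rw [Polynomial.eq_X_add_C_of_natDegree_le_one hn]
    simp
  have hde : ∀ t, d.eval t = d.coeff 1 * t + d.coeff 0 := fun t => by
    conv_lhs => rw [Polynomial.eq_X_add_C_of_natDegree_le_one hd]
    simp
  -- A zero determinant would make n/d constant, against injectivity.
  have hdet : (!![n.coeff 1, n.coeff 0; d.coeff 1, d.coeff 0]).det ≠ 0 := by
    rw [Matrix.det_fin_two_of]
    intro h0
    obtain ⟨s, hs⟩ := hS.infinite_compl.nonempty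
    obtain ⟨t, ht⟩ := (hS.union (Set.finite_singleton s)).infinite_compl.nonempty
    refine ht (Or.inr (hinj' s hs t (fun h => ht (Or.inl h)) ?_))
    rw [hne, hne, hde, hde]
    linear_combination (t - s) * h0
  let g : GL (Fin 2) ℂ := Matrix.GeneralLinearGroup.mkOfDetNeZero _ hdet
  have hg : ∀ t : ℂ, g.1 *ᵥ ![t, 1] = ![n.eval t, d.eval t] := by
    intro t
    rw [hne, hde]
    ext i
    fin_cases i <;> simp [g, Matrix.GeneralLinearGroup.mkOfDetNeZero] <;> exact mul_comm _ _
  refine ⟨Matrix.ProjGenLinGroup.mk g, ?_⟩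
  -- `f` and the projective transformation agree on an infinite set, and their locus of agreement is
  -- closed.
  have hcl := isClosed_setOf_eq_of_isMorphism hf
    (isMorphism_iff_morphismAt.2 (morphismAt_smul_val Λ (Matrix.ProjGenLinGroup.mk g)))
  have huniv := eq_univ_of_isClosed_of_infinite hcl ?_
  · exact fun q => Set.eq_univ_iff_forall.1 huniv q
  · refine Set.Infinite.of_image (Subtype.val : (Λᶜ : Set (ℙ ℂ (Fin 2 → ℂ))) → _)
      ((hS.infinite_compl.image toProj_one_injective.injOn).mono ?_)
    rintro _ ⟨t, ht, rfl⟩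
    obtain ⟨h1, h2⟩ := not_not.1 ht
    refine ⟨⟨_, h1⟩, ?_, rfl⟩
    refine h2.trans ?_
    change _ = (Matrix.ProjGenLinGroup.mk g : PGL(2, ℂ)) • toProj ![t, 1]
    rw [mk_smul_toProj _ (vec_ne_zero_of_snd one_ne_zero), hg]

theorem smul_mem_compl_iff_of_mem_stabilizer {Λ : Set (ℙ ℂ (Fin 2 → ℂ))} {h : PGL(2, ℂ)}
    (hh : h ∈ MulAction.stabilizer PGL(2, ℂ) Λ) (q : ℙ ℂ (Fin 2 → ℂ)) :
    h • q ∈ Λᶜ ↔ q ∈ Λᶜ := by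
  have h1 : h • Λ = Λ := hh
  rw [Set.mem_compl_iff, Set.mem_compl_iff, not_iff_not]
  conv_lhs => rw [← h1]
  exact Set.smul_mem_smul_set_iff

/-- Projective transformations preserving `Λ` restrict to automorphisms of the complement. -/
noncomputable def autOfStabilizer (Λ : Set (ℙ ℂ (Fin 2 → ℂ))) :
    MulAction.stabilizer PGL(2, ℂ) Λ →* (projLineMinus Λ).Aut where
  toFun h := ⟨
    { toFun := fun q : (Λᶜ : Set (ℙ ℂ (Fin 2 → ℂ))) =>
        (⟨h.1 • q.1, (smul_mem_compl_iff_of_mem_stabilizer h.2 _).2 q.2⟩ :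
          (Λᶜ : Set (ℙ ℂ (Fin 2 → ℂ))))
      invFun := fun q : (Λᶜ : Set (ℙ ℂ (Fin 2 → ℂ))) =>
        (⟨(h⁻¹).1 • q.1, (smul_mem_compl_iff_of_mem_stabilizer (h⁻¹).2 _).2 q.2⟩ :
          (Λᶜ : Set (ℙ ℂ (Fin 2 → ℂ))))
      left_inv := fun q : (Λᶜ : Set (ℙ ℂ (Fin 2 → ℂ))) => Subtype.ext (inv_smul_smul h.1 q.1)
      right_inv := fun q : (Λᶜ : Set (ℙ ℂ (Fin 2 → ℂ))) => Subtype.ext (smul_inv_smul h.1 q.1) },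
    isMorphism_iff_morphismAt.2 fun x => morphismAt_restrict
      (morphismAt_smul_val Λ h.1 x),
    isMorphism_iff_morphismAt.2 fun x => morphismAt_restrict
      (morphismAt_smul_val Λ (h⁻¹).1 x)⟩
  map_one' := Subtype.ext (Equiv.ext fun q : (Λᶜ : Set (ℙ ℂ (Fin 2 → ℂ))) =>
    Subtype.ext (one_smul PGL(2, ℂ) q.1))
  map_mul' h k := Subtype.ext (Equiv.ext fun q : (Λᶜ : Set (ℙ ℂ (Fin 2 → ℂ))) =>
    Subtype.ext (mul_smul h.1 k.1 q.1))

/-- Injectivity holds because a transformation fixing infinitely many points is trivial. For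
surjectivity, an automorphism followed by the inclusion in ℙ¹ is an injective morphism, hence
projective, and it preserves the complement of `Λ`. -/
theorem autOfStabilizer_bijective {Λ : Set (ℙ ℂ (Fin 2 → ℂ))} (hΛ : Λ.Finite) :
    Function.Bijective (autOfStabilizer Λ) := by
  constructor
  · rw [injective_iff_map_eq_one]
    intro h hh
    refine Subtype.ext (eq_one_of_infinite_fixed hΛ.infinite_compl fun q hq => ?_)
    exact congrArg Subtype.val (DFunLike.congr_fun (congrArg Subtype.val hh) ⟨q, hq⟩)
  · intro φ
    have hval := isMorphism_iff_morphismAt.2 (morphismAt_val projLine Λᶜ)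
    obtain ⟨h, hh⟩ := exists_eq_smul_of_injective hΛ (hval.comp φ.2.1)
      (Subtype.val_injective.comp φ.1.injective)
    have hstab : h • Λ = Λ := by
      rw [← compl_inj_iff, ← Set.smul_set_compl]
      ext q
      constructor
      · rintro ⟨p, hp, rfl⟩
        change h • p ∈ Λᶜ
        rw [← hh ⟨p, hp⟩]
        exact (φ.1 ⟨p, hp⟩).2
      · intro hq
        obtain ⟨p, hp⟩ := φ.1.surjective ⟨q, hq⟩
        exact ⟨p.1, p.2, (hh p).symm.trans (congrArg Subtype.val hp)⟩
    exact ⟨⟨h, hstab⟩, Subtype.ext (Equiv.ext fun q => Subtype.ext (hh q).symm)⟩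

/-- The automorphisms of the complement of a finite subset of the projective line are the projective
transformations preserving this subset. -/
noncomputable def autEquivStabilizer {Λ : Set (ℙ ℂ (Fin 2 → ℂ))} (hΛ : Λ.Finite) :
    (projLineMinus Λ).Aut ≃* MulAction.stabilizer PGL(2, ℂ) Λ :=
  (MulEquiv.ofBijective (autOfStabilizer Λ) (autOfStabilizer_bijective hΛ)).symm

theorem autEquivStabilizer_apply {Λ : Set (ℙ ℂ (Fin 2 → ℂ))} (hΛ : Λ.Finite)
    (φ : (projLineMinus Λ).Aut) (q : (Λᶜ : Set (ℙ ℂ (Fin 2 → ℂ)))) :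
    (φ.1 q).1 = (autEquivStabilizer hΛ φ).1 • q.1 := by
  obtain ⟨h, rfl⟩ := (autEquivStabilizer hΛ).symm.surjective φ
  rw [MulEquiv.apply_symm_apply]
  rfl

/-! ### An equivariant self-map with prescribed fixed points -/

theorem FunSpace.regAt_sum {X : FunSpace} {ι : Type*} (s : Finset ι) {f : ι → X.Pt → ℂ} {x : X.Pt}
    (hf : ∀ i ∈ s, X.RegAt (f i) x) : X.RegAt (fun y => ∑ i ∈ s, f i y) x := by
  induction s using Finset.cons_induction with
  | empty => simpa using X.regAt_const 0 x
  | cons i s hi ih =>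
    simp only [Finset.sum_cons]
    exact X.regAt_add (hf i (Finset.mem_cons_self i s))
      (ih fun j hj => hf j (Finset.mem_cons_of_mem hj))

theorem FunSpace.regAt_prod {X : FunSpace} {ι : Type*} (s : Finset ι) {f : ι → X.Pt → ℂ}
    {x : X.Pt} (hf : ∀ i ∈ s, X.RegAt (f i) x) : X.RegAt (fun y => ∏ i ∈ s, f i y) x := by
  induction s using Finset.cons_induction with
  | empty => simpa using X.regAt_const 1 x
  | cons i s hi ih =>
    simp only [Finset.prod_cons]
    exact X.regAt_mul (hf i (Finset.mem_cons_self i s))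
      (ih fun j hj => hf j (Finset.mem_cons_of_mem hj))

open Classical in
/-- The Hamiltonian vector field of the binary form with set of zeros `s`. -/
noncomputable def polarVec (s : Finset (ℙ ℂ (Fin 2 → ℂ))) (v : Fin 2 → ℂ) : Fin 2 → ℂ :=
  ∑ q ∈ s, (∏ r ∈ s.erase q, planeDet r.rep v) • q.rep

theorem polarVec_smul (s : Finset (ℙ ℂ (Fin 2 → ℂ))) (c : ℂ) (v : Fin 2 → ℂ) :
    polarVec s (c • v) = c ^ (s.card - 1) • polarVec s v := by
  classical
  rw [polarVec, polarVec, Finset.smul_sum]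
  refine Finset.sum_congr rfl fun q hq => ?_
  simp only [planeDet_smul_right]
  rw [Finset.prod_mul_distrib, Finset.prod_const, Finset.card_erase_of_mem hq, smul_smul]

/-- Euler's relation for the form F(v) = ∏ det(r, v): pairing the summand of `q` with `v` restores
the missing factor, so each of the deg F summands contributes F(v). -/
theorem planeDet_polarVec (s : Finset (ℙ ℂ (Fin 2 → ℂ))) (v : Fin 2 → ℂ) :
    planeDet (polarVec s v) v = s.card * ∏ r ∈ s, planeDet r.rep v := by
  classical
  have hsum : planeDet (polarVec s v) v =
      ∑ q ∈ s, (∏ r ∈ s.erase q, planeDet r.rep v) * planeDet q.rep v := by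
    simp only [planeDet, polarVec, Finset.sum_apply, Finset.sum_mul, Pi.smul_apply, smul_eq_mul]
    rw [← Finset.sum_sub_distrib]
    exact Finset.sum_congr rfl fun q _ => by ring
  rw [hsum, Finset.sum_congr rfl fun q hq => Finset.prod_erase_mul s _ hq, Finset.sum_const,
    nsmul_eq_mul]

/-- Away from the zeros of F this follows from Euler's relation. At a zero `q`, every summand except
that of `q` contains the factor det(q, q) = 0, and the remaining one is nonzero since the points are
distinct. -/
theorem polarVec_ne_zero {s : Finset (ℙ ℂ (Fin 2 → ℂ))} (hs : s.Nonempty) {v : Fin 2 → ℂ}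
    (hv : v ≠ 0) : polarVec s v ≠ 0 := by
  classical
  by_cases h : ∏ r ∈ s, planeDet r.rep v = 0
  · obtain ⟨q, hq, hqv⟩ := Finset.prod_eq_zero_iff.1 h
    obtain ⟨c, rfl⟩ := eq_smul_of_planeDet_eq_zero q.rep_nonzero hqv
    have hc := left_ne_zero_of_smul hv
    rw [polarVec_smul]
    refine smul_ne_zero (pow_ne_zero _ hc) ?_
    rw [polarVec, Finset.sum_eq_single q]
    · refine smul_ne_zero (Finset.prod_ne_zero_iff.2 fun r hr h0 => ?_) q.rep_nonzero
      exact Finset.ne_of_mem_erase hr (eq_iff_planeDet_rep.2 h0)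
    · intro r _ hrq
      rw [Finset.prod_eq_zero (Finset.mem_erase.2 ⟨hrq.symm, hq⟩) (planeDet_self _), zero_smul]
    · exact fun h => absurd hq h
  · refine ne_zero_left_of_planeDet (w := v) ?_
    rw [planeDet_polarVec]
    exact mul_ne_zero (Nat.cast_ne_zero.2 hs.card_ne_zero) h

/-- The map of the projective line given by the Hamiltonian vector field of the binary form with
set of zeros `s`. -/
noncomputable def polarMap (s : Finset (ℙ ℂ (Fin 2 → ℂ))) (q : ℙ ℂ (Fin 2 → ℂ)) :
    ℙ ℂ (Fin 2 → ℂ) :=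
  toProj (polarVec s q.rep)

theorem polarMap_toProj (s : Finset (ℙ ℂ (Fin 2 → ℂ))) {v : Fin 2 → ℂ} (hv : v ≠ 0) :
    polarMap s (toProj v) = toProj (polarVec s v) := by
  obtain ⟨c, hc⟩ := Projectivization.exists_smul_eq_mk_rep ℂ v hv
  rw [polarMap, toProj_of_ne_zero hv, ← hc, Units.smul_def, polarVec_smul,
    toProj_smul (pow_ne_zero _ c.ne_zero)]

theorem polarMap_eq_self_iff {s : Finset (ℙ ℂ (Fin 2 → ℂ))} (hs : s.Nonempty)
    (q : ℙ ℂ (Fin 2 → ℂ)) : polarMap s q = q ↔ q ∈ s := by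
  conv_lhs => rw [← toProj_rep q]
  rw [polarMap_toProj s q.rep_nonzero,
    toProj_eq_toProj_iff (polarVec_ne_zero hs q.rep_nonzero) q.rep_nonzero, planeDet_polarVec,
    mul_eq_zero, Nat.cast_eq_zero, or_iff_right hs.card_ne_zero, Finset.prod_eq_zero_iff]
  constructor
  · rintro ⟨r, hr, h⟩
    rwa [← eq_iff_planeDet_rep.2 h]
  · exact fun h => ⟨q, h, planeDet_self _⟩

theorem isMorphism_polarMap {s : Finset (ℙ ℂ (Fin 2 → ℂ))} (hs : s.Nonempty) :
    IsMorphism projLine projLine (polarMap s) := by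
  classical
  refine isMorphism_iff_morphismAt.2 fun x => ?_
  obtain ⟨v, hv⟩ := ((isMorphism_id projLine).morphismAt x).exists_hasCoordsAt
  refine HasCoordsAt.morphismAt (v := fun y => polarVec s (v y)) ⟨fun i => ?_, ?_⟩
  · simp only [polarVec, Finset.sum_apply, Pi.smul_apply, smul_eq_mul]
    refine regAt_sum s fun q _ => projLine.regAt_mul (regAt_prod _ fun r _ => ?_)
      (projLine.regAt_const _ x)
    exact regAt_sub (projLine.regAt_mul (projLine.regAt_const _ x) (hv.1 1))
      (projLine.regAt_mul (projLine.regAt_const _ x) (hv.1 0))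
  · filter_upwards [hv.2] with y ⟨h1, h2⟩
    refine ⟨polarVec_ne_zero hs h1, ?_⟩
    rw [← toProj_of_ne_zero h1] at h2
    exact (congrArg (polarMap s) h2).trans
      ((polarMap_toProj s h1).trans (toProj_of_ne_zero (polarVec_ne_zero hs h1)))

/-- `h` permutes `s`, so a lift `g` permutes the summands of `polarVec` up to scalars; these scalars
turn out to be the same for every summand. -/
theorem polarMap_smul {s : Finset (ℙ ℂ (Fin 2 → ℂ))} (hs : s.Nonempty) {h : PGL(2, ℂ)}
    (hh : ∀ q, h • q ∈ s ↔ q ∈ s) (q : ℙ ℂ (Fin 2 → ℂ)) :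
    polarMap s (h • q) = h • polarMap s q := by
  classical
  obtain ⟨g, rfl⟩ := Matrix.ProjGenLinGroup.mk_surjective h
  have hrep : ∀ r : ℙ ℂ (Fin 2 → ℂ), ∃ c : ℂ, c ≠ 0 ∧
      ((Matrix.ProjGenLinGroup.mk g : PGL(2, ℂ)) • r).rep = c • (g.1 *ᵥ r.rep) := by
    intro r
    obtain ⟨c, hc⟩ := Projectivization.exists_smul_eq_mk_rep ℂ (g.1 *ᵥ r.rep)
      (mulVec_ne_zero g r.rep_nonzero)
    refine ⟨c, c.ne_zero, ?_⟩
    conv_lhs => rw [← toProj_rep r]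
    rw [mk_smul_toProj g r.rep_nonzero, toProj_of_ne_zero (mulVec_ne_zero g r.rep_nonzero), ← hc,
      Units.smul_def]
  choose c hc hcr using hrep
  have hdet : g.1.det ≠ 0 := by
    rw [← Matrix.GeneralLinearGroup.val_det_apply]
    exact Units.ne_zero _
  -- Each summand has |s| - 1 determinants, giving the power of det g. Each representative occurs in
  -- it exactly once, as a factor or as the vector, giving the product of all `c r`.
  have key : ∀ v : Fin 2 → ℂ, polarVec s (g.1 *ᵥ v) =
      ((∏ r ∈ s, c r) * g.1.det ^ (s.card - 1)) • (g.1 *ᵥ polarVec s v) := by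
    intro v
    rw [polarVec, polarVec, Matrix.mulVec_sum, Finset.smul_sum]
    symm
    refine Finset.sum_equiv (MulAction.toPerm (Matrix.ProjGenLinGroup.mk g : PGL(2, ℂ)))
      (fun r => (hh r).symm) fun p hp => ?_
    rw [MulAction.toPerm_apply, hcr]
    have hprod : ∏ r ∈ s.erase ((Matrix.ProjGenLinGroup.mk g : PGL(2, ℂ)) • p),
        planeDet r.rep (g.1 *ᵥ v) =
        (∏ r ∈ s.erase p, c r) * g.1.det ^ (s.card - 1) * ∏ r ∈ s.erase p, planeDet r.rep v := by
      rw [← Finset.card_erase_of_mem hp, ← Finset.prod_const, ← Finset.prod_mul_distrib,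
        ← Finset.prod_mul_distrib]
      symm
      refine Finset.prod_equiv (MulAction.toPerm (Matrix.ProjGenLinGroup.mk g : PGL(2, ℂ)))
        (fun r => ?_) fun r _ => ?_
      · simp [hh]
      · rw [MulAction.toPerm_apply, hcr, planeDet_smul_left, planeDet_mulVec, mul_assoc]
    rw [hprod, Matrix.mulVec_smul, smul_smul, smul_smul, ← Finset.prod_erase_mul s c hp]
    congr 1
    ring
  have hK : (∏ r ∈ s, c r) * g.1.det ^ (s.card - 1) ≠ 0 :=
    mul_ne_zero (Finset.prod_ne_zero_iff.2 fun r _ => hc r) (pow_ne_zero _ hdet)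
  conv_lhs => rw [← toProj_rep q]
  rw [mk_smul_toProj g q.rep_nonzero, polarMap_toProj s (mulVec_ne_zero g q.rep_nonzero), key,
    toProj_smul hK, polarMap, mk_smul_toProj g (polarVec_ne_zero hs q.rep_nonzero)]

/-- One or two points are allowed, so that this also covers the affine line and the punctured line;
for one point `δ` is constant. -/
theorem exists_equivariant_map {Λ : Set (ℙ ℂ (Fin 2 → ℂ))} (hΛ : Λ.Finite) (hne : Λ.Nonempty) :
    ∃ δ : ℙ ℂ (Fin 2 → ℂ) → ℙ ℂ (Fin 2 → ℂ), FunSpace.IsMorphism projLine projLine δ ∧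
      (∀ h ∈ MulAction.stabilizer PGL(2, ℂ) Λ, ∀ q, δ (h • q) = h • δ q) ∧
      ∀ q, δ q = q ↔ q ∈ Λ := by
  have hs : hΛ.toFinset.Nonempty := (hΛ.toFinset_nonempty).2 hne
  refine ⟨polarMap hΛ.toFinset, isMorphism_polarMap hs, fun h hh q => ?_, fun q => ?_⟩
  · refine polarMap_smul hs (fun r => ?_) q
    rw [hΛ.mem_toFinset, hΛ.mem_toFinset]
    exact not_iff_not.1 (smul_mem_compl_iff_of_mem_stabilizer hh r)
  · rw [polarMap_eq_self_iff hs, hΛ.mem_toFinset]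

/-! ### The graph embedding -/

/-- The graph of a map of the projective line with set of fixed points `Λ`. -/
def graphMap {Λ : Set (ℙ ℂ (Fin 2 → ℂ))} {δ : ℙ ℂ (Fin 2 → ℂ) → ℙ ℂ (Fin 2 → ℂ)}
    (hfix : ∀ q, δ q = q ↔ q ∈ Λ) (q : (Λᶜ : Set (ℙ ℂ (Fin 2 → ℂ)))) :
    {p : ℙ ℂ (Fin 2 → ℂ) × ℙ ℂ (Fin 2 → ℂ) | p.1 ≠ p.2} :=
  ⟨(q.1, δ q.1), fun hq => q.2 ((hfix q.1).1 hq.symm)⟩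

/-- The image is the closed locus where `δ` of the first coordinate equals the second, and the first
projection is a retraction. -/
theorem isClosedEmbedding_graphMap {Λ : Set (ℙ ℂ (Fin 2 → ℂ))}
    {δ : ℙ ℂ (Fin 2 → ℂ) → ℙ ℂ (Fin 2 → ℂ)} (hδ : IsMorphism projLine projLine δ)
    (hfix : ∀ q, δ q = q ↔ q ∈ Λ) :
    IsClosedEmbedding (projLineMinus Λ) projLineSqMinusDiag (graphMap hfix) := by
  have hfst : IsMorphism projLineSqMinusDiag projLine
      (fun y : {p : ℙ ℂ (Fin 2 → ℂ) × ℙ ℂ (Fin 2 → ℂ) | p.1 ≠ p.2} => y.1.1) :=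
    isMorphism_iff_morphismAt.2 fun y =>
      ((exists_hasCoordsAt_fst y.1).choose_spec.comp (morphismAt_val projLineSq _ y)).morphismAt
  have hsnd : IsMorphism projLineSqMinusDiag projLine
      (fun y : {p : ℙ ℂ (Fin 2 → ℂ) × ℙ ℂ (Fin 2 → ℂ) | p.1 ≠ p.2} => y.1.2) :=
    isMorphism_iff_morphismAt.2 fun y =>
      ((exists_hasCoordsAt_snd y.1).choose_spec.comp (morphismAt_val projLineSq _ y)).morphismAt
  have hmor : IsMorphism (projLineMinus Λ) projLineSqMinusDiag (graphMap hfix) :=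
    isMorphism_iff_morphismAt.2 fun x => morphismAt_restrict
      ((morphismAt_val projLine Λᶜ x).prodMk
        (MorphismAt.comp (hδ.morphismAt _) (morphismAt_val projLine Λᶜ x)))
  refine isClosedEmbedding_of_retraction_restrict hmor ?_ fun x => ⟨_, hfst.morphismAt _,
    Filter.Eventually.of_forall ?_⟩
  · have hcl := isClosed_setOf_eq_of_isMorphism (hδ.comp hfst) hsnd
    convert hcl using 1
    ext y
    constructor
    · rintro ⟨q, rfl⟩
      rfl
    · intro hy
      change δ y.1.1 = y.1.2 at hy
      refine ⟨⟨y.1.1, fun h => y.2 ?_⟩, Subtype.ext (Prod.ext rfl hy)⟩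
      rw [← hy]
      exact ((hfix _).2 h).symm
  · rintro y x' rfl
    rfl

theorem isEquivariantEmbedding_of_equivariant_map {Λ : Set (ℙ ℂ (Fin 2 → ℂ))} (hΛ : Λ.Finite)
    {δ : ℙ ℂ (Fin 2 → ℂ) → ℙ ℂ (Fin 2 → ℂ)} (hδ : IsMorphism projLine projLine δ)
    (hequiv : ∀ h ∈ MulAction.stabilizer PGL(2, ℂ) Λ, ∀ q, δ (h • q) = h • δ q)
    (hfix : ∀ q, δ q = q ↔ q ∈ Λ) :
    IsEquivariantEmbedding (projLineMinus Λ)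
      (quadricAction.comp ((MulAction.stabilizer PGL(2, ℂ) Λ).subtype.comp
        (autEquivStabilizer hΛ).toMonoidHom))
      (fun q : (Λᶜ : Set (ℙ ℂ (Fin 2 → ℂ))) => quadricMap (graphMap hfix q)) := by
  refine isEquivariantEmbedding_of_equivariant
    (isClosedEmbedding_quadricMap.comp (isClosedEmbedding_graphMap hδ hfix))
    fun φ (q : (Λᶜ : Set (ℙ ℂ (Fin 2 → ℂ)))) => ?_
  have h1 := autEquivStabilizer_apply hΛ φ q
  set h := autEquivStabilizer hΛ φ with hh
  have hne : h.1 • q.1 ≠ h.1 • δ q.1 := fun h0 =>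
    (graphMap hfix q).2 (MulAction.injective h.1 h0)
  have h2 : graphMap hfix (φ.1 q) = ⟨(h.1 • q.1, h.1 • δ q.1), hne⟩ := by
    refine Subtype.ext (Prod.ext h1 ?_)
    exact (congrArg δ h1).trans (hequiv h.1 h.2 q.1)
  exact (congrArg quadricMap h2).trans (quadricMap_smul h.1 q.1 (δ q.1) _ hne)

/-! ### The affine line and the punctured line -/

/-- The affine coordinate on the projective line with pole at `u` and zero at `v`. -/
noncomputable def affineCoord (u v : Fin 2 → ℂ) (q : ℙ ℂ (Fin 2 → ℂ)) : ℂ :=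
  planeDet q.rep v / planeDet u q.rep

theorem affineCoord_toProj (u v : Fin 2 → ℂ) {w : Fin 2 → ℂ} (hw : w ≠ 0) :
    affineCoord u v (toProj w) = planeDet w v / planeDet u w := by
  obtain ⟨c, hc⟩ := Projectivization.exists_smul_eq_mk_rep ℂ w hw
  rw [affineCoord, toProj_of_ne_zero hw, ← hc, Units.smul_def, planeDet_smul_left,
    planeDet_smul_right, mul_div_mul_left _ _ c.ne_zero]

theorem planeDet_smul_add {u v : Fin 2 → ℂ} (t : ℂ) :
    planeDet u (t • u + v) = planeDet u v := by
  rw [planeDet_add_right, planeDet_smul_right, planeDet_self, mul_zero, zero_add]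

theorem smul_add_ne_zero {u v : Fin 2 → ℂ} (h : planeDet u v ≠ 0)
    (t : ℂ) : t • u + v ≠ 0 :=
  ne_zero_right_of_planeDet (v := u) (by rwa [planeDet_smul_add])

theorem affineCoord_smul_add {u v : Fin 2 → ℂ} (h : planeDet u v ≠ 0)
    (t : ℂ) : affineCoord u v (toProj (t • u + v)) = t := by
  rw [affineCoord_toProj u v (smul_add_ne_zero h t), planeDet_smul_add, div_eq_iff h]
  simp [planeDet]; ring

theorem toProj_smul_add_ne {u v : Fin 2 → ℂ} (h : planeDet u v ≠ 0)
    (t : ℂ) : toProj (t • u + v) ≠ toProj u := by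
  rw [Ne, toProj_eq_toProj_iff (smul_add_ne_zero h t) (ne_zero_left_of_planeDet h),
    planeDet_comm, planeDet_smul_add, neg_eq_zero]
  exact h

theorem toProj_smul_add_eq_iff {u v : Fin 2 → ℂ} (h : planeDet u v ≠ 0)
    (t : ℂ) : toProj (t • u + v) = toProj v ↔ t = 0 := by
  have h0 : toProj v = toProj ((0 : ℂ) • u + v) := by rw [zero_smul, zero_add]
  rw [h0]
  exact (toProj_affine_injective h).eq_iff

theorem planeDet_rep_ne_zero {u v : Fin 2 → ℂ} (h : planeDet u v ≠ 0)
    {q : ℙ ℂ (Fin 2 → ℂ)} (hq : q ≠ toProj u) :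
    planeDet u q.rep ≠ 0 := by
  rw [← toProj_rep q, ne_comm,
    Ne, toProj_eq_toProj_iff (ne_zero_left_of_planeDet h) q.rep_nonzero] at hq
  exact hq

theorem toProj_affineCoord {u v : Fin 2 → ℂ} (h : planeDet u v ≠ 0)
    {q : ℙ ℂ (Fin 2 → ℂ)} (hq : q ≠ toProj u) :
    toProj (affineCoord u v q • u + v) = q := by
  have hq' := planeDet_rep_ne_zero h hq
  conv_rhs => rw [← toProj_rep q, eq_smul_add_smul h q.rep]
  rw [← toProj_smul (div_ne_zero hq' h), smul_add, smul_smul, affineCoord]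
  congr 3
  field_simp

theorem regAt_affineCoord {u v : Fin 2 → ℂ} (h : planeDet u v ≠ 0)
    {q : projLine.Pt} (hq : q ≠ toProj u) :
    projLine.RegAt (affineCoord u v) q := by
  obtain ⟨w, hw⟩ := ((isMorphism_id projLine).morphismAt q).exists_hasCoordsAt
  have hc := fun a => projLine.regAt_const a q
  have hD : projLine.RegAt (fun y => planeDet u (w y)) q :=
    regAt_sub (projLine.regAt_mul (hc _) (hw.1 1)) (projLine.regAt_mul (hc _) (hw.1 0))
  have hN : projLine.RegAt (fun y => planeDet (w y) v) q :=
    regAt_sub (projLine.regAt_mul (hw.1 0) (hc _)) (projLine.regAt_mul (hw.1 1) (hc _))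
  have hne : planeDet u (w q) ≠ 0 := by
    obtain ⟨h1, h2⟩ := hw.2.self_of_nhds
    rw [← toProj_of_ne_zero h1] at h2
    intro h0
    exact hq (h2.trans ((toProj_eq_toProj_iff h1 (ne_zero_left_of_planeDet h)).2
      (by rw [planeDet_comm, h0, neg_zero])))
  refine projLine.regAt_congr ?_ (regAt_div hN hD hne)
  filter_upwards [hw.2] with y ⟨h1, h2⟩
  rw [← affineCoord_toProj u v h1, toProj_of_ne_zero h1]
  exact congrArg (affineCoord u v) h2.symm

theorem morphismAt_toProj_smul_add {u v : Fin 2 → ℂ} (h : planeDet u v ≠ 0)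
    {X : FunSpace} {a : X.Pt → ℂ} {x : X.Pt} (ha : X.RegAt a x) :
    MorphismAt X projLine (fun y => toProj (a y • u + v)) x := by
  refine (hasCoordsAt_toProj (fun i => ?_) (smul_add_ne_zero h (a x))).morphismAt
  exact X.regAt_add (X.regAt_mul ha (X.regAt_const (u i) x)) (X.regAt_const (v i) x)

/-- The affine line is the complement of a point of the projective line. -/
noncomputable def affineLineEquiv {u v : Fin 2 → ℂ} (h : planeDet u v ≠ 0)
    : (affineSpace 1).Pt ≃ (projLineMinus {toProj u}).Pt where
  toFun := fun t : Fin 1 → ℂ => (⟨toProj (t 0 • u + v), toProj_smul_add_ne h (t 0)⟩ :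
    ({toProj u}ᶜ : Set (ℙ ℂ (Fin 2 → ℂ))))
  invFun := fun q : ({toProj u}ᶜ : Set (ℙ ℂ (Fin 2 → ℂ))) =>
    (![affineCoord u v q.1] : Fin 1 → ℂ)
  left_inv := fun t : Fin 1 → ℂ => by
    refine funext fun i => ?_
    fin_cases i
    exact affineCoord_smul_add h (t 0)
  right_inv := fun q : ({toProj u}ᶜ : Set (ℙ ℂ (Fin 2 → ℂ))) =>
    Subtype.ext (toProj_affineCoord h q.2)

theorem isIso_affineLineEquiv {u v : Fin 2 → ℂ} (h : planeDet u v ≠ 0)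
    :
    IsIso (affineSpace 1) (projLineMinus {toProj u}) (affineLineEquiv h) := by
  refine ⟨isMorphism_iff_morphismAt.2 fun x => morphismAt_restrict
    (morphismAt_toProj_smul_add h (affineSpace_regAt_coord 0 x)),
    isMorphism_iff_morphismAt.2 fun x => morphismAt_affineSpace fun i => ?_⟩
  fin_cases i
  exact (morphismAt_val projLine _ x).2 _ (regAt_affineCoord h x.2)

/-- The punctured line is the complement of two points of the projective line. -/
noncomputable def punctLineEquiv {u v : Fin 2 → ℂ} (h : planeDet u v ≠ 0)
    : punctLine.Pt ≃ (projLineMinus {toProj u, toProj v}).Pt where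
  toFun := fun t : {t : Fin 1 → ℂ | t 0 ≠ 0} => (⟨toProj (t.1 0 • u + v), by
    rintro (h1 | h1)
    · exact toProj_smul_add_ne h (t.1 0) h1
    · exact t.2 ((toProj_smul_add_eq_iff h (t.1 0)).1 h1)⟩ :
    ({toProj u, toProj v}ᶜ : Set (ℙ ℂ (Fin 2 → ℂ))))
  invFun := fun q : ({toProj u, toProj v}ᶜ : Set (ℙ ℂ (Fin 2 → ℂ))) =>
    (⟨![affineCoord u v q.1], fun h0 => q.2 (Or.inr (by
      rw [Set.mem_singleton_iff, ← toProj_affineCoord h fun h1 => q.2 (Or.inl h1)]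
      exact (toProj_smul_add_eq_iff h _).2 h0))⟩ : {t : Fin 1 → ℂ | t 0 ≠ 0})
  left_inv := fun t : {t : Fin 1 → ℂ | t 0 ≠ 0} => by
    refine Subtype.ext ?_
    ext i
    fin_cases i
    exact affineCoord_smul_add h (t.1 0)
  right_inv := fun q : ({toProj u, toProj v}ᶜ : Set (ℙ ℂ (Fin 2 → ℂ))) =>
    Subtype.ext (toProj_affineCoord h fun h1 => q.2 (Or.inl h1))

theorem regAt_punctLine_coord (x : punctLine.Pt) :
    punctLine.RegAt (fun t : {t : Fin 1 → ℂ | t 0 ≠ 0} => t.1 0) x :=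
  (morphismAt_val (affineSpace 1) _ x).2 _ (affineSpace_regAt_coord 0 x.1)

theorem isIso_punctLineEquiv {u v : Fin 2 → ℂ} (h : planeDet u v ≠ 0)
    :
    IsIso punctLine (projLineMinus {toProj u, toProj v}) (punctLineEquiv h) := by
  refine ⟨isMorphism_iff_morphismAt.2 fun x => morphismAt_restrict
    (morphismAt_toProj_smul_add h (regAt_punctLine_coord x)),
    isMorphism_iff_morphismAt.2 fun x => morphismAt_restrict
      (morphismAt_affineSpace fun i => ?_)⟩
  fin_cases i
  exact (morphismAt_val projLine _ x).2 _ (regAt_affineCoord h fun h1 => x.2 (Or.inl h1))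

/-- When the curve spans only a plane, equivariance does not determine a matrix. Requiring in
addition that a vector `e` be fixed restores uniqueness, and uniqueness makes the choice of matrices
multiplicative. -/
theorem isEquivariantEmbedding_exists_hom {X : FunSpace} {τ : X.Pt → Fin 3 → ℂ}
    (hτ : IsClosedEmbedding X (affineSpace 3) τ) {e : Fin 3 → ℂ}
    (hex : ∀ φ : X.Aut, ∃ M : Matrix (Fin 3) (Fin 3) ℂ, (∀ q, τ (φ.1 q) = M *ᵥ τ q) ∧ M *ᵥ e = e)
    (huniq : ∀ M N : Matrix (Fin 3) (Fin 3) ℂ, (∀ q, M *ᵥ τ q = N *ᵥ τ q) → M *ᵥ e = N *ᵥ e →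
      M = N) :
    ∃ ρ : X.Aut →* GL (Fin 3) ℂ, (∀ (φ : X.Aut) (M : Matrix (Fin 3) (Fin 3) ℂ),
      (∀ q, τ (φ.1 q) = M *ᵥ τ q) → M *ᵥ e = e → (ρ φ : Matrix (Fin 3) (Fin 3) ℂ) = M) ∧
      IsEquivariantEmbedding X ρ τ := by
  choose M hM hMe using hex
  let ρ : X.Aut →* Matrix (Fin 3) (Fin 3) ℂ :=
    { toFun := M
      map_one' := huniq _ _ (fun q => by rw [← hM, Matrix.one_mulVec]; rfl)
        (by rw [hMe, Matrix.one_mulVec])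
      map_mul' := fun φ ψ => huniq _ _
        (fun q => by rw [← hM, ← Matrix.mulVec_mulVec, ← hM ψ, ← hM φ]; rfl)
        (by rw [hMe, ← Matrix.mulVec_mulVec, hMe ψ, hMe φ]) }
  refine ⟨ρ.toHomUnits, fun φ N hN hNe => ?_, isEquivariantEmbedding_of_equivariant hτ hM⟩
  exact huniq _ _ (fun q => (hM φ q).symm.trans (hN q)) ((hMe φ).trans hNe.symm)

/-- Transported to ℙ¹ ∖ Λ, the automorphism is projective; a lift to GL₂ is read off in the
coordinate `c`. The cross-multiplied form avoids assuming that the denominator is nonzero. -/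
theorem exists_moebius_of_aut {X : FunSpace} {Λ : Set (ℙ ℂ (Fin 2 → ℂ))} (hΛ : Λ.Finite)
    {e : X.Pt ≃ (projLineMinus Λ).Pt} (he : IsIso X (projLineMinus Λ) e) {c : X.Pt → ℂ}
    (hc : ∀ x, (e x : (Λᶜ : Set (ℙ ℂ (Fin 2 → ℂ)))).1 = toProj (c x • ![1, 0] + ![0, 1]))
    (φ : X.Aut) :
    ∃ a b a' b' : ℂ, a * b' - b * a' ≠ 0 ∧
      ∀ x, c (φ.1 x) * (a' * c x + b') = a * c x + b := by
  obtain ⟨g, hg⟩ := Matrix.ProjGenLinGroup.mk_surjective (autEquivStabilizer hΛ (he.autCongr φ)).1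
  have hdet : g.1.det ≠ 0 := by
    rw [← Matrix.GeneralLinearGroup.val_det_apply]
    exact Units.ne_zero _
  have hbasis : planeDet ![1, 0] ![0, 1] ≠ 0 := by simp [planeDet]
  refine ⟨g.1 0 0, g.1 0 1, g.1 1 0, g.1 1 1, by rwa [Matrix.det_fin_two] at hdet, fun x => ?_⟩
  have h1 := autEquivStabilizer_apply hΛ (he.autCongr φ) (e x)
  rw [← hg] at h1
  have h2 : ((he.autCongr φ).1 (e x) : (Λᶜ : Set (ℙ ℂ (Fin 2 → ℂ)))).1 =
      toProj (c (φ.1 x) • ![1, 0] + ![0, 1]) := by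
    rw [he.autCongr_apply, e.symm_apply_apply]
    exact hc _
  have h3 : (e x : (Λᶜ : Set (ℙ ℂ (Fin 2 → ℂ)))).1 = toProj (c x • ![1, 0] + ![0, 1]) := hc x
  have h4 := h2.symm.trans h1
  rw [h3, mk_smul_toProj g (smul_add_ne_zero hbasis _)] at h4
  replace h4 := (toProj_eq_toProj_iff (smul_add_ne_zero hbasis _)
      (mulVec_ne_zero g (smul_add_ne_zero hbasis _))).1 h4
  simp [planeDet, Matrix.mulVec, dotProduct, Fin.sum_univ_two] at h4
  linear_combination h4

theorem affineLine_aut_eq (φ : (affineSpace 1).Aut) :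
    ∃ a b : ℂ, a ≠ 0 ∧ ∀ t : Fin 1 → ℂ, φ.1 t = ![a * t 0 + b] := by
  obtain ⟨a, b, a', b', hdet, hφ⟩ := exists_moebius_of_aut
    (Set.finite_singleton _) (isIso_affineLineEquiv (u := ![1, 0]) (v := ![0, 1])
      (by simp [planeDet])) (c := fun t : Fin 1 → ℂ => t 0) (fun _ => rfl) φ
  -- Otherwise the pole -b'/a' is a point of the affine line, where the numerator must vanish too,
  -- and the determinant would be zero.
  have ha' : a' = 0 := by
    by_contra h
    have h1 := hφ (![-b' / a'] : Fin 1 → ℂ)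
    simp only [Matrix.cons_val_zero] at h1
    refine hdet ?_
    have h2 : a' * (-b' / a') + b' = 0 := by field_simp; ring
    rw [h2, mul_zero] at h1
    field_simp at h1
    linear_combination h1
  rw [ha', mul_zero, sub_zero] at hdet
  have hb' := right_ne_zero_of_mul hdet
  refine ⟨a / b', b / b', div_ne_zero (left_ne_zero_of_mul hdet) hb', fun t => ?_⟩
  have h1 := hφ t
  rw [ha', zero_mul, zero_add] at h1
  refine funext fun i => ?_
  fin_cases i
  change (φ.1 t : Fin 1 → ℂ) 0 = a / b' * t 0 + b / b'
  field_simp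
  exact h1

theorem isMorphism_affineLine_affine (a b : ℂ) :
    IsMorphism (affineSpace 1) (affineSpace 1)
      (fun t : Fin 1 → ℂ => (![a * t 0 + b] : Fin 1 → ℂ)) := by
  refine isMorphism_iff_morphismAt.2 fun x => morphismAt_affineSpace fun i => ?_
  fin_cases i
  exact (affineSpace 1).regAt_add ((affineSpace 1).regAt_mul ((affineSpace 1).regAt_const a x)
    (affineSpace_regAt_coord 0 x)) ((affineSpace 1).regAt_const b x)

theorem affineLine_exists_aut (a b : ℂ) (ha : a ≠ 0) :
    ∃ φ : (affineSpace 1).Aut, ∀ t : Fin 1 → ℂ, φ.1 t = ![a * t 0 + b] := by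
  refine ⟨⟨⟨fun t : Fin 1 → ℂ => (![a * t 0 + b] : Fin 1 → ℂ),
    fun t : Fin 1 → ℂ => (![a⁻¹ * t 0 + -(a⁻¹ * b)] : Fin 1 → ℂ), ?_, ?_⟩,
    isMorphism_affineLine_affine _ _, isMorphism_affineLine_affine _ _⟩, fun _ => rfl⟩
  · intro t
    refine funext fun i => ?_
    fin_cases i
    change a⁻¹ * (a * (t : Fin 1 → ℂ) 0 + b) + -(a⁻¹ * b) = (t : Fin 1 → ℂ) 0
    field_simp
    ring
  · intro t
    refine funext fun i => ?_
    fin_cases i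
    change a * (a⁻¹ * (t : Fin 1 → ℂ) 0 + -(a⁻¹ * b)) + b = (t : Fin 1 → ℂ) 0
    field_simp
    ring

theorem isClosedEmbedding_affineLine :
    IsClosedEmbedding (affineSpace 1) (affineSpace 3)
      (fun t : Fin 1 → ℂ => (![t 0, 1, 0] : Fin 3 → ℂ)) := by
  refine isClosedEmbedding_of_retraction_self ?_ ?_ fun x =>
    ⟨fun v : Fin 3 → ℂ => (![v 0] : Fin 1 → ℂ), ?_, ?_⟩
  · refine isMorphism_iff_morphismAt.2 fun x => morphismAt_affineSpace fun i => ?_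
    fin_cases i
    exacts [affineSpace_regAt_coord 0 x, (affineSpace 1).regAt_const 1 x,
      (affineSpace 1).regAt_const 0 x]
  · convert (isClosed_affineSpace_zeros (n := 3) (MvPolynomial.X 1 - 1)).inter
      (isClosed_affineSpace_zeros (n := 3) (MvPolynomial.X 2)) using 1
    refine Set.ext fun v : Fin 3 → ℂ => ?_
    change _ ↔ MvPolynomial.eval v _ = 0 ∧ MvPolynomial.eval v _ = 0
    simp only [map_sub, MvPolynomial.eval_X, map_one, sub_eq_zero]
    constructor
    · rintro ⟨t, rfl⟩
      exact ⟨rfl, rfl⟩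
    · rintro ⟨h1, h2⟩
      refine ⟨(![v 0] : Fin 1 → ℂ), funext fun i => ?_⟩
      fin_cases i
      exacts [rfl, h1.symm, h2.symm]
  · refine morphismAt_affineSpace fun i => ?_
    fin_cases i
    exact affineSpace_regAt_coord 0 _
  · refine Filter.Eventually.of_forall ?_
    rintro _ t rfl
    refine funext fun i => ?_
    fin_cases i
    rfl

theorem exists_affineLine_action :
    ∃ ρ : (affineSpace 1).Aut →* GL (Fin 3) ℂ,
      (∀ (φ : (affineSpace 1).Aut) (a b : ℂ), (∀ t : Fin 1 → ℂ, φ.1 t = ![a * t 0 + b]) →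
        (ρ φ : Matrix (Fin 3) (Fin 3) ℂ) = !![a, b, 0; 0, 1, 0; 0, 0, 1]) ∧
      IsEquivariantEmbedding (affineSpace 1) ρ (fun t : Fin 1 → ℂ => ![t 0, 1, 0]) := by
  have hM : ∀ (φ : (affineSpace 1).Aut) (a b : ℂ), (∀ t : Fin 1 → ℂ, φ.1 t = ![a * t 0 + b]) →
      ∀ t : Fin 1 → ℂ, (![(φ.1 t : Fin 1 → ℂ) 0, 1, 0] : Fin 3 → ℂ) =
        !![a, b, 0; 0, 1, 0; 0, 0, 1] *ᵥ ![t 0, 1, 0] := by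
    intro φ a b hφ t
    have h0 : (φ.1 t : Fin 1 → ℂ) 0 = a * t 0 + b := congrFun (hφ t) 0
    rw [h0]
    ext i
    fin_cases i <;> simp [Matrix.mulVec, dotProduct, Fin.sum_univ_three]
  have hMe : ∀ a b : ℂ, !![a, b, 0; 0, 1, 0; 0, 0, 1] *ᵥ ![0, 0, 1] = (![0, 0, 1] : Fin 3 → ℂ) := by
    intro a b
    ext i
    fin_cases i <;> simp [Matrix.mulVec, dotProduct, Fin.sum_univ_three]
  obtain ⟨ρ, hρ, hemb⟩ := isEquivariantEmbedding_exists_hom isClosedEmbedding_affineLine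
    (e := ![0, 0, 1]) (fun φ => by
      obtain ⟨a, b, -, hφ⟩ := affineLine_aut_eq φ
      exact ⟨_, hM φ a b hφ, hMe a b⟩) (fun M N h h' => by
      -- The points (0, 1, 0) and (1, 1, 0) of the curve form with `e` a basis of ℂ³.
      have h0 := h (![0] : Fin 1 → ℂ)
      have h1 := h (![1] : Fin 1 → ℂ)
      ext i j
      have e0 := congrFun h0 i
      have e1 := congrFun h1 i
      have e2 := congrFun h' i
      simp [Matrix.mulVec, dotProduct, Fin.sum_univ_three] at e0 e1 e2
      fin_cases j
      · simpa [e0] using e1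
      · exact e0
      · exact e2)
  exact ⟨ρ, fun φ a b hφ => hρ φ _ (hM φ a b hφ) (hMe a b), hemb⟩

theorem punctLine_aut_eq (φ : punctLine.Aut) : ∃ l : ℂ, l ≠ 0 ∧
    ((∀ t : {t : Fin 1 → ℂ | t 0 ≠ 0}, (φ.1 t).1 = ![l * t.1 0]) ∨
      ∀ t : {t : Fin 1 → ℂ | t 0 ≠ 0}, (φ.1 t).1 = ![l * (t.1 0)⁻¹]) := by
  obtain ⟨a, b, a', b', hdet, hφ⟩ := exists_moebius_of_aut
    (Set.toFinite _) (isIso_punctLineEquiv (u := ![1, 0]) (v := ![0, 1])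
      (by simp [planeDet])) (c := fun t : {t : Fin 1 → ℂ | t 0 ≠ 0} => t.1 0) (fun _ => rfl) φ
  have hval : ∀ s : ℂ, s ≠ 0 → ∃ r : ℂ, r ≠ 0 ∧ r * (a' * s + b') = a * s + b := by
    intro s hs
    let t : {t : Fin 1 → ℂ | t 0 ≠ 0} := ⟨![s], hs⟩
    exact ⟨(φ.1 t).1 0, (φ.1 t).2, hφ t⟩
  -- The pole of the transformation cannot lie in ℂ*, so it is ∞ or 0.
  have h1 : a' = 0 ∨ b' = 0 := by
    by_contra! h
    obtain ⟨r, -, hr⟩ := hval (-b' / a') (div_ne_zero (neg_ne_zero.2 h.2) h.1)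
    refine hdet ?_
    have ha' := h.1
    have h2 : a' * (-b' / a') + b' = 0 := by field_simp; ring
    rw [h2, mul_zero] at hr
    field_simp at hr
    linear_combination hr
  -- Likewise the zero cannot lie in ℂ*, because the values of `φ` are nonzero.
  have h2 : a = 0 ∨ b = 0 := by
    by_contra! h
    obtain ⟨r, hr0, hr⟩ := hval (-b / a) (div_ne_zero (neg_ne_zero.2 h.2) h.1)
    refine hdet ?_
    have ha := h.1
    have h2 : a * (-b / a) + b = 0 := by field_simp; ring
    rw [h2] at hr
    have h3 := (mul_eq_zero.1 hr).resolve_left hr0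
    field_simp at h3
    linear_combination h3
  rcases h1 with h1 | h1
  · have hb : b = 0 := h2.resolve_left fun h2 => hdet (by rw [h1, h2]; ring)
    rw [h1, mul_zero, sub_zero] at hdet
    have hb' := right_ne_zero_of_mul hdet
    refine ⟨a / b', div_ne_zero (left_ne_zero_of_mul hdet) hb', Or.inl fun t => ?_⟩
    have h3 : (φ.1 t).1 0 * (a' * t.1 0 + b') = a * t.1 0 + b := hφ t
    rw [h1, hb, zero_mul, zero_add, add_zero] at h3
    refine funext fun i => ?_
    fin_cases i
    change (φ.1 t).1 0 = a / b' * t.1 0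
    field_simp
    exact h3
  · have ha : a = 0 := h2.resolve_right fun h2 => hdet (by rw [h1, h2]; ring)
    rw [h1, mul_zero, zero_sub, neg_ne_zero] at hdet
    have ha' := right_ne_zero_of_mul hdet
    refine ⟨b / a', div_ne_zero (left_ne_zero_of_mul hdet) ha', Or.inr fun t => ?_⟩
    have h3 : (φ.1 t).1 0 * (a' * t.1 0 + b') = a * t.1 0 + b := hφ t
    rw [h1, ha, zero_mul, zero_add, add_zero] at h3
    have ht : t.1 0 ≠ 0 := t.2
    refine funext fun i => ?_
    fin_cases i
    change (φ.1 t).1 0 = b / a' * (t.1 0)⁻¹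
    field_simp
    linear_combination h3

theorem isMorphism_punctLine_mul {l : ℂ} (hl : l ≠ 0) :
    IsMorphism punctLine punctLine (fun t : {t : Fin 1 → ℂ | t 0 ≠ 0} =>
      (⟨![l * t.1 0], mul_ne_zero hl t.2⟩ : {t : Fin 1 → ℂ | t 0 ≠ 0})) := by
  refine isMorphism_iff_morphismAt.2 fun x => morphismAt_restrict
    (morphismAt_affineSpace fun i => ?_)
  fin_cases i
  exact punctLine.regAt_mul (punctLine.regAt_const l x) (regAt_punctLine_coord x)

theorem isMorphism_punctLine_inv {l : ℂ} (hl : l ≠ 0) :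
    IsMorphism punctLine punctLine (fun t : {t : Fin 1 → ℂ | t 0 ≠ 0} =>
      (⟨![l * (t.1 0)⁻¹], mul_ne_zero hl (inv_ne_zero t.2)⟩ : {t : Fin 1 → ℂ | t 0 ≠ 0})) := by
  refine isMorphism_iff_morphismAt.2 fun x => morphismAt_restrict
    (morphismAt_affineSpace fun i => ?_)
  fin_cases i
  exact punctLine.regAt_mul (punctLine.regAt_const l x)
    (punctLine.regAt_inv (regAt_punctLine_coord x) x.2)

theorem punctLine_exists_aut_mul {l : ℂ} (hl : l ≠ 0) :
    ∃ φ : punctLine.Aut, ∀ t : {t : Fin 1 → ℂ | t 0 ≠ 0}, (φ.1 t).1 = ![l * t.1 0] := by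
  refine ⟨⟨⟨_, _, ?_, ?_⟩, isMorphism_punctLine_mul hl,
    isMorphism_punctLine_mul (inv_ne_zero hl)⟩, fun _ => rfl⟩
  · refine fun t : {t : Fin 1 → ℂ | t 0 ≠ 0} => Subtype.ext (funext fun i => ?_)
    fin_cases i
    exact inv_mul_cancel_left₀ hl _
  · refine fun t : {t : Fin 1 → ℂ | t 0 ≠ 0} => Subtype.ext (funext fun i => ?_)
    fin_cases i
    exact mul_inv_cancel_left₀ hl _

theorem punctLine_exists_aut_inv {l : ℂ} (hl : l ≠ 0) :
    ∃ φ : punctLine.Aut, ∀ t : {t : Fin 1 → ℂ | t 0 ≠ 0}, (φ.1 t).1 = ![l * (t.1 0)⁻¹] := by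
  have hinv : ∀ s : ℂ, l * (l * s⁻¹)⁻¹ = s := fun s => by
    rw [mul_inv, inv_inv, mul_inv_cancel_left₀ hl]
  refine ⟨⟨⟨_, _, ?_, ?_⟩, isMorphism_punctLine_inv hl, isMorphism_punctLine_inv hl⟩, fun _ => rfl⟩
  · refine fun t : {t : Fin 1 → ℂ | t 0 ≠ 0} => Subtype.ext (funext fun i => ?_)
    fin_cases i
    exact hinv _
  · refine fun t : {t : Fin 1 → ℂ | t 0 ≠ 0} => Subtype.ext (funext fun i => ?_)
    fin_cases i
    exact hinv _

theorem isClosedEmbedding_punctLine :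
    IsClosedEmbedding punctLine (affineSpace 3)
      (fun t : {t : Fin 1 → ℂ | t 0 ≠ 0} => (![t.1 0, (t.1 0)⁻¹, 0] : Fin 3 → ℂ)) := by
  refine isClosedEmbedding_of_retraction_restrict (X := affineSpace 1) ?_ ?_ fun x =>
    ⟨fun v : Fin 3 → ℂ => (![v 0] : Fin 1 → ℂ), ?_, ?_⟩
  · refine isMorphism_iff_morphismAt.2 fun x => morphismAt_affineSpace fun i => ?_
    fin_cases i
    exacts [regAt_punctLine_coord x, punctLine.regAt_inv (regAt_punctLine_coord x) x.2,
      punctLine.regAt_const 0 x]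
  · convert (isClosed_affineSpace_zeros (n := 3) (MvPolynomial.X 0 * MvPolynomial.X 1 - 1)).inter
      (isClosed_affineSpace_zeros (n := 3) (MvPolynomial.X 2)) using 1
    refine Set.ext fun v : Fin 3 → ℂ => ?_
    change _ ↔ MvPolynomial.eval v _ = 0 ∧ MvPolynomial.eval v _ = 0
    simp only [map_sub, map_mul, MvPolynomial.eval_X, map_one, sub_eq_zero]
    constructor
    · rintro ⟨t, rfl⟩
      exact ⟨mul_inv_cancel₀ t.2, rfl⟩
    · rintro ⟨h1, h2⟩
      refine ⟨⟨(![v 0] : Fin 1 → ℂ), left_ne_zero_of_mul_eq_one h1⟩, funext fun i => ?_⟩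
      fin_cases i
      exacts [rfl, (eq_inv_of_mul_eq_one_right h1).symm, h2.symm]
  · refine morphismAt_affineSpace fun i => ?_
    fin_cases i
    exact affineSpace_regAt_coord 0 _
  · refine Filter.Eventually.of_forall ?_
    rintro _ t rfl
    refine funext fun i => ?_
    fin_cases i
    rfl

theorem exists_punctLine_action :
    ∃ ρ : punctLine.Aut →* GL (Fin 3) ℂ,
      (∀ (φ : punctLine.Aut) (l : ℂ),
        (∀ t : {t : Fin 1 → ℂ | t 0 ≠ 0}, (φ.1 t).1 = ![l * t.1 0]) →
        (ρ φ : Matrix (Fin 3) (Fin 3) ℂ) = !![l, 0, 0; 0, l⁻¹, 0; 0, 0, 1]) ∧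
      (∀ (φ : punctLine.Aut) (l : ℂ),
        (∀ t : {t : Fin 1 → ℂ | t 0 ≠ 0}, (φ.1 t).1 = ![l * (t.1 0)⁻¹]) →
        (ρ φ : Matrix (Fin 3) (Fin 3) ℂ) = !![0, l, 0; l⁻¹, 0, 0; 0, 0, 1]) ∧
      IsEquivariantEmbedding punctLine ρ
        (fun t : {t : Fin 1 → ℂ | t 0 ≠ 0} => ![t.1 0, (t.1 0)⁻¹, 0]) := by
  have hM : ∀ (φ : punctLine.Aut) (l : ℂ),
      (∀ t : {t : Fin 1 → ℂ | t 0 ≠ 0}, (φ.1 t).1 = ![l * t.1 0]) →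
      ∀ t : {t : Fin 1 → ℂ | t 0 ≠ 0},
        (![(φ.1 t).1 0, ((φ.1 t).1 0)⁻¹, 0] : Fin 3 → ℂ) =
          !![l, 0, 0; 0, l⁻¹, 0; 0, 0, 1] *ᵥ ![t.1 0, (t.1 0)⁻¹, 0] := by
    intro φ l hφ t
    rw [hφ t]
    ext i
    fin_cases i <;> simp [Matrix.mulVec, dotProduct, Fin.sum_univ_three, mul_comm]
  have hM' : ∀ (φ : punctLine.Aut) (l : ℂ),
      (∀ t : {t : Fin 1 → ℂ | t 0 ≠ 0}, (φ.1 t).1 = ![l * (t.1 0)⁻¹]) →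
      ∀ t : {t : Fin 1 → ℂ | t 0 ≠ 0},
        (![(φ.1 t).1 0, ((φ.1 t).1 0)⁻¹, 0] : Fin 3 → ℂ) =
          !![0, l, 0; l⁻¹, 0, 0; 0, 0, 1] *ᵥ ![t.1 0, (t.1 0)⁻¹, 0] := by
    intro φ l hφ t
    rw [hφ t]
    ext i
    fin_cases i <;> simp [Matrix.mulVec, dotProduct, Fin.sum_univ_three, mul_comm]
  have hMe : ∀ a b c d : ℂ,
      !![a, b, 0; c, d, 0; 0, 0, 1] *ᵥ ![0, 0, 1] = (![0, 0, 1] : Fin 3 → ℂ) := by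
    intro a b c d
    ext i
    fin_cases i <;> simp [Matrix.mulVec, dotProduct, Fin.sum_univ_three]
  obtain ⟨ρ, hρ, hemb⟩ := isEquivariantEmbedding_exists_hom isClosedEmbedding_punctLine
    (e := ![0, 0, 1]) (fun φ => by
      obtain ⟨l, -, hφ | hφ⟩ := punctLine_aut_eq φ
      · exact ⟨_, hM φ l hφ, hMe _ _ _ _⟩
      · exact ⟨_, hM' φ l hφ, hMe _ _ _ _⟩) (fun M N h h' => by
      -- The points (1, 1, 0) and (2, 1/2, 0) of the curve form with `e` a basis of ℂ³; the
      -- coefficients below solve this linear system.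
      have h0 := h (⟨![1], one_ne_zero⟩ : {t : Fin 1 → ℂ | t 0 ≠ 0})
      have h1 := h (⟨![2], two_ne_zero⟩ : {t : Fin 1 → ℂ | t 0 ≠ 0})
      ext i j
      have e0 := congrFun h0 i
      have e1 := congrFun h1 i
      have e2 := congrFun h' i
      simp [Matrix.mulVec, dotProduct, Fin.sum_univ_three] at e0 e1 e2
      fin_cases j
      · change M i 0 = N i 0
        linear_combination (2 / 3) * e1 - (1 / 3) * e0
      · change M i 1 = N i 1
        linear_combination (4 / 3) * e0 - (2 / 3) * e1
      · exact e2)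
  exact ⟨ρ, fun φ l hφ => hρ φ _ (hM φ l hφ) (hMe _ _ _ _),
    fun φ l hφ => hρ φ _ (hM' φ l hφ) (hMe _ _ _ _), hemb⟩

/-! ### Rational smooth affine curves are complements of finite sets -/

/-- Regular functions on a closed subvariety of an affine space are polynomials. -/
theorem exists_polynomial_of_regular {X : FunSpace} {n : ℕ} {j : X.Pt → Fin n → ℂ}
    (hj : IsClosedEmbedding X (affineSpace n) j) {f : X.Pt → ℂ} (hf : ∀ x, X.RegAt f x) :
    ∃ P : MvPolynomial (Fin n) ℂ, ∀ x, f x = MvPolynomial.eval (j x) P := by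
  -- `J` is the ideal of denominators of `f`. By the Nullstellensatz it is the unit ideal as soon as
  -- its elements have no common zero `y`.
  let J : Ideal (MvPolynomial (Fin n) ℂ) :=
    { carrier := {h | ∃ N, ∀ x, MvPolynomial.eval (j x) h * f x = MvPolynomial.eval (j x) N}
      zero_mem' := ⟨0, by simp⟩
      add_mem' := by
        rintro a b ⟨N, hN⟩ ⟨N', hN'⟩
        exact ⟨N + N', fun x => by simp [add_mul, hN, hN']⟩
      smul_mem' := by
        rintro c a ⟨N, hN⟩
        exact ⟨c * N, fun x => by simp [mul_assoc, hN]⟩ }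
  suffices hJ : J = ⊤ by
    obtain ⟨N, hN⟩ : (1 : MvPolynomial (Fin n) ℂ) ∈ J := hJ ▸ Submodule.mem_top
    exact ⟨N, fun x => by simpa using hN x⟩
  by_contra hJ
  obtain ⟨M, hM, hJM⟩ := Ideal.exists_le_maximal J hJ
  obtain ⟨y, rfl⟩ := MvPolynomial.isMaximal_iff_eq_vanishingIdeal_singleton.1 hM
  have hy : ∀ h ∈ J, MvPolynomial.eval y h = 0 := fun h hh => by
    have := hJM hh
    rwa [MvPolynomial.mem_vanishingIdeal_singleton_iff] at this
  by_cases hr : y ∈ Set.range j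
  · obtain ⟨a, rfl⟩ := hr
    obtain ⟨h, ⟨_, N, D, -, -, hD, hh⟩, hfh⟩ := hj.3 a f (hf a)
    have hev : ∀ᶠ x in 𝓝 a, f x = MvPolynomial.eval (j x) N / MvPolynomial.eval (j x) D := by
      filter_upwards [hfh, hj.1.1.continuousAt.eventually hh] with x h1 h2
      rw [h1]
      exact h2
    rw [hj.2.isInducing.nhds_eq_comap] at hev
    replace hev := Filter.eventually_comap.1 hev
    obtain ⟨E, hE, hEU⟩ := affineSpace_exists_basicOpen hev
    -- Where E and D are nonzero one has f = N/D. The factor E removes the points outside this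
    -- neighbourhood, and the second D those where D vanishes.
    have hmem : E * D * D ∈ J := by
      refine ⟨E * D * N, fun x => ?_⟩
      by_cases h1 : MvPolynomial.eval (j x) E = 0
      · simp [h1]
      by_cases h2 : MvPolynomial.eval (j x) D = 0
      · simp [h2]
      rw [hEU (j x) h1 x rfl]
      simp only [map_mul]
      field_simp
    have := hy _ hmem
    simp only [map_mul, mul_eq_zero] at this
    exact this.elim (fun h => h.elim hE hD) hD
  -- Off the closed image some E with E(y) ≠ 0 vanishes on the image, and lies in `J` with numerator
  -- 0.
  · have hopen : (Set.range j)ᶜ ∈ @nhds (affineSpace n).Pt _ y :=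
      hj.2.isClosed_range.isOpen_compl.mem_nhds hr
    obtain ⟨E, hE, hEU⟩ := affineSpace_exists_basicOpen hopen
    refine hE (hy E ⟨0, fun x => ?_⟩)
    have : MvPolynomial.eval (j x) E = 0 := by
      by_contra h
      exact hEU (j x) h ⟨x, rfl⟩
    rw [this, zero_mul, map_zero]

theorem regAt_coord_of_isClosedEmbedding {X : FunSpace} {n : ℕ} {j : X.Pt → Fin n → ℂ}
    (hj : IsClosedEmbedding X (affineSpace n) j) (i : Fin n) (x : X.Pt) :
    X.RegAt (fun x => j x i) x :=
  hj.1.2 x (fun y : Fin n → ℂ => y i) (affineSpace_regAt_coord i _)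

/-- Evaluation of regular functions at a point. -/
def evalFunctions (X : FunSpace) (p : X.Pt) : X.functions →ₐ[ℂ] ℂ :=
  (Pi.evalAlgHom ℂ (fun _ : X.Pt => ℂ) p).comp X.functions.val

theorem isNoetherianRing_functions {X : FunSpace} {n : ℕ} {j : X.Pt → Fin n → ℂ}
    (hj : IsClosedEmbedding X (affineSpace n) j) : IsNoetherianRing X.functions := by
  let c : Fin n → X.functions := fun i =>
    ⟨fun x => j x i, regAt_coord_of_isClosedEmbedding hj i⟩
  refine isNoetherianRing_of_surjective (MvPolynomial (Fin n) ℂ) _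
    (MvPolynomial.aeval (R := ℂ) c).toRingHom fun f => ?_
  obtain ⟨P, hP⟩ := exists_polynomial_of_regular hj f.2
  refine ⟨P, Subtype.ext (funext fun x => ?_)⟩
  rw [hP]
  have h1 : evalFunctions X x (MvPolynomial.aeval c P) =
      MvPolynomial.aeval (fun i => evalFunctions X x (c i)) P := by
    rw [MvPolynomial.aeval_def, MvPolynomial.aeval_def, ← AlgHom.coe_toRingHom,
      MvPolynomial.hom_eval₂]
    congr 1
  exact h1

/-- In a Noetherian domain, at a maximal ideal that is principal modulo its square, any fraction or
its inverse is defined. -/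
theorem exists_fraction_of_le_span_sup_sq {R : Type*} [CommRing R] [IsDomain R]
    [IsNoetherianRing R] (m : Ideal R) [m.IsPrime] (u : R) (hu : m ≤ Ideal.span {u} ⊔ m ^ 2)
    (hum : u ∈ m) (a b : R) : ∃ s ∉ m, ∃ c, s * a = c * b ∨ s * b = c * a := by
  let L := Localization.AtPrime m
  have hmax : Ideal.map (algebraMap R L) m = IsLocalRing.maximalIdeal L :=
    Localization.AtPrime.map_eq_maximalIdeal
  have : IsDomain L := IsLocalization.isDomain_localization m.primeCompl_le_nonZeroDivisors
  have : IsNoetherianRing L := IsLocalization.isNoetherianRing m.primeCompl L inferInstance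
  -- Nakayama's lemma: a generator modulo the square of the maximal ideal is a generator.
  have hle : IsLocalRing.maximalIdeal L ≤ Ideal.span {algebraMap R L u} := by
    refine Submodule.le_of_le_smul_of_le_jacobson_bot (I := IsLocalRing.maximalIdeal L)
      (IsNoetherian.noetherian _) (IsLocalRing.maximalIdeal_le_jacobson _) ?_
    have h1 := Ideal.map_mono (f := algebraMap R L) hu
    rw [Ideal.map_sup, Ideal.map_pow, Ideal.map_span, Set.image_singleton, hmax, pow_two] at h1
    exact h1
  have hprin : (IsLocalRing.maximalIdeal L).IsPrincipal := by
    refine ⟨⟨algebraMap R L u, le_antisymm hle ?_⟩⟩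
    rw [← hmax]
    exact (Ideal.span_singleton_le_iff_mem _).2 (Ideal.mem_map_of_mem _ hum)
  -- A Noetherian local domain with principal maximal ideal is a valuation ring, so of `a` and `b`
  -- one divides the other in `L`.
  have hval : ValuationRing L :=
    ((tfae_of_isNoetherianRing_of_isLocalRing_of_isDomain L).out 4 1).1 hprin
  have key : ∀ a b : R, algebraMap R L b ∣ algebraMap R L a → ∃ s ∉ m, ∃ c, s * a = c * b := by
    rintro a b ⟨z, hz⟩
    obtain ⟨⟨c, s⟩, hcs⟩ := IsLocalization.surj m.primeCompl z
    refine ⟨s, s.2, c, IsLocalization.injective L m.primeCompl_le_nonZeroDivisors ?_⟩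
    rw [map_mul, map_mul, hz, ← hcs]
    ring
  rcases ValuationRing.dvd_total (algebraMap R L a) (algebraMap R L b) with h | h
  · obtain ⟨s, hs, c, hc⟩ := key b a h
    exact ⟨s, hs, c, Or.inr hc⟩
  · obtain ⟨s, hs, c, hc⟩ := key a b h
    exact ⟨s, hs, c, Or.inl hc⟩

theorem exists_le_span_sup_sq {k R : Type*} [Field k] [CommRing R] [Algebra k R] {I : Ideal R}
    (h : Module.finrank k I.Cotangent = 1) : ∃ u ∈ I, I ≤ Ideal.span {u} ⊔ I ^ 2 := by
  obtain ⟨v, -, hv⟩ := finrank_eq_one_iff'.1 h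
  obtain ⟨u, rfl⟩ := I.toCotangent_surjective v
  refine ⟨u.1, u.2, fun x hx => ?_⟩
  obtain ⟨c, hc⟩ := hv (I.toCotangent ⟨x, hx⟩)
  have h1 : I.toCotangent (algebraMap k R c • u) = I.toCotangent ⟨x, hx⟩ := by
    rw [map_smul, ← hc, algebraMap_smul]
  rw [Ideal.toCotangent_eq] at h1
  have h2 : x = algebraMap k R c * u.1 + -((algebraMap k R c • u : I).1 - x) := by
    simp [Algebra.smul_def]
  rw [h2]
  exact Ideal.add_mem _
    (Ideal.mem_sup_left (Ideal.mul_mem_left _ _ (Ideal.mem_span_singleton_self _)))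
    (Ideal.mem_sup_right (neg_mem_iff.2 h1))

open Polynomial in
-- Used with x = t and w = ψ g, so that the pair is (ψ f, ψ g) and no division by `g` is needed.
theorem aeval_homogenize_mul {A : Type*} [CommRing A] [Algebra ℂ A] {p : ℂ[X]} {n : ℕ}
    (hn : p.natDegree ≤ n) (x w : A) :
    MvPolynomial.aeval ![x * w, w] (p.homogenize n) = w ^ n * aeval x p := by
  refine Polynomial.induction_with_natDegree_le
    (fun p => MvPolynomial.aeval ![x * w, w] (p.homogenize n) = w ^ n * aeval x p) n ?_ ?_ ?_ p hn
  · simp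
  · intro k c _ hk
    simp only [homogenize_C_mul, homogenize_X_pow hk, map_mul, map_pow, MvPolynomial.aeval_X,
      aeval_C, aeval_X, MvPolynomial.algHom_C, Matrix.cons_val_zero, Matrix.cons_val_one]
    rw [← pow_mul_pow_sub w hk]
    ring
  · intro f g _ _ hf hg
    rw [homogenize_add, map_add, hf, hg, map_add, mul_add]

open Polynomial in
theorem eval_homogenize_of_snd_eq_zero {p : ℂ[X]} {n : ℕ} (hn : p.natDegree ≤ n)
    {v : Fin 2 → ℂ} (hv : v 1 = 0) :
    MvPolynomial.eval v (p.homogenize n) = p.coeff n * v 0 ^ n := by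
  refine Polynomial.induction_with_natDegree_le
    (fun p => MvPolynomial.eval v (p.homogenize n) = p.coeff n * v 0 ^ n) n ?_ ?_ ?_ p hn
  · simp
  · intro k c _ hk
    rcases hk.eq_or_lt with rfl | hk'
    · simp
    · have h1 : n - k ≠ 0 := Nat.sub_ne_zero_of_lt hk'
      simp [homogenize_X_pow hk, hv, h1, coeff_X_pow, hk'.ne']
  · intro f g _ _ hf hg
    rw [homogenize_add, map_add, hf, hg, coeff_add, add_mul]

open Polynomial in
-- At finite points a Bézout relation excludes common zeros. At infinity only the coefficients of
-- degree max(deg N, deg D) matter, and one of them is a leading coefficient.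
theorem eval_homogenize_ne_zero_of_isCoprime {N D : ℂ[X]} (h : IsCoprime N D) {v : Fin 2 → ℂ}
    (hv : v ≠ 0)
    (hN : MvPolynomial.eval v (N.homogenize (max N.natDegree D.natDegree)) = 0) :
    MvPolynomial.eval v (D.homogenize (max N.natDegree D.natDegree)) ≠ 0 := by
  intro hD
  by_cases h1 : v 1 = 0
  · have h0 : v 0 ≠ 0 := fun h0 => hv (by ext i; fin_cases i <;> assumption)
    rw [eval_homogenize_of_snd_eq_zero (le_max_left _ _) h1] at hN
    rw [eval_homogenize_of_snd_eq_zero (le_max_right _ _) h1] at hD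
    have hN' := (mul_eq_zero.1 hN).resolve_right (pow_ne_zero _ h0)
    have hD' := (mul_eq_zero.1 hD).resolve_right (pow_ne_zero _ h0)
    rcases le_total N.natDegree D.natDegree with hle | hle
    · rw [max_eq_right hle] at hD' hN'
      have hD0 : D = 0 := leadingCoeff_eq_zero.1 hD'
      rw [hD0, natDegree_zero, Nat.le_zero] at hle
      rw [hD0, natDegree_zero, ← hle] at hN'
      have hN0 : N = 0 := leadingCoeff_eq_zero.1 hN'
      rw [hN0, hD0] at h
      exact not_isCoprime_zero_zero h
    · rw [max_eq_left hle] at hD' hN'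
      have hN0 : N = 0 := leadingCoeff_eq_zero.1 hN'
      rw [hN0, natDegree_zero, Nat.le_zero] at hle
      rw [hN0, natDegree_zero, ← hle] at hD'
      have hD0 : D = 0 := leadingCoeff_eq_zero.1 hD'
      rw [hN0, hD0] at h
      exact not_isCoprime_zero_zero h
  · rw [eval_homogenize (le_max_left _ _) v h1] at hN
    rw [eval_homogenize (le_max_right _ _) v h1] at hD
    have hN' := (mul_eq_zero.1 hN).resolve_right (pow_ne_zero _ h1)
    have hD' := (mul_eq_zero.1 hD).resolve_right (pow_ne_zero _ h1)
    obtain ⟨a, b, hab⟩ := h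
    have := congrArg (eval (v 0 / v 1)) hab
    simp [hN', hD'] at this

open Polynomial in
-- Either `D` has full degree and a root, or its degree drops and the homogenization vanishes at
-- infinity.
theorem exists_zero_homogenize {D : ℂ[X]} {m : ℕ} (hD : D.natDegree ≤ m) (hm : m ≠ 0) :
    ∃ v : Fin 2 → ℂ, v ≠ 0 ∧ MvPolynomial.eval v (D.homogenize m) = 0 := by
  rcases hD.eq_or_lt with rfl | hlt
  · obtain ⟨t, ht⟩ := IsAlgClosed.exists_root D (fun h0 => hm (natDegree_eq_of_degree_eq_some h0))
    refine ⟨![t, 1], vec_ne_zero_of_snd one_ne_zero, ?_⟩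
    rw [eval_homogenize le_rfl _ (by simp)]
    simpa using ht
  · refine ⟨![1, 0], vec_ne_zero_of_fst one_ne_zero, ?_⟩
    rw [eval_homogenize_of_snd_eq_zero hD rfl, coeff_eq_zero_of_natDegree_lt hlt, zero_mul]

theorem exists_algHom_ratFunc {A : Type*} [CommRing A] [Algebra ℂ A]
    (e : FractionRing A ≃ₐ[ℂ] RatFunc ℂ) :
    ∃ ψ : A →ₐ[ℂ] RatFunc ℂ, Function.Injective ψ ∧
      ∃ f g : A, ψ g ≠ 0 ∧ ψ f = RatFunc.X * ψ g := by
  let ψ : A →ₐ[ℂ] RatFunc ℂ := e.toAlgHom.comp (IsScalarTower.toAlgHom ℂ A (FractionRing A))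
  have hψ : Function.Injective ψ :=
    e.injective.comp (IsFractionRing.injective A (FractionRing A))
  refine ⟨ψ, hψ, ?_⟩
  obtain ⟨⟨f, g⟩, hfg⟩ := IsLocalization.surj (nonZeroDivisors A) (e.symm RatFunc.X)
  have : Nontrivial A := hψ.isDomain ψ.toRingHom |>.toNontrivial
  refine ⟨f, g, ?_, ?_⟩
  · rw [map_ne_zero_iff ψ hψ]
    exact nonZeroDivisors.ne_zero g.2
  · have h1 := congrArg e hfg
    rw [map_mul, e.apply_symm_apply] at h1
    exact h1.symm

/-- At a smooth point of a curve with function field inside `ℂ(t)`, the function `t` is a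
quotient of regular functions that do not both vanish at the point. -/
theorem exists_coords_of_smooth {A : Type*} [CommRing A] [Algebra ℂ A] [IsNoetherianRing A]
    {ψ : A →ₐ[ℂ] RatFunc ℂ} (hψ : Function.Injective ψ)
    (hX : ∃ f g : A, ψ g ≠ 0 ∧ ψ f = RatFunc.X * ψ g) {m : Ideal A} [m.IsPrime]
    (hm : Module.finrank ℂ m.Cotangent = 1) :
    ∃ f g : A, ψ f = RatFunc.X * ψ g ∧ (f ∉ m ∨ g ∉ m) := by
  have : IsDomain A := hψ.isDomain ψ.toRingHom
  obtain ⟨f₀, g₀, hg₀, hfg⟩ := hX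
  obtain ⟨u, hum, hu⟩ := exists_le_span_sup_sq hm
  obtain ⟨s, hs, c, h | h⟩ := exists_fraction_of_le_span_sup_sq m u hu hum f₀ g₀
  · refine ⟨c, s, mul_right_cancel₀ hg₀ ?_, Or.inr hs⟩
    have := congrArg ψ h
    rw [map_mul, map_mul, hfg] at this
    rw [← this]
    ring
  · refine ⟨s, c, mul_right_cancel₀ hg₀ ?_, Or.inl hs⟩
    have := congrArg ψ h
    rw [map_mul, map_mul, hfg] at this
    rw [this]
    ring

instance (X : FunSpace) (p : X.Pt) : (X.idealAt p).IsPrime :=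
  RingHom.ker_isPrime _

/-- The degree to which numerator and denominator of a rational function are homogenized. -/
noncomputable def ratDegree (r : RatFunc ℂ) : ℕ :=
  max r.num.natDegree r.denom.natDegree

/-- The homogenized numerator of a rational function. -/
noncomputable def homNum (r : RatFunc ℂ) : MvPolynomial (Fin 2) ℂ :=
  r.num.homogenize (ratDegree r)

/-- The homogenized denominator of a rational function. -/
noncomputable def homDenom (r : RatFunc ℂ) : MvPolynomial (Fin 2) ℂ :=
  r.denom.homogenize (ratDegree r)

theorem isWeightedHomogeneous_homNum (r : RatFunc ℂ) :
    MvPolynomial.IsWeightedHomogeneous (fun _ => 1) (homNum r) (ratDegree r) :=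
  Polynomial.isHomogeneous_homogenize _

theorem isWeightedHomogeneous_homDenom (r : RatFunc ℂ) :
    MvPolynomial.IsWeightedHomogeneous (fun _ => 1) (homDenom r) (ratDegree r) :=
  Polynomial.isHomogeneous_homogenize _

/-- In the function field t = f/g, and `x` is a quotient of polynomials in t. Homogenizing both to
the same degree clears the powers of `g`. -/
theorem mul_aeval_homDenom {A : Type*} [CommRing A] [Algebra ℂ A] {ψ : A →ₐ[ℂ] RatFunc ℂ}
    (hψ : Function.Injective ψ) {f g : A} (hfg : ψ f = RatFunc.X * ψ g) (x : A) :
    x * MvPolynomial.aeval ![f, g] (homDenom (ψ x)) =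
      MvPolynomial.aeval ![f, g] (homNum (ψ x)) := by
  apply hψ
  have hcomp : ∀ P : MvPolynomial (Fin 2) ℂ, ψ (MvPolynomial.aeval ![f, g] P) =
      MvPolynomial.aeval ![RatFunc.X * ψ g, ψ g] P := by
    intro P
    rw [MvPolynomial.comp_aeval_apply]
    congr 2
    funext i
    fin_cases i
    exacts [hfg, rfl]
  rw [map_mul, hcomp, hcomp, homNum, homDenom, ratDegree,
    aeval_homogenize_mul (le_max_left _ _), aeval_homogenize_mul (le_max_right _ _),
    RatFunc.aeval_X_left_eq_algebraMap,
    RatFunc.aeval_X_left_eq_algebraMap]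
  have hden : algebraMap (Polynomial ℂ) (RatFunc ℂ) (ψ x).denom ≠ 0 :=
    (map_ne_zero_iff _ (RatFunc.algebraMap_injective ℂ)).2 (RatFunc.denom_ne_zero _)
  have h1 := RatFunc.num_div_denom (ψ x)
  rw [div_eq_iff hden] at h1
  rw [h1]
  ring

/-- On a finite set the functions form a finite-dimensional algebra, so all are algebraic over ℂ;
then so would be t, a quotient of two of them. -/
theorem infinite_of_algHom_ratFunc {X : FunSpace} {ψ : X.functions →ₐ[ℂ] RatFunc ℂ}
    (hX : ∃ f g : X.functions, ψ g ≠ 0 ∧ ψ f = RatFunc.X * ψ g) : Infinite X.Pt := by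
  by_contra hfin
  rw [not_infinite_iff_finite] at hfin
  have hint : Algebra.IsIntegral ℂ X.functions := by
    have : Module.Finite ℂ X.functions :=
      Module.Finite.of_injective X.functions.val.toLinearMap Subtype.val_injective
    exact Algebra.IsIntegral.of_finite ℂ X.functions
  have halg : ∀ f : X.functions, IsAlgebraic ℂ (ψ f) := fun f =>
    ((hint.isIntegral f).map ψ).isAlgebraic
  obtain ⟨f, g, hg, hfg⟩ := hX
  have h1 : (RatFunc.X : RatFunc ℂ) = ψ f * (ψ g)⁻¹ := by
    rw [hfg, mul_inv_cancel_right₀ hg]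
  exact RatFunc.transcendental_X (h1 ▸ (halg f).mul (halg g).inv)

/-- A rational smooth affine curve is isomorphic to the complement of a non-empty finite subset of the projective line. -/
theorem exists_isIso_projLineMinus {Γ : FunSpace} (hΓ : IsRationalSmoothAffineCurve Γ) :
    ∃ (Λ : Set (ℙ ℂ (Fin 2 → ℂ))) (e : Γ.Pt ≃ (projLineMinus Λ).Pt), Λ.Finite ∧ Λ.Nonempty ∧
      IsIso Γ (projLineMinus Λ) e := by
  obtain ⟨n, j, hj⟩ := hΓ.affine
  obtain ⟨e⟩ := hΓ.rational
  have := isNoetherianRing_functions hj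
  obtain ⟨ψ, hψ, hX⟩ := exists_algHom_ratFunc e
  have hinf : Infinite Γ.Pt := infinite_of_algHom_ratFunc hX
  choose f g hfg hne using fun p => exists_coords_of_smooth hψ hX (hΓ.smooth p)
  have hne' : ∀ p, (![(f p).1 p, (g p).1 p] : Fin 2 → ℂ) ≠ 0 := by
    intro p
    rcases hne p with h | h
    · exact vec_ne_zero_of_fst h
    · exact vec_ne_zero_of_snd h
  -- `β` is the function t = f/g as a map to ℙ¹, with `f` and `g` chosen at each point so as not to
  -- vanish there simultaneously.
  let β : Γ.Pt → ℙ ℂ (Fin 2 → ℂ) := fun p => toProj ![(f p).1 p, (g p).1 p]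
  -- All pairs (f p, g p) represent the same t, so the pair chosen at `p` also computes `β` at
  -- nearby points.
  have hβ : ∀ p q, (![(f p).1 q, (g p).1 q] : Fin 2 → ℂ) ≠ 0 →
      β q = toProj ![(f p).1 q, (g p).1 q] := by
    intro p q h
    rw [toProj_eq_toProj_iff (hne' q) h]
    have h1 : f q * g p = g q * f p := by
      apply hψ
      rw [map_mul, map_mul, hfg, hfg]
      ring
    have h2 := congrFun (congrArg Subtype.val h1) q
    exact sub_eq_zero.2 h2
  have hβm : IsMorphism Γ projLine β := by
    refine isMorphism_iff_morphismAt.2 fun p => ?_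
    have hreg : ∀ i, Γ.RegAt (fun y => (![(f p).1 y, (g p).1 y] : Fin 2 → ℂ) i) p := by
      intro i
      fin_cases i
      exacts [(f p).2 p, (g p).2 p]
    refine HasCoordsAt.morphismAt (v := fun y => ![(f p).1 y, (g p).1 y]) ⟨hreg, ?_⟩
    filter_upwards [eventually_ne_zero hreg (hne' p)] with y hy
    exact ⟨hy, by rw [hβ p y hy, toProj_of_ne_zero hy]⟩
  let x : Fin n → Γ.functions := fun i =>
    ⟨fun p => j p i, regAt_coord_of_isClosedEmbedding hj i⟩
  have heval : ∀ (r : Fin n) (p : Γ.Pt),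
      j p r * MvPolynomial.eval (β p).rep (homDenom (ψ (x r))) =
        MvPolynomial.eval (β p).rep (homNum (ψ (x r))) := by
    intro r p
    have h1 := congrFun (congrArg Subtype.val (mul_aeval_homDenom hψ (hfg p) (x r))) p
    have h2 : ∀ P : MvPolynomial (Fin 2) ℂ, (MvPolynomial.aeval ![f p, g p] P).1 p =
        MvPolynomial.eval ![(f p).1 p, (g p).1 p] P := by
      intro P
      have hv : (fun i => evalFunctions Γ p (![f p, g p] i)) = ![(f p).1 p, (g p).1 p] := by
        ext i
        fin_cases i <;> rfl
      exact (MvPolynomial.comp_aeval_apply _ (evalFunctions Γ p) P).trans (by rw [hv]; rfl)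
    have h3 : j p r * (MvPolynomial.aeval ![f p, g p] (homDenom (ψ (x r)))).1 p =
        (MvPolynomial.aeval ![f p, g p] (homNum (ψ (x r)))).1 p := h1
    rw [h2, h2] at h3
    obtain ⟨c, hc⟩ := Projectivization.exists_smul_eq_mk_rep ℂ _ (hne' p)
    rw [← toProj_of_ne_zero (hne' p)] at hc
    change c • _ = (β p).rep at hc
    rw [← hc, Units.smul_def,
      eval_smul_of_isWeightedHomogeneous_one (isWeightedHomogeneous_homDenom _),
      eval_smul_of_isWeightedHomogeneous_one (isWeightedHomogeneous_homNum _), ← h3]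
    ring
  -- A zero denominator would make the numerator zero as well, and the two have no common zero.
  have hden : ∀ (r : Fin n) (p : Γ.Pt), MvPolynomial.eval (β p).rep (homDenom (ψ (x r))) ≠ 0 := by
    intro r p h0
    have h1 := heval r p
    rw [h0, mul_zero] at h1
    exact eval_homogenize_ne_zero_of_isCoprime (RatFunc.isCoprime_num_denom _) (β p).rep_nonzero
      h1.symm h0
  -- `Λ` collects the poles of the coordinate functions of the curve, viewed as rational functions
  -- of t; away from it they define the inverse `α`.
  let Λ : Set (ℙ ℂ (Fin 2 → ℂ)) :=
    ⋃ r : Fin n, {q | MvPolynomial.eval q.rep (homDenom (ψ (x r))) = 0}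
  have hΛ : ∀ q, q ∈ Λᶜ → ∀ r, MvPolynomial.eval q.rep (homDenom (ψ (x r))) ≠ 0 :=
    fun q hq r h => hq (Set.mem_iUnion.2 ⟨r, h⟩)
  have hβΛ : ∀ p, β p ∈ Λᶜ := by
    intro p hp
    obtain ⟨r, hr⟩ := Set.mem_iUnion.1 hp
    exact hden r p hr
  obtain ⟨p₀⟩ : Nonempty Γ.Pt := inferInstance
  have hfin : Λ.Finite := Set.finite_iUnion fun r =>
    finite_zeros (isWeightedHomogeneous_homDenom _) (hden r p₀)
  let α : ℙ ℂ (Fin 2 → ℂ) → Fin n → ℂ := fun q r =>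
    MvPolynomial.eval q.rep (homNum (ψ (x r))) / MvPolynomial.eval q.rep (homDenom (ψ (x r)))
  have hαβ : ∀ p, α (β p) = j p := by
    intro p
    ext r
    exact div_eq_of_eq_mul (hden r p) (heval r p).symm
  have hβinj : Function.Injective β := by
    intro p q hpq
    exact hj.2.injective (by rw [← hαβ p, ← hαβ q, hpq])
  have hαm : IsMorphism (projLineMinus Λ) (affineSpace n)
      (fun q : (Λᶜ : Set (ℙ ℂ (Fin 2 → ℂ))) => α q.1) := by
    refine isMorphism_iff_morphismAt.2 fun q => morphismAt_affineSpace fun r =>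
      (morphismAt_val projLine Λᶜ q).2 (fun q => α q r) ?_
    exact ⟨_, _, _, isWeightedHomogeneous_homNum _, isWeightedHomogeneous_homDenom _,
      hΛ q.1 q.2 r, Filter.Eventually.of_forall fun _ => rfl⟩
  let β' : Γ.Pt → (Λᶜ : Set (ℙ ℂ (Fin 2 → ℂ))) := fun p => ⟨β p, hβΛ p⟩
  have hβ'inf : (Set.range β').Infinite :=
    Set.infinite_range_of_injective fun p q h => hβinj (congrArg Subtype.val h)
  -- The preimage of the closed curve under `α` is closed and contains the infinite image of `β`, so
  -- `α` maps all of ℙ¹ ∖ Λ into the curve.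
  have hrange : ∀ q : (Λᶜ : Set (ℙ ℂ (Fin 2 → ℂ))), ∃ p, j p = α q.1 := by
    have hcl := hj.2.isClosed_range.preimage hαm.1
    have := eq_univ_of_isClosed_of_infinite hcl (hβ'inf.mono ?_)
    · exact fun q => Set.eq_univ_iff_forall.1 this q
    · rintro _ ⟨p, rfl⟩
      exact ⟨p, (hαβ p).symm⟩
  choose γ hγ using hrange
  have hγm : IsMorphism (projLineMinus Λ) Γ γ := by
    refine hj.isMorphism_of_comp ?_
    have h : (fun q => j (γ q)) = fun q : (Λᶜ : Set (ℙ ℂ (Fin 2 → ℂ))) => α q.1 := funext hγ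
    exact h ▸ hαm
  have hγβ : ∀ p, γ (β' p) = p := fun p => hj.2.injective ((hγ _).trans (hαβ p))
  -- The identity holds on the infinite image of `β`, hence everywhere.
  have hβγ : ∀ q, β' (γ q) = q := by
    have hcl := isClosed_setOf_eq_of_isMorphism (hβm.comp hγm)
      (isMorphism_iff_morphismAt.2 (morphismAt_val projLine Λᶜ))
    have := eq_univ_of_isClosed_of_infinite hcl (hβ'inf.mono ?_)
    · exact fun q => Subtype.ext (Set.eq_univ_iff_forall.1 this q)
    · rintro _ ⟨p, rfl⟩
      exact congrArg β (hγβ p)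
  refine ⟨Λ, ⟨β', γ, hγβ, hβγ⟩, hfin, ?_, ⟨isMorphism_iff_morphismAt.2 fun p =>
    morphismAt_restrict (hβm.morphismAt p), hγm⟩⟩
  by_contra hemp
  rw [Set.not_nonempty_iff_eq_empty] at hemp
  -- Without poles every coordinate function is constant as a function of t, so `j` would be
  -- constant on an infinite set although it is injective.
  have hdeg : ∀ r, ratDegree (ψ (x r)) = 0 := by
    intro r
    by_contra h0
    obtain ⟨v, hv, hv0⟩ := exists_zero_homogenize (le_max_right _ _) h0
    refine hΛ (toProj v) (by rw [hemp]; exact Set.notMem_empty _) r ?_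
    obtain ⟨c, hc⟩ := Projectivization.exists_smul_eq_mk_rep ℂ v hv
    rw [toProj_of_ne_zero hv, ← hc, Units.smul_def,
      eval_smul_of_isWeightedHomogeneous_one (isWeightedHomogeneous_homDenom _)]
    exact mul_eq_zero_of_right _ hv0
  have hconst : ∀ (r : RatFunc ℂ), ratDegree r = 0 → ∀ v w : Fin 2 → ℂ,
      MvPolynomial.eval v (homNum r) = MvPolynomial.eval w (homNum r) ∧
      MvPolynomial.eval v (homDenom r) = MvPolynomial.eval w (homDenom r) := by
    intro r hr v w
    have h1 := Polynomial.eq_C_of_natDegree_le_zero ((le_max_left _ _).trans hr.le)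
    have h2 := Polynomial.eq_C_of_natDegree_le_zero ((le_max_right _ _).trans hr.le)
    rw [homNum, homDenom, hr, h1, h2]
    simp
  obtain ⟨p, q, hpq⟩ := exists_pair_ne Γ.Pt
  refine hpq (hj.2.injective ?_)
  rw [← hαβ p, ← hαβ q]
  refine funext fun r => ?_
  obtain ⟨h1, h2⟩ := hconst _ (hdeg r) (β p).rep (β q).rep
  simp only [α, h1, h2]

/-! ### The theorem -/

theorem theorem1 :
    -- every rational smooth affine curve
    (∀ Γ : FunSpace, IsRationalSmoothAffineCurve Γ →
      ∃ (ρ : Γ.Aut →* GL (Fin 3) ℂ) (τ : Γ.Pt → Fin 3 → ℂ), IsEquivariantEmbedding Γ ρ τ) ∧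
    -- the affine line: `Aut` consists of the maps `t ↦ a t + b`
    ((∀ φ : (affineSpace 1).Aut, ∃ a b : ℂ, a ≠ 0 ∧ ∀ t : Fin 1 → ℂ, φ.1 t = ![a * t 0 + b]) ∧
      (∀ a b : ℂ, a ≠ 0 →
        ∃ φ : (affineSpace 1).Aut, ∀ t : Fin 1 → ℂ, φ.1 t = ![a * t 0 + b]) ∧
      ∃ ρ : (affineSpace 1).Aut →* GL (Fin 3) ℂ,
        (∀ (φ : (affineSpace 1).Aut) (a b : ℂ), (∀ t : Fin 1 → ℂ, φ.1 t = ![a * t 0 + b]) →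
          (ρ φ : Matrix (Fin 3) (Fin 3) ℂ) = !![a, b, 0; 0, 1, 0; 0, 0, 1]) ∧
        IsEquivariantEmbedding (affineSpace 1) ρ (fun t : Fin 1 → ℂ => ![t 0, 1, 0])) ∧
    -- the punctured line: `Aut` consists of the maps `t ↦ l t` and `t ↦ l t⁻¹`
    ((∀ φ : punctLine.Aut, ∃ l : ℂ, l ≠ 0 ∧
        ((∀ t : {t : Fin 1 → ℂ | t 0 ≠ 0}, (φ.1 t).1 = ![l * t.1 0]) ∨
          ∀ t : {t : Fin 1 → ℂ | t 0 ≠ 0}, (φ.1 t).1 = ![l * (t.1 0)⁻¹])) ∧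
      (∀ l : ℂ, l ≠ 0 →
        (∃ φ : punctLine.Aut, ∀ t : {t : Fin 1 → ℂ | t 0 ≠ 0}, (φ.1 t).1 = ![l * t.1 0]) ∧
        ∃ φ : punctLine.Aut, ∀ t : {t : Fin 1 → ℂ | t 0 ≠ 0}, (φ.1 t).1 = ![l * (t.1 0)⁻¹]) ∧
      ∃ ρ : punctLine.Aut →* GL (Fin 3) ℂ,
        (∀ (φ : punctLine.Aut) (l : ℂ),
          (∀ t : {t : Fin 1 → ℂ | t 0 ≠ 0}, (φ.1 t).1 = ![l * t.1 0]) →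
          (ρ φ : Matrix (Fin 3) (Fin 3) ℂ) = !![l, 0, 0; 0, l⁻¹, 0; 0, 0, 1]) ∧
        (∀ (φ : punctLine.Aut) (l : ℂ),
          (∀ t : {t : Fin 1 → ℂ | t 0 ≠ 0}, (φ.1 t).1 = ![l * (t.1 0)⁻¹]) →
          (ρ φ : Matrix (Fin 3) (Fin 3) ℂ) = !![0, l, 0; l⁻¹, 0, 0; 0, 0, 1]) ∧
        IsEquivariantEmbedding punctLine ρ
          (fun t : {t : Fin 1 → ℂ | t 0 ≠ 0} => ![t.1 0, (t.1 0)⁻¹, 0])) ∧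
    -- the embedding of `(ℙ¹ × ℙ¹) ∖ Δ`, and the projective line minus at least three points
    (∃ (ι : {p : ℙ ℂ (Fin 2 → ℂ) × ℙ ℂ (Fin 2 → ℂ) | p.1 ≠ p.2} → Fin 3 → ℂ)
      (R : PGL(2, ℂ) →* GL (Fin 3) ℂ),
      (∀ (y z : Fin 2 → ℂ) (hy : y ≠ 0) (hz : z ≠ 0)
        (h : Projectivization.mk ℂ y hy ≠ Projectivization.mk ℂ z hz),
        ι ⟨(Projectivization.mk ℂ y hy, Projectivization.mk ℂ z hz), h⟩ =
          ![(y 0 * z 1 + y 1 * z 0) / (y 0 * z 1 - y 1 * z 0),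
            2 * y 0 * z 0 / (y 0 * z 1 - y 1 * z 0),
            2 * y 1 * z 1 / (y 0 * z 1 - y 1 * z 0)]) ∧
      FunSpace.IsClosedEmbedding projLineSqMinusDiag (affineSpace 3) ι ∧
      Set.range ι = {v : Fin 3 → ℂ | v 1 * v 2 = v 0 ^ 2 - 1} ∧
      (∀ g : GL (Fin 2) ℂ, (R (Matrix.ProjGenLinGroup.mk g) : Matrix (Fin 3) (Fin 3) ℂ) =
        (g 0 0 * g 1 1 - g 0 1 * g 1 0)⁻¹ •
          !![g 0 0 * g 1 1 + g 0 1 * g 1 0, g 0 0 * g 1 0, g 0 1 * g 1 1;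
             2 * g 0 0 * g 0 1, g 0 0 ^ 2, g 0 1 ^ 2;
             2 * g 1 0 * g 1 1, g 1 0 ^ 2, g 1 1 ^ 2]) ∧
      (∀ (h : PGL(2, ℂ)) (p q : ℙ ℂ (Fin 2 → ℂ)) (hpq : p ≠ q) (hpq' : h • p ≠ h • q),
        ι ⟨(h • p, h • q), hpq'⟩ = (R h : Matrix (Fin 3) (Fin 3) ℂ) *ᵥ ι ⟨(p, q), hpq⟩) ∧
      ∀ Λ : Set (ℙ ℂ (Fin 2 → ℂ)), Λ.Finite → 3 ≤ Λ.ncard →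
        ∃ e : (projLineMinus Λ).Aut ≃* MulAction.stabilizer PGL(2, ℂ) Λ,
          (∀ (φ : (projLineMinus Λ).Aut) (q : (Λᶜ : Set (ℙ ℂ (Fin 2 → ℂ)))),
            (φ.1 q).1 = (e φ).1 • q.1) ∧
          (∃ δ : ℙ ℂ (Fin 2 → ℂ) → ℙ ℂ (Fin 2 → ℂ), FunSpace.IsMorphism projLine projLine δ ∧
            (∀ h ∈ MulAction.stabilizer PGL(2, ℂ) Λ, ∀ q, δ (h • q) = h • δ q) ∧
            ∀ q, δ q = q ↔ q ∈ Λ) ∧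
          ∀ δ : ℙ ℂ (Fin 2 → ℂ) → ℙ ℂ (Fin 2 → ℂ), FunSpace.IsMorphism projLine projLine δ →
            (∀ h ∈ MulAction.stabilizer PGL(2, ℂ) Λ, ∀ q, δ (h • q) = h • δ q) →
            ∀ hfix : ∀ q, δ q = q ↔ q ∈ Λ,
              IsEquivariantEmbedding (projLineMinus Λ)
                (R.comp ((MulAction.stabilizer PGL(2, ℂ) Λ).subtype.comp e.toMonoidHom))
                (fun q : (Λᶜ : Set (ℙ ℂ (Fin 2 → ℂ))) =>
                  ι ⟨(q.1, δ q.1), fun hq => q.2 ((hfix q.1).1 hq.symm)⟩)) := by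
  refine ⟨fun Γ hΓ => ?_, ⟨affineLine_aut_eq, affineLine_exists_aut, exists_affineLine_action⟩,
    ⟨punctLine_aut_eq, fun l hl => ⟨punctLine_exists_aut_mul hl, punctLine_exists_aut_inv hl⟩,
      exists_punctLine_action⟩, quadricMap, quadricAction, quadricMap_mk,
    isClosedEmbedding_quadricMap, range_quadricMap, quadricAction_mk, quadricMap_smul,
    fun Λ hΛ h3 => ⟨autEquivStabilizer hΛ, autEquivStabilizer_apply hΛ,
      exists_equivariant_map hΛ (Set.nonempty_of_ncard_ne_zero (by lia)),
      fun δ hδ hequiv hfix => isEquivariantEmbedding_of_equivariant_map hΛ hδ hequiv hfix⟩⟩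
  -- No case distinction on the size of `Λ` is needed: the graph construction works for every finite
  -- non-empty set.
  obtain ⟨Λ, e, hfin, hne, he⟩ := exists_isIso_projLineMinus hΓ
  obtain ⟨δ, hδ, hequiv, hfix⟩ := exists_equivariant_map hfin hne
  exact ⟨_, _, (isEquivariantEmbedding_of_equivariant_map hfin hδ hequiv hfix).comp_isIso he⟩
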